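/- Let $n\ge 1$, $T>0$, $r\in(0,1)$, and let $B_s(x_0)$ denote the open ball in $\mathbb{R}^n$ and $e_1$ the first standard basis vector. Put $U=B_{T+4}(0)\setminus\overline{B_1(0)}\subset\mathbb{R}^n$, $X_+=(0,T)\times U$ and $Y=(-T,T)\times B_r(-2e_1)$, both subsets of $\mathbb{R}^{1+n}$. All function spaces are complex-valued, and $0^0=1$. For $W\subset\mathbb{R}^{d}$ open and $\sigma\ge 1$, $G^\sigma(W)$ is the set of $f\in C^\infty(W)$ such that for every compact $K\subset W$ there is $C>0$ with $\max_K|\partial^\alpha f|\le C^{1+|\alpha|}|\alpha|^{\sigma|\alpha|}$ for all multi-indices $\alpha$. For a closed (compact, boundaryless) real-analytic manifold $N$ of dimension $d$ with a real-analytic Riemannian metric $g$, $G^\sigma(N)$ is the set of $u\in C^\infty(N)$ for which there is $C>0$ with $\|\nabla^k u\|_{L^\infty(N)}\le C^{k+1}k^{\sigma k}$ for all $k\ge 0$, where $\nabla$ is the Levi-Civita connection. Let $(\varphi_j)_{j\ge0}$ be an orthonormal basis of $L^2(N)$ of eigenfunctions of $-\Delta_g$, ordered so that the eigenvalues are nondecreasing.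 For $\rho>0$, $A^{\sigma,\rho}(N)$ is the Banach space of all $u\in L^2(N)$ with $$\|u\|_{A^{\sigma,\rho}(N)}=\Big(\sum_{j=0}^\infty e^{2\rho j^{1/(d\sigma)}}|\langle u,\varphi_j\rangle|^2\Big)^{1/2}<\infty.$$ **Proposition.** Let $\sigma>1$ and let $(N,g)$ be a closed analytic manifold of dimension $n+1$ that contains $Y$ as an open analytic submanifold (no relation between $g$ and the Euclidean metric on $Y$ is assumed). Let $F\colon L^2(X_+)\to L^2(Y)$ be linear and continuous, with $Fu\in G^\sigma(Y)$ for all $u\in L^2(X_+)$. Then for every $\chi\in G^\sigma(N)\cap C_c^\infty(Y)$ there is $\rho>0$, which can be chosen independently of the ordered eigenbasis $(\varphi_j)$, such that $u\mapsto\chi Fu$ (extended by $0$ to $N\setminus Y$) is a continuous linear map from $L^2(X_+)$ into $A^{\sigma,\rho}(N)$. -/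

import Mathlib

open scoped Manifold ContDiff Topology
open MeasureTheory Bundle

noncomputable section

/-- The Euclidean space `ℝ^d`. -/
abbrev Euc (d : ℕ) : Type := EuclideanSpace ℝ (Fin d)

/-- The `i`-th standard basis vector of `ℝ^d`. -/
def stdVec {d : ℕ} (i : Fin d) : Euc d := EuclideanSpace.single i 1

/-- The partial derivative `∂_i f` at `x`. -/
def partialDeriv {d : ℕ} {V : Type*} [NormedAddCommGroup V] [NormedSpace ℝ V]
    (i : Fin d) (f : Euc d → V) (x : Euc d) : V :=
  fderiv ℝ f x (stdVec i)

/-! ### The space-time sets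

A point of space-time `ℝ × ℝ^n` is a vector `z = (t, x)` of `ℝ^(n+1)`, with `t = z 0`. -/

/-- The spatial part `x` of `z = (t, x)`. -/
def spacePart {n : ℕ} (z : Euc (n + 1)) : Euc n :=
  WithLp.toLp 2 fun i : Fin n => z i.succ

/-- `U = B_{T+4}(0) \ 𝒪`, with the obstacle `𝒪` the closed unit ball. -/
def domainU (n : ℕ) (T : ℝ) : Set (Euc n) :=
  Metric.ball 0 (T + 4) \ Metric.closedBall 0 1

/-- `X₊ = (0, T) × U`. -/
def domainXPlus (n : ℕ) (T : ℝ) : Set (Euc (n + 1)) :=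
  {z | z 0 ∈ Set.Ioo 0 T ∧ spacePart z ∈ domainU n T}

/-- `Y = (-T, T) × B_r(-2 e₁)`. -/
def domainY (n : ℕ) [NeZero n] (T r : ℝ) : Set (Euc (n + 1)) :=
  {z | z 0 ∈ Set.Ioo (-T) T ∧
    spacePart z ∈ Metric.ball ((-2 : ℝ) • stdVec (0 : Fin n)) r}

/-- The complex Hilbert space `L²(W)` with respect to Lebesgue measure. -/
abbrev L2 {d : ℕ} (W : Set (Euc d)) : Type := Lp ℂ 2 (volume.restrict W)

/-- The Gevrey space `G^σ(W)`, for `W ⊆ ℝ^d` open. The tuple `I` runs through all sequences of `k`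
coordinate directions, so `∂_{I 0} ⋯ ∂_{I (k-1)} f` runs through all `∂^α f` with `|α| = k`. -/
def IsGevreyOn {d : ℕ} (σ : ℝ) (f : Euc d → ℂ) (W : Set (Euc d)) : Prop :=
  ContDiffOn ℝ ∞ f W ∧
    ∀ K : Set (Euc d), IsCompact K → K ⊆ W → ∃ C : ℝ, 0 < C ∧
      ∀ (k : ℕ) (I : Fin k → Fin d), ∀ x ∈ K,
        ‖iteratedFDeriv ℝ k f x (fun m => stdVec (I m))‖ ≤ C ^ (1 + k) * (k : ℝ) ^ (σ * k)

/-! ### Real-analytic Riemannian manifolds -/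

section Manifold

variable {d : ℕ} {N : Type*} [TopologicalSpace N] [ChartedSpace (Euc d) N]

variable (d N) in
/-- The charts of the analytic manifold `N`: all charts of its maximal real-analytic atlas. -/
def analyticCharts : Set (OpenPartialHomeomorph N (Euc d)) :=
  IsManifold.maximalAtlas 𝓘(ℝ, Euc d) ω N

variable [IsManifold 𝓘(ℝ, Euc d) ω N]

variable (d N) in
/-- A real-analytic Riemannian metric on `N`. -/
abbrev AnalyticMetric : Type _ :=
  ContMDiffRiemannianMetric 𝓘(ℝ, Euc d) ω (Euc d) (fun p : N => TangentSpace 𝓘(ℝ, Euc d) p)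

/-- The matrix `(g_{ij}(x))` of the metric in the chart `c`. -/
def gram (g : AnalyticMetric d N) (c : OpenPartialHomeomorph N (Euc d)) (x : Euc d) :
    Matrix (Fin d) (Fin d) ℝ :=
  Matrix.of fun i j => g.inner (c.symm x)
    (mfderiv 𝓘(ℝ, Euc d) 𝓘(ℝ, Euc d) c.symm x (stdVec i))
    (mfderiv 𝓘(ℝ, Euc d) 𝓘(ℝ, Euc d) c.symm x (stdVec j))

/-- The inverse matrix `(g^{ij}(x))`. -/
def gramInv (g : AnalyticMetric d N) (c : OpenPartialHomeomorph N (Euc d)) (x : Euc d) :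
    Matrix (Fin d) (Fin d) ℝ :=
  (gram g c x)⁻¹

/-- The Riemannian density `√(det g_{ij}(x))`. -/
def volDensity (g : AnalyticMetric d N) (c : OpenPartialHomeomorph N (Euc d)) (x : Euc d) : ℝ :=
  Real.sqrt (gram g c x).det

/-- The measure `√(det g_{ij}) dx` of the chart `c`, transported to the domain of `c`. -/
def chartVolume [MeasurableSpace N] (g : AnalyticMetric d N)
    (c : OpenPartialHomeomorph N (Euc d)) : Measure N :=
  Measure.map c.symm
    ((volume.restrict c.target).withDensity fun x => ENNReal.ofReal (volDensity g c x))

/-- The Riemannian volume measure. The measures of the charts agree on overlaps, so that their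
least upper bound is the measure which is `√(det g_{ij}) dx` in every chart. -/
def riemannianVolume [MeasurableSpace N] (g : AnalyticMetric d N) : Measure N :=
  ⨆ c ∈ analyticCharts d N, chartVolume g c

/-- The Hilbert space `L²(N)` of the Riemannian manifold `(N, g)`. -/
abbrev RiemL2 [MeasurableSpace N] (g : AnalyticMetric d N) : Type _ :=
  Lp ℂ 2 (riemannianVolume g)

/-- The Laplace-Beltrami operator in the chart `c`,
`Δ_g u = (det g)^{-1/2} ∑_{i,j} ∂_i ((det g)^{1/2} g^{ij} ∂_j u)`. -/
def chartLaplacian (g : AnalyticMetric d N) (c : OpenPartialHomeomorph N (Euc d))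
    (u : N → ℂ) (x : Euc d) : ℂ :=
  ((volDensity g c x)⁻¹ : ℝ) • ∑ i, ∑ j,
    partialDeriv i (fun y => (volDensity g c y * gramInv g c y i j) •
      partialDeriv j (fun z => u (c.symm z)) y) x

/-- `u` is smooth and `-Δ_g u = ev u` on `N`. -/
def IsLaplaceEigenfunction (g : AnalyticMetric d N) (u : N → ℂ) (ev : ℝ) : Prop :=
  ContMDiff 𝓘(ℝ, Euc d) 𝓘(ℝ, ℂ) ∞ u ∧
    ∀ c ∈ analyticCharts d N, ∀ x ∈ c.target, -chartLaplacian g c u x = ev • u (c.symm x)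

/-- The Christoffel symbol `Γ^l_{ij}` of the Levi-Civita connection in the chart `c`. -/
def christoffel (g : AnalyticMetric d N) (c : OpenPartialHomeomorph N (Euc d))
    (l i j : Fin d) (x : Euc d) : ℝ :=
  (1 / 2) * ∑ m, gramInv g c x l m *
    (partialDeriv i (fun y => gram g c y j m) x + partialDeriv j (fun y => gram g c y i m) x
      - partialDeriv m (fun y => gram g c y i j) x)

/-- The components of `∇^k u` in the chart `c`:
`(∇T)_{i₀ i₁ … i_k} = ∂_{i₀} T_{i₁ … i_k} - ∑_m ∑_l Γ^l_{i₀ i_m} T_{i₁ … l … i_k}`,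
with `l` in the place of `i_m`. -/
def covDeriv (g : AnalyticMetric d N) (c : OpenPartialHomeomorph N (Euc d)) (u : N → ℂ) :
    (k : ℕ) → (Fin k → Fin d) → Euc d → ℂ
  | 0, _, x => u (c.symm x)
  | k + 1, I, x =>
    partialDeriv (I 0) (covDeriv g c u k (Fin.tail I)) x
      - ∑ m : Fin k, ∑ l : Fin d, christoffel g c l (I 0) (I m.succ) x •
          covDeriv g c u k (Function.update (Fin.tail I) m l) x

/-- The pointwise norm `|∇^k u|_g`, with
`|T|_g² = ∑ g^{i₁ j₁} ⋯ g^{i_k j_k} T_{i₁ … i_k} conj(T_{j₁ … j_k})`. -/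
def covDerivNorm (g : AnalyticMetric d N) (c : OpenPartialHomeomorph N (Euc d)) (u : N → ℂ)
    (k : ℕ) (x : Euc d) : ℝ :=
  Real.sqrt (∑ I : Fin k → Fin d, ∑ J : Fin k → Fin d,
    (∏ m, gramInv g c x (I m) (J m)) •
      (covDeriv g c u k I x * starRingEnd ℂ (covDeriv g c u k J x))).re

/-- The Gevrey space `G^σ(N)`: smooth `u` with `‖∇^k u‖_{L^∞(N)} ≤ C^{k+1} k^{σ k}` for all `k`. -/
def IsGevrey (g : AnalyticMetric d N) (σ : ℝ) (u : N → ℂ) : Prop :=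
  ContMDiff 𝓘(ℝ, Euc d) 𝓘(ℝ, ℂ) ∞ u ∧
    ∃ C : ℝ, 0 < C ∧ ∀ k : ℕ, ∀ c ∈ analyticCharts d N, ∀ x ∈ c.target,
      covDerivNorm g c u k x ≤ C ^ (k + 1) * (k : ℝ) ^ (σ * k)

/-! ### The spaces `A^{σ,ρ}` -/

/-- An orthonormal basis `(φ_j)_{j ∈ ℕ}` of `L²(N)` that consists of eigenfunctions of `-Δ_g`, with
eigenvalues in nondecreasing order, counted with multiplicity. -/
structure LaplaceEigenbasis [MeasurableSpace N] (g : AnalyticMetric d N) where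
  /-- the orthonormal basis -/
  basis : HilbertBasis ℕ ℂ (RiemL2 g)
  /-- the smooth representatives -/
  fn : ℕ → N → ℂ
  /-- the eigenvalues of `-Δ_g` -/
  eigenvalue : ℕ → ℝ
  basis_ae_eq : ∀ j, basis j =ᵐ[riemannianVolume g] fn j
  isEigenfunction : ∀ j, IsLaplaceEigenfunction g (fn j) (eigenvalue j)
  monotone : Monotone eigenvalue

variable [MeasurableSpace N] {g : AnalyticMetric d N}

/-- The weight `e^{ρ j^{1/(dσ)}}`. -/
def gevreyWeight (d : ℕ) (σ ρ : ℝ) (j : ℕ) : ℝ :=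
  Real.exp (ρ * (j : ℝ) ^ (1 / (d * σ)))

/-- `u ∈ A^{σ,ρ}(N)`: the series `∑_j e^{2ρ j^{1/(dσ)}} |⟨u, φ_j⟩|²` converges. -/
def MemA (B : LaplaceEigenbasis g) (σ ρ : ℝ) (u : RiemL2 g) : Prop :=
  Summable fun j : ℕ =>
    Real.exp (2 * ρ * (j : ℝ) ^ (1 / (d * σ))) * ‖inner ℂ (B.basis j) u‖ ^ 2

/-- The weighted coefficients `e^{ρ j^{1/(dσ)}} ⟨u, φ_j⟩`. -/
def wcoeff (B : LaplaceEigenbasis g) (σ ρ : ℝ) (u : RiemL2 g) (j : ℕ) : ℂ :=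
  (gevreyWeight d σ ρ j : ℂ) * inner ℂ (B.basis j) u

theorem norm_wcoeff_sq (B : LaplaceEigenbasis g) (σ ρ : ℝ) (u : RiemL2 g) (j : ℕ) :
    ‖wcoeff B σ ρ u j‖ ^ 2 =
      Real.exp (2 * ρ * (j : ℝ) ^ (1 / (d * σ))) * ‖inner ℂ (B.basis j) u‖ ^ 2 := by
  rw [wcoeff, norm_mul, mul_pow, Complex.norm_real, Real.norm_eq_abs, sq_abs, gevreyWeight,
    ← Real.exp_nat_mul]
  congr 2
  push_cast
  ring

theorem memA_iff (B : LaplaceEigenbasis g) (σ ρ : ℝ) (u : RiemL2 g) :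
    MemA B σ ρ u ↔ Memℓp (wcoeff B σ ρ u) 2 := by
  rw [memℓp_gen_iff (by norm_num)]
  unfold MemA
  refine summable_congr fun j => ?_
  rw [← norm_wcoeff_sq]
  norm_num

theorem wcoeff_add (B : LaplaceEigenbasis g) (σ ρ : ℝ) (u v : RiemL2 g) :
    wcoeff B σ ρ (u + v) = wcoeff B σ ρ u + wcoeff B σ ρ v := by
  funext j
  simp only [wcoeff, inner_add_right, Pi.add_apply]
  ring

theorem wcoeff_smul (B : LaplaceEigenbasis g) (σ ρ : ℝ) (a : ℂ) (u : RiemL2 g) :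
    wcoeff B σ ρ (a • u) = a • wcoeff B σ ρ u := by
  funext j
  simp only [wcoeff, inner_smul_right, Pi.smul_apply, smul_eq_mul]
  ring

/-- `A^{σ,ρ}(N)` as a subspace of `L²(N)`. -/
def submoduleA (B : LaplaceEigenbasis g) (σ ρ : ℝ) : Submodule ℂ (RiemL2 g) where
  carrier := {u | MemA B σ ρ u}
  zero_mem' := by simp [MemA, summable_zero]
  add_mem' := by
    intro u v hu hv
    simp only [Set.mem_ofPred_eq, memA_iff] at hu hv ⊢
    rw [wcoeff_add]
    exact hu.add hv
  smul_mem' := by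
    intro a u hu
    simp only [Set.mem_ofPred_eq, memA_iff] at hu ⊢
    rw [wcoeff_smul]
    exact hu.const_smul a

/-- The space `A^{σ,ρ}(N)`, which carries its own norm and not the one of `L²(N)`. -/
def SpaceA (B : LaplaceEigenbasis g) (σ ρ : ℝ) : Type _ := submoduleA B σ ρ

namespace SpaceA

variable (B : LaplaceEigenbasis g) (σ ρ : ℝ)

instance : AddCommGroup (SpaceA B σ ρ) := inferInstanceAs (AddCommGroup (submoduleA B σ ρ))

instance : Module ℂ (SpaceA B σ ρ) := inferInstanceAs (Module ℂ (submoduleA B σ ρ))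

variable {B σ ρ} in
/-- An element of `A^{σ,ρ}(N)` as an element of `L²(N)`. -/
def val (u : SpaceA B σ ρ) : RiemL2 g := Subtype.val u

variable {B σ ρ} in
theorem val_add (u v : SpaceA B σ ρ) : (u + v).val = u.val + v.val := rfl

variable {B σ ρ} in
theorem val_smul (a : ℂ) (u : SpaceA B σ ρ) : (a • u).val = a • u.val := rfl

/-- `‖u‖_{A^{σ,ρ}} = (∑_j e^{2ρ j^{1/(dσ)}} |⟨u, φ_j⟩|²)^{1/2}`. -/
instance : Norm (SpaceA B σ ρ) where
  norm u := Real.sqrt (∑' j : ℕ,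
    Real.exp (2 * ρ * (j : ℝ) ^ (1 / (d * σ))) * ‖inner ℂ (B.basis j) u.val‖ ^ 2)

/-- The weighted coefficients as an element of `ℓ²`. -/
def toSeq : SpaceA B σ ρ →ₗ[ℂ] lp (fun _ : ℕ => ℂ) 2 where
  toFun u := ⟨wcoeff B σ ρ u.val, (memA_iff B σ ρ u.val).1 (Subtype.property u)⟩
  map_add' u v := by
    ext j
    exact congrFun (wcoeff_add B σ ρ u.val v.val) j
  map_smul' a u := by
    ext j
    exact congrFun (wcoeff_smul B σ ρ a u.val) j

theorem norm_toSeq (u : SpaceA B σ ρ) : ‖toSeq B σ ρ u‖ = ‖u‖ := by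
  rw [lp.norm_eq_tsum_rpow (by norm_num)]
  change _ = Real.sqrt _
  rw [Real.sqrt_eq_rpow]
  have h : ∀ j, ‖(toSeq B σ ρ u : ℕ → ℂ) j‖ ^ (2 : ENNReal).toReal =
      Real.exp (2 * ρ * (j : ℝ) ^ (1 / (d * σ))) * ‖inner ℂ (B.basis j) u.val‖ ^ 2 := by
    intro j
    rw [← norm_wcoeff_sq, ENNReal.toReal_ofNat, Real.rpow_ofNat]
    rfl
  rw [ENNReal.toReal_ofNat]
  congr 1
  exact tsum_congr h

theorem toSeq_injective : Function.Injective (toSeq B σ ρ) := by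
  rw [← LinearMap.ker_eq_bot, LinearMap.ker_eq_bot']
  intro u hu
  have h : ∀ j, inner ℂ (B.basis j) u.val = 0 := by
    intro j
    have h1 : wcoeff B σ ρ u.val j = 0 :=
      congrArg (fun a : lp (fun _ : ℕ => ℂ) 2 => (a : ℕ → ℂ) j) hu
    rcases mul_eq_zero.1 h1 with h2 | h2
    · exact absurd (Complex.ofReal_eq_zero.1 h2) (Real.exp_pos _).ne'
    · exact h2
  have h0 : u.val = 0 := by
    apply B.basis.repr.injective
    ext j
    rw [B.basis.repr_apply_apply, h j]
    simp
  exact Subtype.ext h0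

theorem normCore : NormedSpace.Core ℂ (SpaceA B σ ρ) where
  norm_nonneg u := Real.sqrt_nonneg _
  norm_smul a u := by
    rw [← norm_toSeq, ← norm_toSeq, map_smul, norm_smul]
  norm_triangle u v := by
    rw [← norm_toSeq, ← norm_toSeq, ← norm_toSeq, map_add]
    exact norm_add_le _ _
  norm_eq_zero_iff u := by
    rw [← norm_toSeq, norm_eq_zero]
    exact map_eq_zero_iff _ (toSeq_injective B σ ρ)

instance : NormedAddCommGroup (SpaceA B σ ρ) := NormedAddCommGroup.ofCore (normCore B σ ρ)

instance : NormedSpace ℂ (SpaceA B σ ρ) :=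
  NormedSpace.ofCore (normCore B σ ρ)

theorem toSeq_surjective (hρ : 0 ≤ ρ) : Function.Surjective (toSeq B σ ρ) := by
  intro a
  have hw : ∀ j, gevreyWeight d σ ρ j ≠ 0 := fun j => (Real.exp_pos _).ne'
  have hw1 : ∀ j, 1 ≤ gevreyWeight d σ ρ j := fun j =>
    Real.one_le_exp (mul_nonneg hρ (Real.rpow_nonneg (Nat.cast_nonneg j) _))
  have hb : Memℓp (fun j => ((gevreyWeight d σ ρ j : ℝ) : ℂ)⁻¹ * (a : ℕ → ℂ) j) 2 := by
    have ha := lp.memℓp a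
    rw [memℓp_gen_iff (by norm_num)] at ha ⊢
    refine Summable.of_nonneg_of_le (fun j => by positivity) (fun j => ?_) ha
    refine Real.rpow_le_rpow (norm_nonneg _) ?_ (by norm_num)
    rw [norm_mul, norm_inv, Complex.norm_real, Real.norm_eq_abs,
      abs_of_nonneg (zero_le_one.trans (hw1 j))]
    exact mul_le_of_le_one_left (norm_nonneg _) (inv_le_one_of_one_le₀ (hw1 j))
  let b : lp (fun _ : ℕ => ℂ) 2 := ⟨_, hb⟩
  let u : RiemL2 g := B.basis.repr.symm b
  have hu : wcoeff B σ ρ u = a := by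
    funext j
    have h1 : inner ℂ (B.basis j) u = (b : ℕ → ℂ) j := by
      rw [← B.basis.repr_apply_apply, LinearIsometryEquiv.apply_symm_apply]
    rw [wcoeff, h1]
    exact mul_inv_cancel_left₀ (Complex.ofReal_ne_zero.2 (hw j)) _
  refine ⟨⟨u, (memA_iff B σ ρ u).2 (hu ▸ lp.memℓp a)⟩, ?_⟩
  exact Subtype.ext hu

/-- `A^{σ,ρ}(N)` is a Banach space. -/
theorem completeSpace (hρ : 0 ≤ ρ) : CompleteSpace (SpaceA B σ ρ) := by
  let f : SpaceA B σ ρ ≃ₗᵢ[ℂ] lp (fun _ : ℕ => ℂ) 2 :=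
    LinearIsometryEquiv.ofSurjective ⟨toSeq B σ ρ, norm_toSeq B σ ρ⟩
      (toSeq_surjective B σ ρ hρ)
  exact f.toIsometryEquiv.completeSpace

end SpaceA

end Manifold

end

/-! Put d = n + 1 and w = χFu. The coefficients ⟨w, φ_j⟩ have to decay like exp(-b j^{1/(dσ)}), with
b independent of u and of the eigenbasis.

Fix u first. As w has compact support in the one chart `e` and Δ_g is symmetric, |λ_j|^k |⟨w, φ_j⟩|
= |⟨Δ_g^k w, φ_j⟩|. The operator has analytic coefficients and w is Gevrey of order σ, so |Δ_g^k w|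
≤ H (A k^{2σ})^k (`exists_norm_divOpIter_le`). Taking k close to (|λ_j| / (Ae))^{1/(2σ)} yields
decay like exp(-c |λ_j|^{1/(2σ)}) (`le_exp_of_forall_pow_mul_le`), and the Weyl bound |λ_j| ≥ κ
j^{2/d} - D (`exists_weyl_lower_bound`) turns this into the required rate
(`exists_norm_integral_le_exp`).

The Weyl bound is a counting argument. Cover N by finitely many coordinate cubes and cut each into
m^d cells. Among more than S m^d eigenfunctions some nonzero combination has integral zero over
every cell. Poincaré's inequality on the cells gains m^{-2}, while Caccioppoli's inequality bounds
the gradient by the largest |λ_j| involved, Λ; summing over the cover gives m² ≤ AΛ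
(`exists_eigenvalue_bounds`). Caccioppoli's inequality also excludes very negative eigenvalues, so
the ordering of the eigenvalues bounds their absolute values.

The bound on iterates uses the Gevrey norms ∑_k |D^k f| R^k / k!^σ at a point. They are
submultiplicative for σ ≥ 1, and a derivative costs a factor of order k^σ when the radius shrinks by
a fraction 1/(4k); 2k derivatives leave at least half of the radius. The definition of G^σ(N) by
covariant derivatives is converted to coordinates by solving the recursion for ∇^k for the partial
derivatives (`IsGevrey.isGevreyBounded`).

Uniformity in u is a Baire category argument (`exists_uniform_exp_bound`). It is run over all pairs
(eigenbasis, j) at once, which makes ρ independent of the basis; halving the exponent then leaves a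
convergent series. -/

/-! ### The metric in coordinates: analyticity and positivity -/

section Metric

variable {d : ℕ} {N : Type*} [TopologicalSpace N] [ChartedSpace (Euc d) N]
  [IsManifold 𝓘(ℝ, Euc d) ω N] {c : OpenPartialHomeomorph N (Euc d)}

theorem contMDiffOn_symm_of_mem_analyticCharts (hc : c ∈ analyticCharts d N) :
    ContMDiffOn 𝓘(ℝ, Euc d) 𝓘(ℝ, Euc d) ω c.symm c.target :=
  contMDiffOn_symm_of_mem_maximalAtlas hc

/-- The field is the tangent map of `c.symm` applied to a constant section. Pairing two such fields
with the analytic metric makes the metric coefficients analytic. -/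
theorem contMDiffOn_tangentVector_symm (hc : c ∈ analyticCharts d N) (v : Euc d) :
    ContMDiffOn 𝓘(ℝ, Euc d) (𝓘(ℝ, Euc d).tangent) ω
      (fun x => (⟨c.symm x, mfderiv 𝓘(ℝ, Euc d) 𝓘(ℝ, Euc d) c.symm x v⟩ :
        TangentBundle 𝓘(ℝ, Euc d) N)) c.target := by
  have h := (contMDiffOn_symm_of_mem_analyticCharts hc).contMDiffOn_tangentMapWithin
    (m := ω) le_rfl c.open_target.uniqueMDiffOn
  have h2 : ContMDiff 𝓘(ℝ, Euc d) (𝓘(ℝ, Euc d).tangent) ω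
      (fun x : Euc d => (⟨x, v⟩ : TangentBundle 𝓘(ℝ, Euc d) (Euc d))) := by
    intro x
    rw [contMDiffAt_totalSpace]
    exact ⟨contMDiffAt_id, by simpa using contMDiffAt_const⟩
  refine (h.comp h2.contMDiffOn (s := c.target) (fun x hx => hx)).congr fun x hx => ?_
  simp only [Function.comp, tangentMapWithin, mfderivWithin_of_isOpen c.open_target hx]

theorem contDiffOn_gram (g : AnalyticMetric d N) (hc : c ∈ analyticCharts d N) (i j : Fin d) :
    ContDiffOn ℝ ω (fun x => gram g c x i j) c.target := by
  rw [← contMDiffOn_iff_contDiffOn]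
  intro x hx
  have this : ContMDiffWithinAt 𝓘(ℝ, Euc d) (𝓘(ℝ, Euc d).prod 𝓘(ℝ)) ω
      (fun x => TotalSpace.mk' ℝ (E := Bundle.Trivial N ℝ) (c.symm x) (gram g c x i j))
      c.target x := by
    apply ContMDiffWithinAt.clm_bundle_apply₂ (F₁ := Euc d) (F₂ := Euc d)
      (E₁ := fun p : N => TangentSpace 𝓘(ℝ, Euc d) p)
      (E₂ := fun p : N => TangentSpace 𝓘(ℝ, Euc d) p)
    · exact ContMDiffAt.comp_contMDiffWithinAt x g.contMDiff.contMDiffAt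
        (contMDiffOn_symm_of_mem_analyticCharts hc x hx)
    · exact contMDiffOn_tangentVector_symm hc _ x hx
    · exact contMDiffOn_tangentVector_symm hc _ x hx
  simp only [contMDiffWithinAt_totalSpace] at this
  exact this.2

theorem gram_isSymm (g : AnalyticMetric d N) (c : OpenPartialHomeomorph N (Euc d)) (x : Euc d)
    (i j : Fin d) : gram g c x i j = gram g c x j i :=
  g.symm _ _ _

theorem mdifferentiableAt_symm_of_mem_analyticCharts (hc : c ∈ analyticCharts d N) {x : Euc d}
    (hx : x ∈ c.target) : MDifferentiableAt 𝓘(ℝ, Euc d) 𝓘(ℝ, Euc d) c.symm x :=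
  ((contMDiffOn_symm_of_mem_analyticCharts hc x hx).contMDiffAt
    (c.open_target.mem_nhds hx)).mdifferentiableAt (by simp)

theorem mdifferentiableAt_of_mem_analyticCharts (hc : c ∈ analyticCharts d N) {p : N}
    (hp : p ∈ c.source) : MDifferentiableAt 𝓘(ℝ, Euc d) 𝓘(ℝ, Euc d) c p :=
  (contMDiffAt_of_mem_maximalAtlas hc hp).mdifferentiableAt (by simp)

/-- The change of coordinates formula for the differentials of the inverse charts. -/
theorem mfderiv_symm_eq_comp {c c' : OpenPartialHomeomorph N (Euc d)}
    (hc : c ∈ analyticCharts d N) (hc' : c' ∈ analyticCharts d N) {x : Euc d}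
    (hx : x ∈ c.target) (hx' : c.symm x ∈ c'.source) :
    DifferentiableAt ℝ (c' ∘ c.symm) x ∧ ∀ v : Euc d,
      mfderiv 𝓘(ℝ, Euc d) 𝓘(ℝ, Euc d) c.symm x v =
      mfderiv 𝓘(ℝ, Euc d) 𝓘(ℝ, Euc d) c'.symm (c' (c.symm x)) (fderiv ℝ (c' ∘ c.symm) x v) := by
  have h1 := mdifferentiableAt_symm_of_mem_analyticCharts hc hx
  have h2 := mdifferentiableAt_of_mem_analyticCharts hc' hx'
  have h3 := mdifferentiableAt_symm_of_mem_analyticCharts hc' (c'.map_source hx')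
  have h4 := h2.comp x h1
  refine ⟨h4.differentiableAt, fun v => ?_⟩
  have h5 : c.symm =ᶠ[𝓝 x] c'.symm ∘ (c' ∘ c.symm) := by
    have : c.symm ⁻¹' c'.source ∈ 𝓝 x :=
      (c.continuousAt_symm hx).preimage_mem_nhds (c'.open_source.mem_nhds hx')
    filter_upwards [this] with y hy
    exact (c'.left_inv hy).symm
  have h6 : HasMFDerivAt 𝓘(ℝ, Euc d) 𝓘(ℝ, Euc d) c.symm x
      ((mfderiv 𝓘(ℝ, Euc d) 𝓘(ℝ, Euc d) c'.symm (c' (c.symm x))).comp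
        (mfderiv 𝓘(ℝ, Euc d) 𝓘(ℝ, Euc d) (c' ∘ c.symm) x)) :=
    (h3.hasMFDerivAt.comp x h4.hasMFDerivAt).congr_of_eventuallyEq h5
  have h7 := h6.mfderiv
  rw [mfderiv_eq_fderiv] at h7
  exact DFunLike.congr_fun h7 v

theorem mfderiv_symm_injective (hc : c ∈ analyticCharts d N) {x : Euc d} (hx : x ∈ c.target)
    {v : Euc d} (hv : mfderiv 𝓘(ℝ, Euc d) 𝓘(ℝ, Euc d) c.symm x v = 0) : v = 0 := by
  have h1 := mdifferentiableAt_symm_of_mem_analyticCharts hc hx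
  have h2 := mdifferentiableAt_of_mem_analyticCharts hc (c.map_target hx)
  have h5 : id =ᶠ[𝓝 x] c ∘ c.symm := by
    filter_upwards [c.open_target.mem_nhds hx] with y hy
    exact (c.right_inv hy).symm
  have h6 := ((h2.hasMFDerivAt.comp x h1.hasMFDerivAt).congr_of_eventuallyEq h5).mfderiv
  rw [mfderiv_id] at h6
  have h7 := DFunLike.congr_fun h6 v
  have h8 : v = mfderiv 𝓘(ℝ, Euc d) 𝓘(ℝ, Euc d) c (c.symm x)
    (mfderiv 𝓘(ℝ, Euc d) 𝓘(ℝ, Euc d) c.symm x v) := h7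
  rw [h8, hv]
  exact map_zero _

theorem sum_smul_stdVec (u : Euc d) : ∑ i, u i • stdVec i = u := by
  conv_rhs => rw [← (EuclideanSpace.basisFun (Fin d) ℝ).sum_repr u]
  simp [stdVec]

theorem bilin_comp_eq_sum {E : Type*} [AddCommGroup E] [Module ℝ E] [TopologicalSpace E]
    [IsTopologicalAddGroup E] [ContinuousConstSMul ℝ E]
    (b : E →L[ℝ] E →L[ℝ] ℝ) (D : Euc d →L[ℝ] E) (v w : Euc d) :
    b (D v) (D w) = ∑ i, ∑ j, v i * b (D (stdVec i)) (D (stdVec j)) * w j := by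
  conv_lhs => rw [← sum_smul_stdVec v, ← sum_smul_stdVec w]
  simp only [map_sum, map_smul, sum_apply, smul_apply, smul_eq_mul,
    Finset.mul_sum]
  rw [Finset.sum_comm]
  refine Finset.sum_congr rfl fun i _ => Finset.sum_congr rfl fun j _ => ?_
  ring

/-- The pulled back metric as a quadratic form. -/
theorem sum_gram_mul (g : AnalyticMetric d N) (c : OpenPartialHomeomorph N (Euc d))
    (x v w : Euc d) : g.inner (c.symm x) (mfderiv 𝓘(ℝ, Euc d) 𝓘(ℝ, Euc d) c.symm x v)
      (mfderiv 𝓘(ℝ, Euc d) 𝓘(ℝ, Euc d) c.symm x w) =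
      ∑ i, ∑ j, v i * gram g c x i j * w j :=
  bilin_comp_eq_sum (E := TangentSpace 𝓘(ℝ, Euc d) (c.symm x)) (g.inner (c.symm x))
    (mfderiv 𝓘(ℝ, Euc d) 𝓘(ℝ, Euc d) c.symm x) v w

theorem gram_posDef (g : AnalyticMetric d N) (hc : c ∈ analyticCharts d N) {x : Euc d}
    (hx : x ∈ c.target) : (gram g c x).PosDef := by
  rw [Matrix.posDef_iff_dotProduct_mulVec]
  refine ⟨Matrix.IsHermitian.ext fun i j => ?_, fun v hv => ?_⟩
  · simpa using (gram_isSymm g c x i j).symm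
  have h1 : WithLp.toLp 2 v ≠ (0 : Euc d) := by simpa using hv
  have h2 := g.pos (c.symm x) (mfderiv 𝓘(ℝ, Euc d) 𝓘(ℝ, Euc d) c.symm x (WithLp.toLp 2 v))
    (fun h => h1 (mfderiv_symm_injective hc hx h))
  rw [sum_gram_mul] at h2
  refine h2.trans_eq ?_
  simp [dotProduct, Matrix.mulVec, Finset.mul_sum, mul_assoc]

theorem gram_det_pos (g : AnalyticMetric d N) (hc : c ∈ analyticCharts d N) {x : Euc d}
    (hx : x ∈ c.target) : 0 < (gram g c x).det :=
  (gram_posDef g hc hx).det_pos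

theorem gramInv_posDef (g : AnalyticMetric d N) (hc : c ∈ analyticCharts d N) {x : Euc d}
    (hx : x ∈ c.target) : (gramInv g c x).PosDef :=
  (gram_posDef g hc hx).inv

theorem gramInv_isSymm (g : AnalyticMetric d N) (hc : c ∈ analyticCharts d N) {x : Euc d}
    (hx : x ∈ c.target) (i j : Fin d) : gramInv g c x i j = gramInv g c x j i := by
  simpa using ((gramInv_posDef g hc hx).1.apply i j).symm

theorem volDensity_pos (g : AnalyticMetric d N) (hc : c ∈ analyticCharts d N) {x : Euc d}
    (hx : x ∈ c.target) : 0 < volDensity g c x :=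
  Real.sqrt_pos.2 (gram_det_pos g hc hx)

theorem contDiffOn_gram_det (g : AnalyticMetric d N) (hc : c ∈ analyticCharts d N) :
    ContDiffOn ℝ ω (fun x => (gram g c x).det) c.target := by
  simp only [Matrix.det_apply]
  refine ContDiffOn.sum fun τ _ => ContDiffOn.const_smul _ ?_
  exact contDiffOn_prod fun i _ => contDiffOn_gram g hc _ _

theorem contDiffOn_volDensity (g : AnalyticMetric d N) (hc : c ∈ analyticCharts d N) :
    ContDiffOn ℝ ω (fun x => volDensity g c x) c.target :=
  (contDiffOn_gram_det g hc).sqrt fun _ hx => (gram_det_pos g hc hx).ne'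

/-- Cramer's rule: the adjugate is polynomial in the metric coefficients and the determinant does
not vanish. -/
theorem contDiffOn_gramInv (g : AnalyticMetric d N) (hc : c ∈ analyticCharts d N) (i j : Fin d) :
    ContDiffOn ℝ ω (fun x => gramInv g c x i j) c.target := by
  have h : ∀ x ∈ c.target,
      gramInv g c x i j = ((gram g c x).det)⁻¹ * (gram g c x).adjugate i j := by
    intro x _
    simp [gramInv, Matrix.inv_def]
  refine ContDiffOn.congr (ContDiffOn.mul ((contDiffOn_gram_det g hc).inv
    fun _ hx => (gram_det_pos g hc hx).ne') ?_) h
  simp only [Matrix.adjugate_apply, Matrix.det_apply]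
  refine ContDiffOn.sum fun τ _ => ContDiffOn.const_smul _ ?_
  refine contDiffOn_prod fun k _ => ?_
  by_cases hk : τ k = j
  · simp only [hk, Matrix.updateRow_self]
    exact contDiffOn_const
  · simp only [Matrix.updateRow_ne hk]
    exact contDiffOn_gram g hc _ _

end Metric

/-! ### The Riemannian volume in a chart -/

section Volume

variable {d : ℕ} {N : Type*} [TopologicalSpace N] [ChartedSpace (Euc d) N]
  [IsManifold 𝓘(ℝ, Euc d) ω N] {c : OpenPartialHomeomorph N (Euc d)}

theorem gram_eq_transpose_mul_mul (g : AnalyticMetric d N) {c c' : OpenPartialHomeomorph N (Euc d)}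
    (hc : c ∈ analyticCharts d N) (hc' : c' ∈ analyticCharts d N) {x : Euc d}
    (hx : x ∈ c.target) (hx' : c.symm x ∈ c'.source) :
    gram g c x = (LinearMap.toMatrix (EuclideanSpace.basisFun (Fin d) ℝ).toBasis
        (EuclideanSpace.basisFun (Fin d) ℝ).toBasis
        (fderiv ℝ (c' ∘ c.symm) x).toLinearMap).transpose * gram g c' (c' (c.symm x)) *
      LinearMap.toMatrix (EuclideanSpace.basisFun (Fin d) ℝ).toBasis
        (EuclideanSpace.basisFun (Fin d) ℝ).toBasis (fderiv ℝ (c' ∘ c.symm) x).toLinearMap := by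
  ext i j
  have h := (mfderiv_symm_eq_comp hc hc' hx hx').2
  have h1 := sum_gram_mul g c' (c' (c.symm x)) (fderiv ℝ (c' ∘ c.symm) x (stdVec i))
    (fderiv ℝ (c' ∘ c.symm) x (stdVec j))
  have hp : c'.symm (c' (c.symm x)) = c.symm x := c'.left_inv hx'
  have h2 : gram g c x i j = g.inner (c'.symm (c' (c.symm x)))
      (mfderiv 𝓘(ℝ, Euc d) 𝓘(ℝ, Euc d) c'.symm (c' (c.symm x))
        (fderiv ℝ (c' ∘ c.symm) x (stdVec i)))
      (mfderiv 𝓘(ℝ, Euc d) 𝓘(ℝ, Euc d) c'.symm (c' (c.symm x))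
        (fderiv ℝ (c' ∘ c.symm) x (stdVec j))) := by
    rw [hp]
    simp only [gram, Matrix.of_apply]
    rw [h, h]
    rfl
  rw [h2, h1]
  simp only [Matrix.mul_apply, Matrix.transpose_apply, LinearMap.toMatrix_apply, Finset.sum_mul]
  rw [Finset.sum_comm]
  simp [stdVec]

/-- Taking determinants in g = Jᵀ g' J, with J the Jacobian matrix of the change of charts, gives
det g = (det J)² det g'. -/
theorem volDensity_eq_abs_det_mul (g : AnalyticMetric d N)
    {c c' : OpenPartialHomeomorph N (Euc d)}
    (hc : c ∈ analyticCharts d N) (hc' : c' ∈ analyticCharts d N) {x : Euc d}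
    (hx : x ∈ c.target) (hx' : c.symm x ∈ c'.source) :
    volDensity g c x =
      |(fderiv ℝ (c' ∘ c.symm) x).det| * volDensity g c' (c' (c.symm x)) := by
  rw [volDensity, gram_eq_transpose_mul_mul g hc hc' hx hx', Matrix.det_mul, Matrix.det_mul,
    Matrix.det_transpose, LinearMap.det_toMatrix, ← Real.sqrt_sq_eq_abs, volDensity,
    ← Real.sqrt_mul (sq_nonneg _)]
  congr 1
  change LinearMap.det _ * _ * LinearMap.det _ = LinearMap.det _ ^ 2 * _
  ring

variable [MeasurableSpace N] [BorelSpace N]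

omit [ChartedSpace (Euc d) N] [IsManifold 𝓘(ℝ, Euc d) ω N] in
theorem measurableSet_target_inter_preimage_symm (c : OpenPartialHomeomorph N (Euc d)) {A : Set N}
    (hA : MeasurableSet A) : MeasurableSet (c.target ∩ c.symm ⁻¹' A) := by
  have h := c.open_target.measurableSet.subtype_image (c.continuousOn_symm.domRestrict.measurable hA)
  convert h using 1
  ext x
  simp [and_comm]

omit [ChartedSpace (Euc d) N] [IsManifold 𝓘(ℝ, Euc d) ω N] in
theorem measurableSet_source_inter_preimage (c : OpenPartialHomeomorph N (Euc d)) {A : Set (Euc d)}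
    (hA : MeasurableSet A) : MeasurableSet (c.source ∩ c ⁻¹' A) := by
  have h := c.open_source.measurableSet.subtype_image (c.continuousOn.domRestrict.measurable hA)
  convert h using 1
  ext x
  simp [and_comm]

omit [ChartedSpace (Euc d) N] [IsManifold 𝓘(ℝ, Euc d) ω N] in
theorem aemeasurable_symm (c : OpenPartialHomeomorph N (Euc d)) :
    AEMeasurable c.symm (volume.restrict c.target) :=
  c.continuousOn_symm.aemeasurable c.open_target.measurableSet

theorem measurable_ofReal_volDensity (g : AnalyticMetric d N) (hc : c ∈ analyticCharts d N) :
    AEMeasurable (fun x => ENNReal.ofReal (volDensity g c x)) (volume.restrict c.target) :=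
  ((contDiffOn_volDensity g hc).continuousOn.aemeasurable
    c.open_target.measurableSet).ennreal_ofReal

theorem aemeasurable_symm_withDensity (g : AnalyticMetric d N)
    (c : OpenPartialHomeomorph N (Euc d)) :
    AEMeasurable c.symm ((volume.restrict c.target).withDensity
      fun x => ENNReal.ofReal (volDensity g c x)) :=
  (aemeasurable_symm c).mono_ac (withDensity_absolutelyContinuous _ _)

theorem chartVolume_apply (g : AnalyticMetric d N) (c : OpenPartialHomeomorph N (Euc d))
    {A : Set N} (hA : MeasurableSet A) :
    chartVolume g c A =
      ∫⁻ x in c.target ∩ c.symm ⁻¹' A, ENNReal.ofReal (volDensity g c x) := by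
  have h := measurableSet_target_inter_preimage_symm c hA
  rw [chartVolume, Measure.map_apply_of_aemeasurable (aemeasurable_symm_withDensity g c) hA,
    withDensity_apply', Measure.restrict_restrict' c.open_target.measurableSet, Set.inter_comm]

theorem lintegral_chartVolume (g : AnalyticMetric d N) (hc : c ∈ analyticCharts d N)
    {f : N → ENNReal} (hf : Measurable f) :
    ∫⁻ p, f p ∂(chartVolume g c) =
      ∫⁻ x in c.target, ENNReal.ofReal (volDensity g c x) * f (c.symm x) := by
  rw [chartVolume, lintegral_map' hf.aemeasurable (aemeasurable_symm_withDensity g c)]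
  exact lintegral_withDensity_eq_lintegral_mul₀ (measurable_ofReal_volDensity g hc)
    (hf.comp_aemeasurable (aemeasurable_symm c))

/-- Change of variables along `c' ∘ c.symm` turns one density into the other. An inequality is
enough, because the opposite bound for the supremum of the chart measures is automatic. -/
theorem chartVolume_restrict_le (g : AnalyticMetric d N) {c c' : OpenPartialHomeomorph N (Euc d)}
    (hc : c ∈ analyticCharts d N) (hc' : c' ∈ analyticCharts d N) :
    (chartVolume g c).restrict c'.source ≤ chartVolume g c' := by
  refine Measure.le_iff.2 fun A hA => ?_
  rw [Measure.restrict_apply hA, chartVolume_apply g c (hA.inter c'.open_source.measurableSet),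
    chartVolume_apply g c' hA]
  set S := c.target ∩ c.symm ⁻¹' (A ∩ c'.source) with hS
  have hSm : MeasurableSet S :=
    measurableSet_target_inter_preimage_symm c (hA.inter c'.open_source.measurableSet)
  have hinj : Set.InjOn (c' ∘ c.symm) S := by
    intro x hx y hy hxy
    exact c.symm.injOn hx.1 hy.1 (c'.injOn hx.2.2 hy.2.2 hxy)
  have hd : ∀ x ∈ S, HasFDerivWithinAt (c' ∘ c.symm) (fderiv ℝ (c' ∘ c.symm) x) S x :=
    fun x hx => (mfderiv_symm_eq_comp hc hc' hx.1 hx.2.2).1.hasFDerivAt.hasFDerivWithinAt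
  have himg : (c' ∘ c.symm) '' S ⊆ c'.target ∩ c'.symm ⁻¹' A := by
    rintro _ ⟨x, hx, rfl⟩
    refine ⟨c'.map_source hx.2.2, ?_⟩
    simp only [Set.mem_preimage, Function.comp_apply]
    rw [c'.left_inv hx.2.2]
    exact hx.2.1
  calc ∫⁻ x in S, ENNReal.ofReal (volDensity g c x)
      = ∫⁻ x in S, ENNReal.ofReal |(fderiv ℝ (c' ∘ c.symm) x).det| *
          ENNReal.ofReal (volDensity g c' ((c' ∘ c.symm) x)) := by
        refine setLIntegral_congr_fun hSm fun x hx => ?_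
        rw [volDensity_eq_abs_det_mul g hc hc' hx.1 hx.2.2, ENNReal.ofReal_mul (abs_nonneg _)]
        rfl
    _ = ∫⁻ y in (c' ∘ c.symm) '' S, ENNReal.ofReal (volDensity g c' y) :=
        (lintegral_image_eq_lintegral_abs_det_fderiv_mul volume hSm hd hinj
          fun y => ENNReal.ofReal (volDensity g c' y)).symm
    _ ≤ _ := lintegral_mono_set himg

theorem chartVolume_source_compl (g : AnalyticMetric d N) (c : OpenPartialHomeomorph N (Euc d)) :
    chartVolume g c c.sourceᶜ = 0 := by
  rw [chartVolume_apply g c c.open_source.measurableSet.compl]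
  have : c.target ∩ c.symm ⁻¹' c.sourceᶜ = ∅ := by
    ext x
    simp only [Set.mem_inter_iff, Set.mem_preimage, Set.mem_compl_iff, Set.mem_empty_iff_false,
      iff_false, not_and, not_not]
    exact fun hx => c.map_target hx
  rw [this, Measure.restrict_empty, lintegral_zero_measure]

theorem chartVolume_le_riemannianVolume (g : AnalyticMetric d N) (hc : c ∈ analyticCharts d N) :
    chartVolume g c ≤ riemannianVolume g :=
  le_iSup₂ (f := fun c (_ : c ∈ analyticCharts d N) => chartVolume g c) c hc

/-- The Riemannian volume is `√(det g_{ij}) dx` in every chart. -/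
theorem riemannianVolume_restrict_source (g : AnalyticMetric d N) (hc : c ∈ analyticCharts d N) :
    (riemannianVolume g).restrict c.source = chartVolume g c := by
  have hm := c.open_source.measurableSet
  apply le_antisymm
  -- Each chart measure is split at `c.source`: inside it is dominated by `chartVolume g c`, outside
  -- by the volume itself. Restriction to `c.source` then removes the second term.
  · have h : riemannianVolume g ≤
        chartVolume g c + (riemannianVolume g).restrict c.sourceᶜ := by
      refine iSup₂_le fun c' hc' => ?_
      rw [← Measure.restrict_add_restrict_compl (μ := chartVolume g c') hm]
      exact add_le_add (chartVolume_restrict_le g hc' hc)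
        (Measure.restrict_mono le_rfl (chartVolume_le_riemannianVolume g hc'))
    refine (Measure.restrict_mono le_rfl h).trans ?_
    rw [Measure.restrict_add, Measure.restrict_restrict hm]
    simpa using Measure.restrict_le_self
  · have h : chartVolume g c = (chartVolume g c).restrict c.source := by
      conv_lhs => rw [← Measure.restrict_add_restrict_compl (μ := chartVolume g c) hm]
      rw [Measure.restrict_eq_zero.2 (chartVolume_source_compl g c), add_zero]
    rw [h]
    exact Measure.restrict_mono le_rfl (chartVolume_le_riemannianVolume g hc)

theorem setLIntegral_riemannianVolume (g : AnalyticMetric d N) (hc : c ∈ analyticCharts d N)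
    {f : N → ENNReal} (hf : Measurable f) {A : Set (Euc d)} (hA : MeasurableSet A)
    (hAc : A ⊆ c.target) :
    ∫⁻ p in c.source ∩ c ⁻¹' A, f p ∂(riemannianVolume g) =
      ∫⁻ x in A, ENNReal.ofReal (volDensity g c x) * f (c.symm x) := by
  have hm := measurableSet_source_inter_preimage c hA
  have h1 : (riemannianVolume g).restrict (c.source ∩ c ⁻¹' A) =
      (chartVolume g c).restrict (c.source ∩ c ⁻¹' A) := by
    rw [← riemannianVolume_restrict_source g hc, Measure.restrict_restrict hm]
    congr 1
    ext p
    simp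
    tauto
  rw [h1, ← lintegral_indicator hm, lintegral_chartVolume g hc (hf.indicator hm),
    ← lintegral_indicator hA, ← lintegral_indicator c.open_target.measurableSet]
  congr 1
  ext x
  by_cases hx : x ∈ c.target
  · by_cases hxA : x ∈ A
    · simp [hx, hxA, c.map_target hx, c.right_inv hx]
    · simp [hx, hxA, c.map_target hx, c.right_inv hx]
  · have : x ∉ A := fun h => hx (hAc h)
    simp [hx, this]

end Volume

/-! ### The Poincaré inequality on convex sets -/

section Poincare

theorem sq_lintegral_le {α : Type*} [MeasurableSpace α] (μ : Measure α) {f : α → ENNReal}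
    (hf : AEMeasurable f μ) : (∫⁻ a, f a ∂μ) ^ 2 ≤ μ Set.univ * ∫⁻ a, f a ^ 2 ∂μ := by
  have h := ENNReal.lintegral_mul_le_Lp_mul_Lq μ Real.HolderConjugate.two_two
    (aemeasurable_const (b := (1 : ENNReal))) hf
  simp only [Pi.mul_apply, one_mul, ENNReal.one_rpow, lintegral_const] at h
  refine (pow_le_pow_left₀ zero_le h 2).trans_eq ?_
  rw [mul_pow, ← ENNReal.rpow_natCast, ← ENNReal.rpow_natCast, ← ENNReal.rpow_mul,
    ← ENNReal.rpow_mul]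
  norm_num

variable {d : ℕ}

theorem lintegral_comp_add_smul_le {G : Euc d → ENNReal} (hG : Measurable G) {t : ℝ}
    (ht : 1 / 2 ≤ t) (v : Euc d) :
    ∫⁻ x, G (v + t • x) ≤ 2 ^ d * ∫⁻ x, G x := by
  have ht0 : 0 < t := by linarith
  calc ∫⁻ x, G (v + t • x) = ∫⁻ y, G (v + y) ∂(Measure.map (t • ·) (volume : Measure (Euc d))) :=
        (lintegral_map (f := fun y => G (v + y)) (g := fun x => t • x) (by fun_prop)
          (by fun_prop)).symm
    _ = ENNReal.ofReal |(t ^ d)⁻¹| * ∫⁻ y, G (v + y) := by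
        rw [Measure.map_addHaar_smul volume ht0.ne', lintegral_smul_measure, smul_eq_mul]
        simp
    _ ≤ 2 ^ d * ∫⁻ x, G x := by
        rw [lintegral_add_left_eq_self (fun y => G y) v]
        gcongr
        rw [abs_of_pos (by positivity), ← inv_pow, ENNReal.ofReal_pow (by positivity)]
        gcongr
        rw [← ENNReal.ofReal_ofNat 2]
        refine ENNReal.ofReal_le_ofReal ?_
        rw [inv_le_comm₀ ht0 (by norm_num)]
        linarith

/-- One of the weights t and 1 - t is at least 1/2. Integrating first over the endpoint with that
weight, the substitution has Jacobian at most 2^d, uniformly in t. -/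
theorem lintegral_lintegral_segment_le {G : Euc d → ENNReal} (hG : Measurable G) (q : Set (Euc d))
    (t : ℝ) : ∫⁻ x in q, ∫⁻ y in q, G (y + t • (x - y)) ≤ 2 ^ d * volume q * ∫⁻ x, G x := by
  have key : ∀ t : ℝ, 1 / 2 ≤ t →
      ∫⁻ x in q, ∫⁻ y in q, G (x + t • (y - x)) ≤ 2 ^ d * volume q * ∫⁻ x, G x := by
    intro t ht
    calc ∫⁻ x in q, ∫⁻ y in q, G (x + t • (y - x))
        ≤ ∫⁻ x in q, 2 ^ d * ∫⁻ x, G x := by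
          refine lintegral_mono fun x => (setLIntegral_le_lintegral q _).trans ?_
          refine le_trans (le_of_eq ?_) (lintegral_comp_add_smul_le hG ht (x - t • x))
          congr 1
          ext y
          congr 1
          module
      _ = 2 ^ d * volume q * ∫⁻ x, G x := by
          rw [lintegral_const, Measure.restrict_apply_univ]
          ring
  rcases le_total (1 / 2) t with ht | ht
  · rw [lintegral_lintegral_swap (by fun_prop)]
    exact key t ht
  · refine le_trans (le_of_eq ?_) (key (1 - t) (by linarith))
    congr 1
    ext x
    congr 1
    ext y
    congr 1
    module

/-- The fundamental theorem of calculus along the segment from y to x, followed by Cauchy-Schwarz in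
t. Convexity keeps the segment in q, so the indicator changes nothing on it but makes the integrand
meaningful everywhere. -/
theorem enorm_sub_sq_le_lintegral {f : Euc d → ℂ} {W q : Set (Euc d)} (hW : IsOpen W)
    (hf : ContDiffOn ℝ 1 f W) (hqW : q ⊆ W) (hq : Convex ℝ q) {D : ENNReal}
    (hDt : D ≠ ⊤) (hD : ∀ x ∈ q, ∀ y ∈ q, ‖x - y‖ₑ ≤ D) {x y : Euc d} (hx : x ∈ q) (hy : y ∈ q) :
    ‖f x - f y‖ₑ ^ 2 ≤ D ^ 2 * ∫⁻ t in Set.Icc (0 : ℝ) 1,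
      q.indicator (fun z => ‖fderiv ℝ f z‖ₑ ^ 2) (y + t • (x - y)) := by
  have hseg : ∀ t ∈ Set.Icc (0 : ℝ) 1, y + t • (x - y) ∈ q := fun t ht => by
    have := hq hy hx (sub_nonneg.2 ht.2) ht.1 (by ring)
    convert this using 1
    module
  have hderiv : ∀ t ∈ Set.uIcc (0 : ℝ) 1,
      HasDerivAt (fun t : ℝ => f (y + t • (x - y))) (fderiv ℝ f (y + t • (x - y)) (x - y)) t := by
    intro t ht
    rw [Set.uIcc_of_le zero_le_one] at ht
    have h1 : HasDerivAt (fun t : ℝ => y + t • (x - y)) (x - y) t := by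
      simpa using ((hasDerivAt_id t).smul_const (x - y)).const_add y
    exact (((hf.contDiffAt (hW.mem_nhds (hqW (hseg t ht)))).differentiableAt
      one_ne_zero).hasFDerivAt).comp_hasDerivAt t h1
  have hcont : ContinuousOn (fun t : ℝ => fderiv ℝ f (y + t • (x - y)) (x - y))
      (Set.Icc 0 1) :=
    ((hf.continuousOn_fderiv_of_isOpen hW le_rfl).comp (by fun_prop)
      fun t ht => hqW (hseg t ht)).clm_apply continuousOn_const
  have hcont' : ContinuousOn (fun t : ℝ => fderiv ℝ f (y + t • (x - y)) (x - y))
      (Set.uIcc 0 1) := by rwa [Set.uIcc_of_le zero_le_one]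
  have h := intervalIntegral.integral_eq_sub_of_hasDerivAt hderiv hcont'.intervalIntegrable
  simp only [one_smul, zero_smul, add_zero, add_sub_cancel] at h
  rw [← h, intervalIntegral.integral_of_le zero_le_one, ← integral_Icc_eq_integral_Ioc]
  have hm : AEMeasurable (fun t : ℝ => ‖fderiv ℝ f (y + t • (x - y)) (x - y)‖ₑ)
      (volume.restrict (Set.Icc 0 1)) := (hcont.aemeasurable measurableSet_Icc).enorm
  calc ‖∫ t in Set.Icc (0 : ℝ) 1, fderiv ℝ f (y + t • (x - y)) (x - y)‖ₑ ^ 2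
      ≤ (∫⁻ t in Set.Icc (0 : ℝ) 1, ‖fderiv ℝ f (y + t • (x - y)) (x - y)‖ₑ) ^ 2 := by
        gcongr
        exact enorm_integral_le_lintegral_enorm _
    _ ≤ _ := sq_lintegral_le _ hm
    _ = ∫⁻ t in Set.Icc (0 : ℝ) 1, ‖fderiv ℝ f (y + t • (x - y)) (x - y)‖ₑ ^ 2 := by simp
    _ ≤ ∫⁻ t in Set.Icc (0 : ℝ) 1,
        D ^ 2 * q.indicator (fun z => ‖fderiv ℝ f z‖ₑ ^ 2) (y + t • (x - y)) := by
        refine setLIntegral_mono' measurableSet_Icc fun t ht => ?_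
        rw [Set.indicator_of_mem (hseg t ht), ← mul_pow]
        gcongr
        calc ‖fderiv ℝ f (y + t • (x - y)) (x - y)‖ₑ
            ≤ ‖fderiv ℝ f (y + t • (x - y))‖ₑ * ‖x - y‖ₑ :=
              ContinuousLinearMap.le_opENorm _ _
          _ ≤ _ := by
            rw [mul_comm]
            gcongr
            exact hD x hx y hy
    _ ≤ _ := by
        rw [lintegral_const_mul' _ _ (by finiteness)]

/-- The Poincaré inequality for functions with mean zero on a convex set. -/
theorem poincare_of_setIntegral_eq_zero {f : Euc d → ℂ} {W q : Set (Euc d)} (hW : IsOpen W)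
    (hf : ContDiffOn ℝ 1 f W) (hqW : q ⊆ W) (hq : Convex ℝ q) (hqm : MeasurableSet q)
    (hfi : IntegrableOn f q) (hqv : volume q ≠ ⊤) {D : ENNReal}
    (hDt : D ≠ ⊤) (hD : ∀ x ∈ q, ∀ y ∈ q, ‖x - y‖ₑ ≤ D) (h0 : ∫ x in q, f x = 0) :
    ∫⁻ x in q, ‖f x‖ₑ ^ 2 ≤ D ^ 2 * 2 ^ d * ∫⁻ x in q, ‖fderiv ℝ f x‖ₑ ^ 2 := by
  -- A null set is treated apart, since a factor `volume q` is cancelled below.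
  by_cases hq0 : volume q = 0
  · simp [Measure.restrict_eq_zero.2 hq0]
  set G := q.indicator (fun z => ‖fderiv ℝ f z‖ₑ ^ 2) with hG
  have hGm : Measurable G := ((measurable_fderiv ℝ f).enorm.pow_const 2).indicator hqm
  have : IsFiniteMeasure (volume.restrict q) := ⟨by simpa using hqv.lt_top⟩
  -- Mean zero makes f(x) the average over y of f(x) - f(y); Cauchy-Schwarz does the rest.
  have h1 : ∀ x, volume q * ‖f x‖ₑ ^ 2 ≤ ∫⁻ y in q, ‖f x - f y‖ₑ ^ 2 := by
    intro x
    have e1 : volume.real q • f x = ∫ y in q, (f x - f y) := by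
      rw [integral_sub (integrable_const _) hfi, h0, setIntegral_const, sub_zero]
    have e2 : (volume q * ‖f x‖ₑ) ^ 2 ≤ volume q * ∫⁻ y in q, ‖f x - f y‖ₑ ^ 2 := by
      have e3 : volume q * ‖f x‖ₑ = ‖∫ y in q, (f x - f y)‖ₑ := by
        rw [← e1, enorm_smul, measureReal_def, Real.enorm_eq_ofReal ENNReal.toReal_nonneg,
          ENNReal.ofReal_toReal hqv]
      rw [e3]
      refine (pow_le_pow_left₀ zero_le (enorm_integral_le_lintegral_enorm _) 2).trans ?_
      simpa using sq_lintegral_le (volume.restrict q) (f := fun y => ‖f x - f y‖ₑ)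
        (aemeasurable_const.sub hfi.1.aemeasurable).enorm
    rw [mul_pow, sq, mul_assoc] at e2
    exact (ENNReal.mul_le_mul_iff_right hq0 hqv).1 e2
  have h2 : volume q * ∫⁻ x in q, ‖f x‖ₑ ^ 2 ≤
      volume q * (D ^ 2 * 2 ^ d * ∫⁻ x in q, ‖fderiv ℝ f x‖ₑ ^ 2) := by
    calc volume q * ∫⁻ x in q, ‖f x‖ₑ ^ 2 = ∫⁻ x in q, volume q * ‖f x‖ₑ ^ 2 :=
          (lintegral_const_mul' _ _ hqv).symm
      _ ≤ ∫⁻ x in q, ∫⁻ y in q, ‖f x - f y‖ₑ ^ 2 := lintegral_mono fun x => h1 x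
      _ ≤ ∫⁻ x in q, ∫⁻ y in q, D ^ 2 * ∫⁻ t in Set.Icc (0 : ℝ) 1, G (y + t • (x - y)) :=
          setLIntegral_mono' hqm fun x hx => setLIntegral_mono' hqm fun y hy =>
            enorm_sub_sq_le_lintegral hW hf hqW hq hDt hD hx hy
      _ = D ^ 2 * ∫⁻ x in q, ∫⁻ y in q, ∫⁻ t in Set.Icc (0 : ℝ) 1, G (y + t • (x - y)) := by
          rw [← lintegral_const_mul _ (by fun_prop)]
          congr 1
          ext x
          rw [← lintegral_const_mul _ (by fun_prop)]
      -- Tonelli puts t outermost, because the segment bound holds for each fixed t.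
      _ = D ^ 2 * ∫⁻ t in Set.Icc (0 : ℝ) 1, ∫⁻ x in q, ∫⁻ y in q, G (y + t • (x - y)) := by
          congr 1
          have e1 : ∀ x, ∫⁻ y in q, ∫⁻ t in Set.Icc (0 : ℝ) 1, G (y + t • (x - y)) =
              ∫⁻ t in Set.Icc (0 : ℝ) 1, ∫⁻ y in q, G (y + t • (x - y)) := fun x =>
            lintegral_lintegral_swap (by fun_prop)
          simp only [e1]
          exact lintegral_lintegral_swap (by fun_prop)
      _ ≤ D ^ 2 * ∫⁻ t in Set.Icc (0 : ℝ) 1, 2 ^ d * volume q * ∫⁻ x, G x := by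
          gcongr with t
          exact lintegral_lintegral_segment_le hGm q t
      _ = _ := by
          rw [lintegral_const, hG, lintegral_indicator hqm]
          simp
          ring
  exact (ENNReal.mul_le_mul_iff_right hq0 hqv).1 h2

end Poincare

/-! ### Subdivision of a cube into cells -/

section Grid

variable {d : ℕ}

/-- The half-open cube with lowest corner `a` and side `h`. -/
def halfOpenCube (a : Fin d → ℝ) (h : ℝ) : Set (Euc d) :=
  {x | ∀ i, x i ∈ Set.Ico (a i) (a i + h)}

/-- The cells of the subdivision of a cube into `m ^ d` cubes. -/
def gridCell (a : Fin d → ℝ) (h : ℝ) {m : ℕ} (k : Fin d → Fin m) : Set (Euc d) :=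
  halfOpenCube (fun i => a i + (k i : ℕ) * (h / m)) (h / m)

theorem measurableSet_halfOpenCube (a : Fin d → ℝ) (h : ℝ) :
    MeasurableSet (halfOpenCube a h) := by
  have : halfOpenCube a h = ⋂ i, (fun x : Euc d => x i) ⁻¹' Set.Ico (a i) (a i + h) := by
    ext x
    simp [halfOpenCube]
  rw [this]
  exact MeasurableSet.iInter fun i => measurableSet_Ico.preimage (by fun_prop)

theorem convex_halfOpenCube (a : Fin d → ℝ) (h : ℝ) : Convex ℝ (halfOpenCube a h) := by
  intro x hx y hy s t hs ht hst i
  have := convex_Ico (a i) (a i + h) (hx i) (hy i) hs ht hst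
  simpa using this

theorem norm_le_sum_abs (x : Euc d) : ‖x‖ ≤ ∑ i, |x i| := by
  conv_lhs => rw [← sum_smul_stdVec x]
  refine (norm_sum_le _ _).trans (Finset.sum_le_sum fun i _ => ?_)
  simp [norm_smul, stdVec]

theorem norm_sub_le_of_mem_halfOpenCube {a : Fin d → ℝ} {h : ℝ} {x y : Euc d}
    (hx : x ∈ halfOpenCube a h) (hy : y ∈ halfOpenCube a h) : ‖x - y‖ ≤ d * h := by
  refine (norm_le_sum_abs _).trans ?_
  calc ∑ i, |(x - y) i| ≤ ∑ _i : Fin d, h := Finset.sum_le_sum fun i _ => by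
        have h1 := hx i
        have h2 := hy i
        simp only [Set.mem_Ico] at h1 h2
        rw [PiLp.sub_apply, abs_le]
        constructor <;> linarith
    _ = d * h := by simp

theorem volume_halfOpenCube_ne_top (a : Fin d → ℝ) (h : ℝ) : volume (halfOpenCube a h) ≠ ⊤ := by
  have : Bornology.IsBounded (halfOpenCube a h) :=
    Metric.isBounded_iff.2 ⟨d * h, fun x hx y hy => by
      rw [dist_eq_norm]; exact norm_sub_le_of_mem_halfOpenCube hx hy⟩
  exact this.measure_lt_top.ne

/-- Half-open cells cover the half-open cube exactly: the cell of a point is read off from the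
integer parts of its rescaled coordinates. -/
theorem iUnion_gridCell (a : Fin d → ℝ) {h : ℝ} (hh : 0 < h) {m : ℕ} (hm : 0 < m) :
    ⋃ k : Fin d → Fin m, gridCell a h k = halfOpenCube a h := by
  have hm' : (0 : ℝ) < m := by exact_mod_cast hm
  have hs : 0 < h / m := by positivity
  ext x
  simp only [Set.mem_iUnion, gridCell, halfOpenCube, Set.mem_ofPred_eq, Set.mem_Ico]
  constructor
  · rintro ⟨k, hk⟩ i
    have h1 := hk i
    have h2 : ((k i : ℕ) : ℝ) + 1 ≤ m := by exact_mod_cast (k i).2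
    have h3 : (((k i : ℕ) : ℝ) + 1) * (h / m) ≤ m * (h / m) := by gcongr
    have h4 : (m : ℝ) * (h / m) = h := by field_simp
    have h5 : 0 ≤ ((k i : ℕ) : ℝ) * (h / m) := by positivity
    constructor <;> nlinarith
  · intro hx
    have h1 : ∀ i, 0 ≤ (x i - a i) / (h / m) := fun i =>
      div_nonneg (by linarith [(hx i).1]) hs.le
    have h2 : ∀ i, ⌊(x i - a i) / (h / m)⌋₊ < m := fun i => by
      rw [Nat.floor_lt (h1 i), div_lt_iff₀ hs]
      have : (m : ℝ) * (h / m) = h := by field_simp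
      linarith [(hx i).2]
    refine ⟨fun i => ⟨_, h2 i⟩, fun i => ?_⟩
    have h3 := Nat.floor_le (h1 i)
    have h4 := Nat.lt_floor_add_one ((x i - a i) / (h / m))
    rw [le_div_iff₀ hs] at h3
    rw [div_lt_iff₀ hs] at h4
    simp only
    constructor <;> nlinarith

theorem gridCell_subset (a : Fin d → ℝ) {h : ℝ} (hh : 0 < h) {m : ℕ} (hm : 0 < m)
    (k : Fin d → Fin m) : gridCell a h k ⊆ halfOpenCube a h := by
  rw [← iUnion_gridCell a hh hm]
  exact Set.subset_iUnion _ k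

theorem pairwise_disjoint_gridCell (a : Fin d → ℝ) {h : ℝ} (hh : 0 < h) {m : ℕ} (hm : 0 < m) :
    Pairwise (Function.onFun Disjoint (gridCell a h (m := m))) := by
  have hm' : (0 : ℝ) < m := by exact_mod_cast hm
  have hs : 0 < h / m := by positivity
  intro k l hkl
  refine Set.disjoint_left.2 fun x hk hl => hkl ?_
  have key : ∀ k l : Fin d → Fin m, x ∈ gridCell a h k → x ∈ gridCell a h l →
      ∀ i, (k i : ℕ) ≤ l i := by
    intro k l hk hl i
    have h1 := (hk i).1
    have h2 := (hl i).2
    have h3 : ((k i : ℕ) : ℝ) * (h / m) < ((l i : ℕ) + 1) * (h / m) := by linarith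
    have h4 := lt_of_mul_lt_mul_right h3 hs.le
    have h5 : (k i : ℕ) < (l i : ℕ) + 1 := by exact_mod_cast h4
    omega
  funext i
  exact Fin.ext (le_antisymm (key k l hk hl i) (key l k hl hk i))

/-- The Poincaré inequality on a cube for functions with mean zero on all cells of a grid. -/
theorem poincare_grid {f : Euc d → ℂ} {W : Set (Euc d)} (hW : IsOpen W)
    (hf : ContDiffOn ℝ 1 f W) {a : Fin d → ℝ} {h : ℝ} (hh : 0 < h) {m : ℕ} (hm : 0 < m)
    (hqW : halfOpenCube a h ⊆ W) (hfi : IntegrableOn f (halfOpenCube a h))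
    (h0 : ∀ k : Fin d → Fin m, ∫ x in gridCell a h k, f x = 0) :
    ∫⁻ x in halfOpenCube a h, ‖f x‖ₑ ^ 2 ≤
      ENNReal.ofReal (d * (h / m)) ^ 2 * 2 ^ d *
        ∫⁻ x in halfOpenCube a h, ‖fderiv ℝ f x‖ₑ ^ 2 := by
  have hmeas : ∀ k : Fin d → Fin m, MeasurableSet (gridCell a h k) := fun k =>
    measurableSet_halfOpenCube _ _
  rw [← iUnion_gridCell a hh hm, lintegral_iUnion hmeas (pairwise_disjoint_gridCell a hh hm),
    lintegral_iUnion hmeas (pairwise_disjoint_gridCell a hh hm), ← ENNReal.tsum_mul_left]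
  refine ENNReal.tsum_le_tsum fun k => ?_
  have hk := gridCell_subset a hh hm k
  refine poincare_of_setIntegral_eq_zero hW hf (hk.trans hqW) (convex_halfOpenCube _ _) (hmeas k)
    (hfi.mono_set hk) (volume_halfOpenCube_ne_top _ _) (by finiteness) (fun x hx y hy => ?_) (h0 k)
  rw [← ofReal_norm]
  exact ENNReal.ofReal_le_ofReal (norm_sub_le_of_mem_halfOpenCube hx hy)

end Grid

/-! ### Integration by parts for divergence form operators -/

section IntegrationByParts

variable {d : ℕ}

theorem contDiff_of_contDiffOn_of_tsupport_subset {V : Type*} [NormedAddCommGroup V]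
    [NormedSpace ℝ V] {n : ℕ∞ω} {f : Euc d → V} {W : Set (Euc d)} (hW : IsOpen W)
    (hf : ContDiffOn ℝ n f W) (hs : tsupport f ⊆ W) : ContDiff ℝ n f := by
  refine contDiff_iff_contDiffAt.2 fun x => ?_
  by_cases hx : x ∈ tsupport f
  · exact hf.contDiffAt (hW.mem_nhds (hs hx))
  · exact contDiffAt_const.congr_of_eventuallyEq (notMem_tsupport_iff_eventuallyEq.1 hx)

theorem tsupport_partialDeriv_subset (i : Fin d) (f : Euc d → ℂ) :
    tsupport (partialDeriv i f) ⊆ tsupport f :=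
  closure_minimal (fun x hx => support_fderiv_subset ℝ (f := f) fun h => hx (by
    simp [partialDeriv, h])) (isClosed_tsupport f)

theorem contDiffOn_partialDeriv {V : Type*} [NormedAddCommGroup V] [NormedSpace ℝ V]
    {m n : ℕ∞ω} {f : Euc d → V} {W : Set (Euc d)}
    (hW : IsOpen W) (hf : ContDiffOn ℝ n f W) (hmn : m + 1 ≤ n) (i : Fin d) :
    ContDiffOn ℝ m (partialDeriv i f) W :=
  (hf.fderiv_of_isOpen hW hmn).clm_apply contDiffOn_const

/-- The function q is controlled on W only. The products vanish off `tsupport p`, hence are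
continuous on the whole space, and there is no boundary term. -/
theorem integral_mul_partialDeriv_of_tsupport_left {p q : Euc d → ℂ} {W : Set (Euc d)}
    (hW : IsOpen W) (hp : ContDiffOn ℝ 1 p W) (hq : ContDiffOn ℝ 1 q W)
    (hpc : HasCompactSupport p) (hpW : tsupport p ⊆ W) (i : Fin d) :
    Integrable (fun x => p x * partialDeriv i q x) ∧
    Integrable (fun x => partialDeriv i p x * q x) ∧
    ∫ x, p x * partialDeriv i q x = -∫ x, partialDeriv i p x * q x := by
  have hi : ∀ {u v : Euc d → ℂ}, ContinuousOn u W → ContinuousOn v W → tsupport u ⊆ tsupport p →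
      Integrable (fun x => u x * v x) := by
    intro u v hu hv hup
    have hs : tsupport (fun x => u x * v x) ⊆ tsupport u := tsupport_mul_subset_left
    have hc : Continuous (fun x => u x * v x) := continuous_of_tsupport fun x hx =>
      (hu.mul hv).continuousAt (hW.mem_nhds (hpW (hup (hs hx))))
    exact hc.integrable_of_hasCompactSupport
      (hpc.isCompact.of_isClosed_subset (isClosed_tsupport _) (hs.trans hup))
  have h1 := hi hp.continuousOn (contDiffOn_partialDeriv (m := 0) hW hq (by simp) i).continuousOn
    le_rfl
  have h2 := hi (contDiffOn_partialDeriv (m := 0) hW hp (by simp) i).continuousOn hq.continuousOn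
    (tsupport_partialDeriv_subset i p)
  refine ⟨h1, h2, ?_⟩
  refine integral_bilinear_fderiv_right_eq_neg_left_of_integrable (B := ContinuousLinearMap.mul ℝ ℂ)
    h2 h1 (hi hp.continuousOn hq.continuousOn le_rfl) ?_ ?_
  · intro x _
    exact (contDiff_of_contDiffOn_of_tsupport_subset hW hp hpW).differentiable one_ne_zero x
  · intro x hx
    exact (hq.contDiffAt (hW.mem_nhds (hpW hx))).differentiableAt one_ne_zero

theorem integral_mul_partialDeriv_of_tsupport_right {p q : Euc d → ℂ} {W : Set (Euc d)}
    (hW : IsOpen W) (hp : ContDiffOn ℝ 1 p W) (hq : ContDiffOn ℝ 1 q W)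
    (hqc : HasCompactSupport q) (hqW : tsupport q ⊆ W) (i : Fin d) :
    Integrable (fun x => p x * partialDeriv i q x) ∧
    Integrable (fun x => partialDeriv i p x * q x) ∧
    ∫ x, p x * partialDeriv i q x = -∫ x, partialDeriv i p x * q x := by
  obtain ⟨h1, h2, h3⟩ := integral_mul_partialDeriv_of_tsupport_left hW hq hp hqc hqW i
  simp only [mul_comm (q _), mul_comm (partialDeriv i q _)] at h1 h2 h3
  exact ⟨h2, h1, by rw [h3, neg_neg]⟩

/-- The operator `u ↦ ∑_{i,j} ∂_i (a_{ij} ∂_j u)` in divergence form. -/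
noncomputable def divOp (a : Fin d → Fin d → Euc d → ℝ) (u : Euc d → ℂ) (x : Euc d) : ℂ :=
  ∑ i, ∑ j, partialDeriv i (fun y => a i j y • partialDeriv j u y) x

theorem tsupport_smul_partialDeriv_subset (b : Euc d → ℝ) (i : Fin d) (u : Euc d → ℂ) :
    tsupport (fun y => b y • partialDeriv i u y) ⊆ tsupport u :=
  (tsupport_smul_subset_right b (partialDeriv i u)).trans (tsupport_partialDeriv_subset i u)

theorem tsupport_divOp_subset (a : Fin d → Fin d → Euc d → ℝ) (u : Euc d → ℂ) :
    tsupport (divOp a u) ⊆ tsupport u := by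
  refine closure_minimal (fun x hx => ?_) (isClosed_tsupport u)
  by_contra hxu
  refine hx (Finset.sum_eq_zero fun i _ => Finset.sum_eq_zero fun j _ => ?_)
  refine image_eq_zero_of_notMem_tsupport fun h => hxu ?_
  exact tsupport_smul_partialDeriv_subset _ j u (tsupport_partialDeriv_subset i _ h)

theorem contDiffOn_divOp {a : Fin d → Fin d → Euc d → ℝ} {u : Euc d → ℂ} {W : Set (Euc d)}
    (hW : IsOpen W) (ha : ∀ i j, ContDiffOn ℝ ∞ (a i j) W) (hu : ContDiffOn ℝ ∞ u W) :
    ContDiffOn ℝ ∞ (divOp a u) W :=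
  ContDiffOn.sum fun i _ => ContDiffOn.sum fun j _ => contDiffOn_partialDeriv hW
    ((ha i j).smul (contDiffOn_partialDeriv hW hu (by simp) j)) (by simp) i

/-- Either factor may carry the compact support: Caccioppoli's inequality cuts off the test
function, while the symmetry of the operator uses both cases. -/
theorem integral_mul_divOp {a : Fin d → Fin d → Euc d → ℝ} {u ψ : Euc d → ℂ} {W : Set (Euc d)}
    (hW : IsOpen W) (ha : ∀ i j, ContDiffOn ℝ ∞ (a i j) W) (hu : ContDiffOn ℝ ∞ u W)
    (hψ : ContDiffOn ℝ 1 ψ W)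
    (hs : (HasCompactSupport ψ ∧ tsupport ψ ⊆ W) ∨ (HasCompactSupport u ∧ tsupport u ⊆ W)) :
    (∀ i j, Integrable fun x => partialDeriv i ψ x * (a i j x • partialDeriv j u x)) ∧
    ∫ x, ψ x * divOp a u x =
      -∑ i, ∑ j, ∫ x, partialDeriv i ψ x * (a i j x • partialDeriv j u x) := by
  have hq : ∀ i j, ContDiffOn ℝ 1 (fun y => a i j y • partialDeriv j u y) W := fun i j =>
    ((ha i j).of_le (by simp)).smul (contDiffOn_partialDeriv hW hu (WithTop.coe_le_coe.2 le_top) j)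
  have key : ∀ i j, _ := fun i j => show
      Integrable (fun x => ψ x * partialDeriv i (fun y => a i j y • partialDeriv j u y) x) ∧
      Integrable (fun x => partialDeriv i ψ x * (a i j x • partialDeriv j u x)) ∧
      ∫ x, ψ x * partialDeriv i (fun y => a i j y • partialDeriv j u y) x =
        -∫ x, partialDeriv i ψ x * (a i j x • partialDeriv j u x) by
    rcases hs with ⟨h1, h2⟩ | ⟨h1, h2⟩
    · exact integral_mul_partialDeriv_of_tsupport_left hW hψ (hq i j) h1 h2 i
    · have h3 := tsupport_smul_partialDeriv_subset (a i j) j u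
      exact integral_mul_partialDeriv_of_tsupport_right hW hψ (hq i j)
        (h1.isCompact.of_isClosed_subset (isClosed_tsupport _) h3) (h3.trans h2) i
  refine ⟨fun i j => (key i j).2.1, ?_⟩
  simp only [divOp, Finset.mul_sum]
  rw [integral_finsetSum _ fun i _ => integrable_finsetSum _ fun j _ => (key i j).1,
    ← Finset.sum_neg_distrib]
  refine Finset.sum_congr rfl fun i _ => ?_
  rw [integral_finsetSum _ fun j _ => (key i j).1, ← Finset.sum_neg_distrib]
  exact Finset.sum_congr rfl fun j _ => (key i j).2.2

/-- An operator in divergence form with symmetric coefficients is symmetric. -/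
theorem integral_mul_divOp_comm {a : Fin d → Fin d → Euc d → ℝ} {u φ : Euc d → ℂ}
    {W : Set (Euc d)} (hW : IsOpen W) (ha : ∀ i j, ContDiffOn ℝ ∞ (a i j) W)
    (hsymm : ∀ i j, ∀ x ∈ W, a i j x = a j i x)
    (hu : ContDiffOn ℝ ∞ u W) (hφ : ContDiffOn ℝ ∞ φ W)
    (huc : HasCompactSupport u) (huW : tsupport u ⊆ W) :
    ∫ x, φ x * divOp a u x = ∫ x, u x * divOp a φ x := by
  rw [(integral_mul_divOp hW ha hu (hφ.of_le (by simp)) (Or.inr ⟨huc, huW⟩)).2,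
    (integral_mul_divOp hW ha hφ (hu.of_le (by simp)) (Or.inl ⟨huc, huW⟩)).2,
    Finset.sum_comm]
  congr 1
  refine Finset.sum_congr rfl fun i _ => Finset.sum_congr rfl fun j _ => ?_
  congr 1
  ext x
  by_cases hx : x ∈ W
  · rw [hsymm i j x hx]
    simp only [Complex.real_smul]
    ring
  · have : partialDeriv i u x = 0 := image_eq_zero_of_notMem_tsupport
      fun h => hx (huW (tsupport_partialDeriv_subset i u h))
    simp [this]

end IntegrationByParts

/-! ### Ellipticity and Caccioppoli's inequality -/

section Caccioppoli

variable {d : ℕ}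

/-- The constant is the minimum of the form over K times the unit sphere, which is compact;
homogeneity extends the bound to all vectors. -/
theorem exists_pos_mul_le_quadForm {K : Set (Euc d)} (hK : IsCompact K)
    {a : Fin d → Fin d → Euc d → ℝ} (ha : ∀ i j, ContinuousOn (a i j) K)
    (hpos : ∀ x ∈ K, ∀ v : Euc d, v ≠ 0 → 0 < ∑ i, ∑ j, v i * a i j x * v j) :
    ∃ θ : ℝ, 0 < θ ∧ ∀ x ∈ K, ∀ v : Fin d → ℝ,
      θ * ∑ i, v i ^ 2 ≤ ∑ i, ∑ j, v i * a i j x * v j := by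
  have hc : IsCompact (K ×ˢ Metric.sphere (0 : Euc d) 1) := hK.prod (isCompact_sphere _ _)
  have hcont : ContinuousOn (fun p : Euc d × Euc d => ∑ i, ∑ j, p.2 i * a i j p.1 * p.2 j)
      (K ×ˢ Metric.sphere (0 : Euc d) 1) := by
    refine continuousOn_finsetSum _ fun i _ => continuousOn_finsetSum _ fun j _ => ?_
    refine ContinuousOn.mul (ContinuousOn.mul (by fun_prop) ?_) (by fun_prop)
    exact (ha i j).comp continuousOn_fst fun p hp => hp.1
  obtain ⟨θ, hθ, h⟩ : ∃ θ : ℝ, 0 < θ ∧ ∀ p ∈ K ×ˢ Metric.sphere (0 : Euc d) 1,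
      θ ≤ ∑ i, ∑ j, p.2 i * a i j p.1 * p.2 j := by
    rcases (K ×ˢ Metric.sphere (0 : Euc d) 1).eq_empty_or_nonempty with he | hne
    · exact ⟨1, one_pos, by simp [he]⟩
    · obtain ⟨p, hp, hmin⟩ := hc.exists_isMinOn hne hcont
      refine ⟨_, hpos p.1 hp.1 p.2 ?_, fun q hq => hmin hq⟩
      intro h0
      have := hp.2
      simp [h0] at this
  refine ⟨θ, hθ, fun x hx v => ?_⟩
  by_cases hv : v = 0
  · simp [hv]
  set w : Euc d := WithLp.toLp 2 v with hw
  have hw0 : w ≠ 0 := by simpa [hw] using hv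
  have hn : 0 < ‖w‖ := norm_pos_iff.2 hw0
  have hn2 : ‖w‖ ^ 2 = ∑ i, v i ^ 2 := by simp [EuclideanSpace.norm_sq_eq, hw]
  have h1 := h (x, ‖w‖⁻¹ • w) ⟨hx, by simp [norm_smul, hn.ne']⟩
  have h2 : ∑ i, ∑ j, (‖w‖⁻¹ • w) i * a i j x * (‖w‖⁻¹ • w) j =
      (‖w‖ ^ 2)⁻¹ * ∑ i, ∑ j, v i * a i j x * v j := by
    simp only [Finset.mul_sum, PiLp.smul_apply, smul_eq_mul, hw]
    refine Finset.sum_congr rfl fun i _ => Finset.sum_congr rfl fun j _ => ?_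
    field_simp
  simp only at h1
  rw [h2, inv_mul_eq_div, le_div_iff₀ (by positivity), hn2] at h1
  exact h1

/-- The real form is applied to real and imaginary parts separately; the mixed terms are purely
imaginary. -/
theorem mul_sum_normSq_le_re_quadForm {a : Fin d → Fin d → ℝ} {θ : ℝ}
    (h : ∀ v : Fin d → ℝ, θ * ∑ i, v i ^ 2 ≤ ∑ i, ∑ j, v i * a i j * v j) (z : Fin d → ℂ) :
    θ * ∑ i, ‖z i‖ ^ 2 ≤ (∑ i, ∑ j, starRingEnd ℂ (z i) * (a i j • z j)).re := by
  have h1 := h fun i => (z i).re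
  have h2 := h fun i => (z i).im
  calc θ * ∑ i, ‖z i‖ ^ 2 = θ * ∑ i, (z i).re ^ 2 + θ * ∑ i, (z i).im ^ 2 := by
        rw [← mul_add, ← Finset.sum_add_distrib]
        congr 1
        refine Finset.sum_congr rfl fun i _ => ?_
        rw [← Complex.normSq_eq_norm_sq, Complex.normSq_apply]
        ring
    _ ≤ _ := add_le_add h1 h2
    _ = _ := by
        simp only [Complex.re_sum, ← Finset.sum_add_distrib]
        refine Finset.sum_congr rfl fun i _ => Finset.sum_congr rfl fun j _ => ?_
        simp
        ring

theorem partialDeriv_sq_smul_conj {η : Euc d → ℝ} {f : Euc d → ℂ} {x : Euc d}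
    (hη : DifferentiableAt ℝ η x) (hf : DifferentiableAt ℝ f x) (i : Fin d) :
    partialDeriv i (fun y => (η y ^ 2) • starRingEnd ℂ (f y)) x =
      (2 * η x * partialDeriv i η x) • starRingEnd ℂ (f x) +
        (η x ^ 2) • starRingEnd ℂ (partialDeriv i f x) := by
  have h1 := (hη.hasFDerivAt.pow 2).smul
    ((Complex.conjCLE.toContinuousLinearMap.hasFDerivAt (x := f x)).comp x hf.hasFDerivAt)
  rw [partialDeriv, HasFDerivAt.fderiv (f := fun y => (η y ^ 2) • starRingEnd ℂ (f y)) h1]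
  simp [partialDeriv]
  ring

/-- The pointwise core of Caccioppoli's inequality, with t = η, e = ∇η, w the conjugate of f and z =
∇f. The term containing ∇η is split by Young's inequality, and half of the ellipticity absorbs its
gradient part. -/
theorem re_quadForm_partialDeriv_ge {a : Fin d → Fin d → ℝ} {θ A E : ℝ} (hθ : 0 < θ)
    (h : ∀ v : Fin d → ℝ, θ * ∑ i, v i ^ 2 ≤ ∑ i, ∑ j, v i * a i j * v j)
    (hA : ∀ i j, |a i j| ≤ A) (t : ℝ) (e : Fin d → ℝ) (he : ∀ i, |e i| ≤ E) (w : ℂ)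
    (z : Fin d → ℂ) :
    θ / 2 * (t ^ 2 * ∑ i, ‖z i‖ ^ 2) - 2 * (d * E * A) ^ 2 / θ * d * ‖w‖ ^ 2 ≤
      (∑ i, ∑ j, ((2 * t * e i) • w + (t ^ 2) • starRingEnd ℂ (z i)) * (a i j • z j)).re := by
  have h1 := mul_sum_normSq_le_re_quadForm h z
  have h2 : (∑ i, ∑ j, ((2 * t * e i) • w + (t ^ 2) • starRingEnd ℂ (z i)) * (a i j • z j)).re =
      t ^ 2 * (∑ i, ∑ j, starRingEnd ℂ (z i) * (a i j • z j)).re +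
      (∑ j, ∑ i, (2 * t * e i) • w * (a i j • z j)).re := by
    rw [Finset.sum_comm (f := fun j i => (2 * t * e i) • w * (a i j • z j)),
      ← Complex.re_ofReal_mul, ← Complex.add_re]
    congr 1
    rw [Finset.mul_sum, ← Finset.sum_add_distrib]
    refine Finset.sum_congr rfl fun i _ => ?_
    rw [Finset.mul_sum, ← Finset.sum_add_distrib]
    refine Finset.sum_congr rfl fun j _ => ?_
    simp only [Complex.real_smul]
    push_cast
    ring
  have h3 : ∀ j, -(θ / 2 * (t ^ 2 * ‖z j‖ ^ 2) + 2 * (d * E * A) ^ 2 / θ * ‖w‖ ^ 2) ≤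
      (∑ i, (2 * t * e i) • w * (a i j • z j)).re := by
    intro j
    have h4 : ‖∑ i, (2 * t * e i) • w * (a i j • z j)‖ ≤
        2 * (|t| * ‖z j‖) * (d * E * A * ‖w‖) := by
      refine (norm_sum_le _ _).trans ?_
      calc ∑ i, ‖(2 * t * e i) • w * (a i j • z j)‖
          ≤ ∑ _i : Fin d, 2 * |t| * E * ‖w‖ * (A * ‖z j‖) := by
            refine Finset.sum_le_sum fun i _ => ?_
            rw [norm_mul, norm_smul, norm_smul, Real.norm_eq_abs, Real.norm_eq_abs, abs_mul,
              abs_mul, abs_two]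
            have := he i
            have := hA i j
            have := (abs_nonneg (e i)).trans (he i)
            gcongr
        _ = _ := by
            simp
            ring
    have h5 : 2 * (|t| * ‖z j‖) * (d * E * A * ‖w‖) ≤
        θ / 2 * (t ^ 2 * ‖z j‖ ^ 2) + 2 * (d * E * A) ^ 2 / θ * ‖w‖ ^ 2 := by
      -- Young's inequality as a completed square, weighted so that exactly θ/2 of the gradient term
      -- is spent.
      have h6 : 0 ≤ (θ * (|t| * ‖z j‖) - 2 * (d * E * A * ‖w‖)) ^ 2 / (2 * θ) := by positivity
      have h7 : (θ * (|t| * ‖z j‖) - 2 * (d * E * A * ‖w‖)) ^ 2 / (2 * θ) =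
          θ / 2 * (|t| ^ 2 * ‖z j‖ ^ 2) + 2 * (d * E * A) ^ 2 / θ * ‖w‖ ^ 2 -
          2 * (|t| * ‖z j‖) * (d * E * A * ‖w‖) := by
        field_simp
        ring
      rw [h7, sq_abs] at h6
      linarith
    have h8 := (Complex.abs_re_le_norm (∑ i, (2 * t * e i) • w * (a i j • z j))).trans
      (h4.trans h5)
    exact (abs_le.1 h8).1
  rw [h2, Complex.re_sum (f := fun j => ∑ i, (2 * t * e i) • w * (a i j • z j))]
  have h9 := Finset.sum_le_sum fun j (_ : j ∈ Finset.univ) => h3 j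
  rw [Finset.sum_neg_distrib, Finset.sum_add_distrib, ← Finset.mul_sum, ← Finset.mul_sum] at h9
  simp only [Finset.sum_const, Finset.card_univ, Fintype.card_fin, nsmul_eq_mul] at h9
  have h10 := mul_le_mul_of_nonneg_left h1 (sq_nonneg t)
  nlinarith

/-- Caccioppoli's inequality for an elliptic operator in divergence form. -/
theorem exists_caccioppoli {a : Fin d → Fin d → Euc d → ℝ} {W : Set (Euc d)} (hW : IsOpen W)
    (ha : ∀ i j, ContDiffOn ℝ ∞ (a i j) W)
    (hpos : ∀ x ∈ W, ∀ v : Euc d, v ≠ 0 → 0 < ∑ i, ∑ j, v i * a i j x * v j)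
    {η : Euc d → ℝ} (hη : ContDiff ℝ ∞ η) (hηc : HasCompactSupport η) (hηW : tsupport η ⊆ W) :
    ∃ θ : ℝ, 0 < θ ∧ ∃ C : ℝ, 0 ≤ C ∧ ∀ f : Euc d → ℂ, ContDiffOn ℝ ∞ f W →
      Integrable (fun x => η x ^ 2 * ∑ j, ‖partialDeriv j f x‖ ^ 2) ∧
      θ * ∫ x, η x ^ 2 * ∑ j, ‖partialDeriv j f x‖ ^ 2 ≤
        C * (∫ x in tsupport η, ‖f x‖ ^ 2) -
          (∫ x, (η x ^ 2) • starRingEnd ℂ (f x) * divOp a f x).re := by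
  have hK : IsCompact (tsupport η) := hηc
  obtain ⟨θ, hθ, hθa⟩ := exists_pos_mul_le_quadForm hK
    (fun i j => (ha i j).continuousOn.mono hηW) fun x hx => hpos x (hηW hx)
  obtain ⟨A, hA⟩ : ∃ A : ℝ, ∀ i j, ∀ x ∈ tsupport η, |a i j x| ≤ A := by
    choose A hA using fun i j => hK.exists_bound_of_continuousOn
      ((ha i j).continuousOn.mono hηW)
    refine ⟨∑ i, ∑ j, |A i j|, fun i j x hx => (hA i j x hx).trans ((le_abs_self _).trans ?_)⟩
    refine le_trans ?_ (Finset.single_le_sum (f := fun i => ∑ j, |A i j|)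
      (fun i _ => Finset.sum_nonneg fun j _ => abs_nonneg _) (Finset.mem_univ i))
    exact Finset.single_le_sum (f := fun j => |A i j|) (fun j _ => abs_nonneg _)
      (Finset.mem_univ j)
  have hη1 : ∀ i, Continuous (partialDeriv i η) := fun i =>
    (hη.continuous_fderiv (by simp)).clm_apply continuous_const
  obtain ⟨E, hE⟩ : ∃ E : ℝ, ∀ i, ∀ x ∈ tsupport η, |partialDeriv i η x| ≤ E := by
    choose E hE using fun i => hK.exists_bound_of_continuousOn (hη1 i).continuousOn
    refine ⟨∑ i, |E i|, fun i x hx => (hE i x hx).trans ((le_abs_self _).trans ?_)⟩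
    exact Finset.single_le_sum (f := fun i => |E i|) (fun i _ => abs_nonneg _) (Finset.mem_univ i)
  refine ⟨θ / 2, by positivity, 2 * (d * E * A) ^ 2 / θ * d, by positivity, fun f hf => ?_⟩
  set C := 2 * (d * E * A) ^ 2 / θ * d with hC
  -- The classical test function, η² times the conjugate of f.
  set ψ : Euc d → ℂ := fun y => (η y ^ 2) • starRingEnd ℂ (f y) with hψ
  have hψs : tsupport ψ ⊆ tsupport η := closure_mono fun x hx => by
    intro h
    exact hx (by simp [hψ, h])
  have hψc : HasCompactSupport ψ := hK.of_isClosed_subset (isClosed_tsupport _) hψs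
  have hψd : ContDiffOn ℝ 1 ψ W :=
    ((hη.of_le (by simp)).contDiffOn.pow 2).smul
      (Complex.conjCLE.contDiff.comp_contDiffOn (hf.of_le (by simp)))
  obtain ⟨hint, hgreen⟩ := integral_mul_divOp hW ha hf hψd (Or.inl ⟨hψc, hψs.trans hηW⟩)
  have hre : -(∫ x, ψ x * divOp a f x).re =
      ∫ x, (∑ i, ∑ j, partialDeriv i ψ x * (a i j x • partialDeriv j f x)).re := by
    rw [hgreen, Complex.neg_re, neg_neg]
    have hsum : ∫ x, ∑ i, ∑ j, partialDeriv i ψ x * (a i j x • partialDeriv j f x) =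
        ∑ i, ∑ j, ∫ x, partialDeriv i ψ x * (a i j x • partialDeriv j f x) := by
      rw [integral_finsetSum _ fun i _ => integrable_finsetSum _ fun j _ => hint i j]
      exact Finset.sum_congr rfl fun i _ => integral_finsetSum _ fun j _ => hint i j
    rw [← hsum]
    exact (integral_re (integrable_finsetSum _ fun i _ => integrable_finsetSum _ fun j _ =>
      hint i j)).symm
  have hf1 : ∀ j, ContinuousOn (partialDeriv j f) W := fun j =>
    (contDiffOn_partialDeriv (m := 0) hW hf (by simp) j).continuousOn
  have hi1 : Integrable (fun x => η x ^ 2 * ∑ j, ‖partialDeriv j f x‖ ^ 2) := by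
    have hs : tsupport (fun x => η x ^ 2 * ∑ j, ‖partialDeriv j f x‖ ^ 2) ⊆ tsupport η :=
      closure_mono fun x hx h => hx (by simp [h])
    have hc : Continuous (fun x => η x ^ 2 * ∑ j, ‖partialDeriv j f x‖ ^ 2) :=
      continuous_of_tsupport fun x hx => ((hη.continuous.pow 2).continuousAt.mul
        ((continuousOn_finsetSum _ fun j _ => (hf1 j).norm.pow 2).continuousAt
          (hW.mem_nhds (hηW (hs hx)))))
    exact hc.integrable_of_hasCompactSupport (hK.of_isClosed_subset (isClosed_tsupport _) hs)
  have hi2 : IntegrableOn (fun x => ‖f x‖ ^ 2) (tsupport η) :=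
    ((hf.continuousOn.mono hηW).norm.pow 2).integrableOn_compact hK
  have hi3 : Integrable ((tsupport η).indicator fun x => ‖f x‖ ^ 2) :=
    (integrable_indicator_iff (isClosed_tsupport η).measurableSet).2 hi2
  refine ⟨hi1, ?_⟩
  rw [← sub_nonneg, sub_eq_add_neg, sub_eq_add_neg, hre,
    ← integral_indicator (isClosed_tsupport η).measurableSet]
  have hpt : ∀ x, θ / 2 * (η x ^ 2 * ∑ j, ‖partialDeriv j f x‖ ^ 2) -
      C * (tsupport η).indicator (fun x => ‖f x‖ ^ 2) x ≤
      (∑ i, ∑ j, partialDeriv i ψ x * (a i j x • partialDeriv j f x)).re := by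
    intro x
    by_cases hx : x ∈ tsupport η
    · have hd := partialDeriv_sq_smul_conj (hη.differentiable (by simp) x)
        ((hf.contDiffAt (hW.mem_nhds (hηW hx))).differentiableAt (by simp))
      simp only [hψ, hd, Set.indicator_of_mem hx]
      have h := re_quadForm_partialDeriv_ge hθ (hθa x hx) (fun i j => hA i j x hx) (η x)
        (fun i => partialDeriv i η x) (fun i => hE i x hx) (starRingEnd ℂ (f x))
        (fun i => partialDeriv i f x)
      simpa using h
    · have h1 : ∀ i, partialDeriv i ψ x = 0 := fun i => image_eq_zero_of_notMem_tsupport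
        fun h => hx (hψs (tsupport_partialDeriv_subset i ψ h))
      simp [h1, hx, image_eq_zero_of_notMem_tsupport hx]
  have h := integral_mono ((hi1.const_mul (θ / 2)).sub (hi3.const_mul C))
    (integrable_finsetSum _ fun i _ => integrable_finsetSum _ fun j _ => hint i j).re hpt
  rw [integral_sub' (hi1.const_mul (θ / 2)) (hi3.const_mul C), integral_const_mul,
    integral_const_mul] at h
  simp only [RCLike.re_to_complex] at h
  linarith

end Caccioppoli

/-! ### Local energy estimates for the Laplacian -/

section Local

variable {d : ℕ}

theorem enorm_sq_eq_ofReal {V : Type*} [NormedAddCommGroup V] (z : V) :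
    ‖z‖ₑ ^ 2 = ENNReal.ofReal (‖z‖ ^ 2) := by
  rw [ENNReal.ofReal_pow (norm_nonneg _), ofReal_norm]

theorem setLIntegral_enorm_sq_eq {V : Type*} [NormedAddCommGroup V] {f : Euc d → V}
    {A : Set (Euc d)} (hf : IntegrableOn (fun x => ‖f x‖ ^ 2) A) :
    ∫⁻ x in A, ‖f x‖ₑ ^ 2 = ENNReal.ofReal (∫ x in A, ‖f x‖ ^ 2) := by
  rw [ofReal_integral_eq_lintegral_ofReal hf (ae_of_all _ fun x => by positivity)]
  simp only [enorm_sq_eq_ofReal]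

theorem norm_fderiv_sq_le (f : Euc d → ℂ) (x : Euc d) :
    ‖fderiv ℝ f x‖ ^ 2 ≤ d * ∑ j, ‖partialDeriv j f x‖ ^ 2 := by
  have h : ‖fderiv ℝ f x‖ ≤ ∑ j, ‖partialDeriv j f x‖ := by
    refine ContinuousLinearMap.opNorm_le_bound _ (Finset.sum_nonneg fun j _ => norm_nonneg _)
      fun v => ?_
    conv_lhs => rw [← sum_smul_stdVec v, map_sum]
    rw [Finset.sum_mul]
    refine (norm_sum_le _ _).trans (Finset.sum_le_sum fun j _ => ?_)
    rw [map_smul, norm_smul, mul_comm]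
    exact mul_le_mul_of_nonneg_left (PiLp.norm_apply_le v j) (norm_nonneg _)
  calc ‖fderiv ℝ f x‖ ^ 2 ≤ (∑ j, ‖partialDeriv j f x‖) ^ 2 := by gcongr
    _ ≤ _ := by simpa using sq_sum_le_card_mul_sum_sq (s := (Finset.univ : Finset (Fin d)))
                  (f := fun j => ‖partialDeriv j f x‖)

/-- Near every point there are a cutoff function and a cube on which it is one. -/
theorem exists_cutoff_cube {W : Set (Euc d)} (hW : IsOpen W) {x₀ : Euc d} (hx₀ : x₀ ∈ W) :
    ∃ (η : Euc d → ℝ) (b : Fin d → ℝ) (h : ℝ), ContDiff ℝ ∞ η ∧ HasCompactSupport η ∧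
      tsupport η ⊆ W ∧ (∀ x, |η x| ≤ 1) ∧ 0 < h ∧ halfOpenCube b h ∈ 𝓝 x₀ ∧
      (∀ x ∈ halfOpenCube b h, η x = 1) := by
  obtain ⟨R, hR, hRW⟩ := Metric.nhds_basis_closedBall.mem_iff.1 (hW.mem_nhds hx₀)
  let β : ContDiffBump x₀ := ⟨R / 2, R, by positivity, by linarith⟩
  -- With this side the diameter bound d h is at most R/2, so the cube lies in the ball on which the
  -- bump function is one.
  set h : ℝ := R / (2 * (d + 1)) with hh
  have hpos : 0 < h := by positivity
  refine ⟨β, fun i => x₀ i - h / 2, h, β.contDiff, β.hasCompactSupport, ?_, ?_, hpos, ?_, ?_⟩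
  · rw [β.tsupport_eq]
    exact hRW
  · intro x
    rw [abs_of_nonneg β.nonneg]
    exact β.le_one
  · have : (⋂ i, (fun x : Euc d => x i) ⁻¹' Set.Ioo (x₀ i - h / 2) (x₀ i + h / 2)) ∈ 𝓝 x₀ := by
      refine (isOpen_iInter_of_finite fun i => isOpen_Ioo.preimage (by fun_prop)).mem_nhds ?_
      simp [hpos]
    refine Filter.mem_of_superset this fun x hx i => ?_
    have := Set.mem_iInter.1 hx i
    simp only [Set.mem_preimage, Set.mem_Ioo] at this
    exact ⟨this.1.le, by linarith [this.2]⟩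
  · intro x hx
    refine β.one_of_mem_closedBall ?_
    rw [Metric.mem_closedBall, dist_eq_norm]
    have hx0 : x₀ ∈ halfOpenCube (fun i => x₀ i - h / 2) h := fun i =>
      ⟨by linarith, by linarith⟩
    refine (norm_sub_le_of_mem_halfOpenCube hx hx0).trans ?_
    change d * h ≤ R / 2
    rw [hh, ← sub_nonneg]
    have : R / 2 - d * (R / (2 * (d + 1))) = R / (2 * (d + 1)) := by
      field_simp
      ring
    rw [this]
    positivity

variable {N : Type*} [TopologicalSpace N] [ChartedSpace (Euc d) N]
  [IsManifold 𝓘(ℝ, Euc d) ω N] {c : OpenPartialHomeomorph N (Euc d)}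

/-- The coefficients `√(det g) g^{ij}` of the Laplacian in divergence form. -/
noncomputable def laplaceCoeff (g : AnalyticMetric d N) (c : OpenPartialHomeomorph N (Euc d))
    (i j : Fin d) (x : Euc d) : ℝ :=
  volDensity g c x * gramInv g c x i j

theorem chartLaplacian_eq (g : AnalyticMetric d N) (c : OpenPartialHomeomorph N (Euc d))
    (u : N → ℂ) (x : Euc d) :
    chartLaplacian g c u x =
      ((volDensity g c x)⁻¹ : ℝ) • divOp (laplaceCoeff g c) (u ∘ c.symm) x := rfl

theorem divOp_laplaceCoeff_eq (g : AnalyticMetric d N) (hc : c ∈ analyticCharts d N)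
    {u : N → ℂ} {x : Euc d} (hx : x ∈ c.target) :
    divOp (laplaceCoeff g c) (u ∘ c.symm) x = volDensity g c x • chartLaplacian g c u x := by
  rw [chartLaplacian_eq, smul_smul, mul_inv_cancel₀ (volDensity_pos g hc hx).ne', one_smul]

theorem contDiffOn_laplaceCoeff (g : AnalyticMetric d N) (hc : c ∈ analyticCharts d N)
    (i j : Fin d) : ContDiffOn ℝ ω (laplaceCoeff g c i j) c.target :=
  (contDiffOn_volDensity g hc).mul (contDiffOn_gramInv g hc i j)

theorem gramInv_quadForm_pos (g : AnalyticMetric d N) (hc : c ∈ analyticCharts d N)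
    {x : Euc d} (hx : x ∈ c.target) {v : Euc d} (hv : v ≠ 0) :
    0 < ∑ i, ∑ j, v i * gramInv g c x i j * v j := by
  have h := (Matrix.posDef_iff_dotProduct_mulVec.1 (gramInv_posDef g hc hx)).2
    (x := fun i => v i) (fun h => hv (by ext i; exact congrFun h i))
  refine h.trans_eq ?_
  simp [dotProduct, Matrix.mulVec, Finset.mul_sum, mul_assoc]

theorem laplaceCoeff_quadForm_pos (g : AnalyticMetric d N) (hc : c ∈ analyticCharts d N)
    {x : Euc d} (hx : x ∈ c.target) {v : Euc d} (hv : v ≠ 0) :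
    0 < ∑ i, ∑ j, v i * laplaceCoeff g c i j x * v j := by
  have h := mul_pos (volDensity_pos g hc hx) (gramInv_quadForm_pos g hc hx hv)
  refine h.trans_eq ?_
  simp only [Finset.mul_sum, laplaceCoeff]
  refine Finset.sum_congr rfl fun i _ => Finset.sum_congr rfl fun j _ => ?_
  ring

theorem contDiffOn_comp_symm (hc : c ∈ analyticCharts d N) {u : N → ℂ}
    (hu : ContMDiff 𝓘(ℝ, Euc d) 𝓘(ℝ, ℂ) ∞ u) : ContDiffOn ℝ ∞ (u ∘ c.symm) c.target := by
  rw [← contMDiffOn_iff_contDiffOn]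
  exact hu.comp_contMDiffOn ((contMDiffOn_symm_of_mem_analyticCharts hc).of_le (by simp))

variable [MeasurableSpace N] [BorelSpace N]

/-- On a compact subset of the chart the density is bounded below, so Lebesgue norms are controlled
by Riemannian ones; B is the inverse of that lower bound. -/
theorem exists_setIntegral_norm_sq_le (g : AnalyticMetric d N) (hc : c ∈ analyticCharts d N)
    {K : Set (Euc d)} (hK : IsCompact K) (hKc : K ⊆ c.target) :
    ∃ B : ℝ, 0 < B ∧ ∀ (u : N → ℂ) (E : ℝ), Continuous u → 0 ≤ E →
      ∫⁻ p, ‖u p‖ₑ ^ 2 ∂(riemannianVolume g) ≤ ENNReal.ofReal E →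
        IntegrableOn (fun x => ‖u (c.symm x)‖ ^ 2) K ∧
        ∫ x in K, ‖u (c.symm x)‖ ^ 2 ≤ B * E := by
  have hs := (contDiffOn_volDensity g hc).continuousOn.mono hKc
  obtain ⟨s, hs0, hsK⟩ : ∃ s : ℝ, 0 < s ∧ ∀ x ∈ K, s ≤ volDensity g c x := by
    rcases K.eq_empty_or_nonempty with rfl | hne
    · exact ⟨1, one_pos, by simp⟩
    · obtain ⟨x, hx, hmin⟩ := hK.exists_isMinOn hne hs
      exact ⟨_, volDensity_pos g hc (hKc hx), fun y hy => hmin hy⟩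
  refine ⟨s⁻¹, by positivity, fun u E hu hE h => ?_⟩
  have hi : IntegrableOn (fun x => ‖u (c.symm x)‖ ^ 2) K :=
    (((hu.comp_continuousOn c.continuousOn_symm).mono hKc).norm.pow 2).integrableOn_compact hK
  refine ⟨hi, ?_⟩
  have h1 : ENNReal.ofReal (s * ∫ x in K, ‖u (c.symm x)‖ ^ 2) ≤ ENNReal.ofReal E := by
    calc ENNReal.ofReal (s * ∫ x in K, ‖u (c.symm x)‖ ^ 2)
        = ∫⁻ x in K, ENNReal.ofReal s * ‖u (c.symm x)‖ₑ ^ 2 := by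
          rw [ENNReal.ofReal_mul hs0.le, lintegral_const_mul' _ _ (by finiteness),
            setLIntegral_enorm_sq_eq hi]
      _ ≤ ∫⁻ x in K, ENNReal.ofReal (volDensity g c x) * ‖u (c.symm x)‖ₑ ^ 2 := by
          refine setLIntegral_mono' hK.measurableSet fun x hx => ?_
          gcongr
          exact hsK x hx
      _ = ∫⁻ p in c.source ∩ c ⁻¹' K, ‖u p‖ₑ ^ 2 ∂(riemannianVolume g) :=
          (setLIntegral_riemannianVolume g hc (hu.measurable.enorm.pow_const 2)
            hK.measurableSet hKc).symm
      _ ≤ _ := (setLIntegral_le_lintegral _ _).trans h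
  rw [ENNReal.ofReal_le_ofReal_iff hE] at h1
  rw [inv_mul_eq_div, le_div_iff₀ hs0]
  linarith

/-- Local energy estimates: the local `L²` norm of a function with mean zero on all cells of a fine
grid is controlled by the norms of the function and its Laplacian, and very negative eigenvalues
are impossible. -/
theorem exists_local_energy_estimate (g : AnalyticMetric d N) (hc : c ∈ analyticCharts d N)
    {p : N} (hp : p ∈ c.source) :
    ∃ (b : Fin d → ℝ) (l : ℝ), 0 < l ∧ (∃ K, IsCompact K ∧ halfOpenCube b l ⊆ K ∧ K ⊆ c.target) ∧
      c.source ∩ c ⁻¹' halfOpenCube b l ∈ 𝓝 p ∧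
      ∃ A : ℝ, 0 < A ∧
      (∀ (u h : N → ℂ) (E Λ : ℝ) (m : ℕ), ContMDiff 𝓘(ℝ, Euc d) 𝓘(ℝ, ℂ) ∞ u → Continuous h →
        0 ≤ E → 1 ≤ Λ → 0 < m →
        (∀ x ∈ c.target, -chartLaplacian g c u x = h (c.symm x)) →
        (∀ k : Fin d → Fin m, ∫ x in gridCell b l k, u (c.symm x) = 0) →
        ∫⁻ p, ‖u p‖ₑ ^ 2 ∂(riemannianVolume g) ≤ ENNReal.ofReal E →
        ∫⁻ p, ‖h p‖ₑ ^ 2 ∂(riemannianVolume g) ≤ ENNReal.ofReal (Λ ^ 2 * E) →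
        ∫⁻ p in c.source ∩ c ⁻¹' halfOpenCube b l, ‖u p‖ₑ ^ 2 ∂(riemannianVolume g) ≤
          ENNReal.ofReal (A * Λ / m ^ 2 * E)) ∧
      (∀ (u : N → ℂ) (E ev : ℝ), IsLaplaceEigenfunction g u ev → 0 ≤ E → ev < 0 →
        ∫⁻ p, ‖u p‖ₑ ^ 2 ∂(riemannianVolume g) ≤ ENNReal.ofReal E →
        ∫⁻ p in c.source ∩ c ⁻¹' halfOpenCube b l, ‖u p‖ₑ ^ 2 ∂(riemannianVolume g) ≤
          ENNReal.ofReal (A / |ev| * E)) := by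
  obtain ⟨η, b, l, hη, hηc, hηW, hη1, hl, hnhds, hone⟩ :=
    exists_cutoff_cube c.open_target (c.map_source hp)
  set Q := halfOpenCube b l with hQ
  set K := tsupport η with hKdef
  have hK : IsCompact K := hηc
  have hQK : Q ⊆ K := fun x hx => subset_tsupport η (by simp [hone x hx])
  have hQm : MeasurableSet Q := measurableSet_halfOpenCube _ _
  have hKm : MeasurableSet K := hK.measurableSet
  have ha : ∀ i j, ContDiffOn ℝ ∞ (laplaceCoeff g c i j) c.target := fun i j =>
    (contDiffOn_laplaceCoeff g hc i j).of_le (by simp)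
  obtain ⟨θ, hθ, C, hC, hcacc⟩ := exists_caccioppoli c.open_target ha
    (fun x hx v hv => laplaceCoeff_quadForm_pos g hc hx hv) hη hηc hηW
  obtain ⟨B, hB, hBu⟩ := exists_setIntegral_norm_sq_le g hc hK hηW
  have hscont := (contDiffOn_volDensity g hc).continuousOn
  obtain ⟨S, hS0, hS⟩ : ∃ S : ℝ, 0 < S ∧ ∀ x ∈ K, volDensity g c x ≤ S := by
    obtain ⟨S, hS⟩ := hK.exists_bound_of_continuousOn (hscont.mono hηW)
    exact ⟨|S| + 1, by positivity, fun x hx => (le_abs_self _).trans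
      ((hS x hx).trans (by linarith [le_abs_self S]))⟩
  -- The first summand combines the Poincaré and Caccioppoli constants for the grid estimate. The
  -- second, C B, serves negative eigenvalues, and the last one only ensures positivity.
  refine ⟨b, l, hl, ⟨K, hK, hQK, hηW⟩, ?_, S * ((d * l) ^ 2 * 2 ^ d * (d * (B * (C + S) / θ))) +
      C * B + 1, by positivity, ?_, ?_⟩
  · exact Filter.inter_mem (c.open_source.mem_nhds hp)
      ((c.continuousAt hp).preimage_mem_nhds hnhds)
  · intro u h E Λ m hu hh hE hΛ hm heq h0 hEu hEh
    have hf := contDiffOn_comp_symm hc hu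
    obtain ⟨hiu, hu2⟩ := hBu u E hu.continuous hE hEu
    obtain ⟨hih, hh2⟩ := hBu h (Λ ^ 2 * E) hh (by positivity) hEh
    obtain ⟨hXi, hX⟩ := hcacc _ hf
    set X := ∫ x, η x ^ 2 * ∑ j, ‖partialDeriv j (u ∘ c.symm) x‖ ^ 2 with hXdef
    have hgi : IntegrableOn (fun x => S / 2 * (Λ * ‖u (c.symm x)‖ ^ 2) +
        S / 2 * (Λ⁻¹ * ‖h (c.symm x)‖ ^ 2)) K :=
      ((hiu.const_mul Λ).const_mul (S / 2)).add ((hih.const_mul Λ⁻¹).const_mul (S / 2))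
    -- Young's inequality in the form |u||h| ≤ (Λ|u|² + Λ⁻¹|h|²)/2: as ‖h‖² ≤ Λ²E, both halves are
    -- of size ΛE. A bound linear in Λ is what the exponent 2/d in Weyl's law requires.
    have hcross : -(∫ x, (η x ^ 2) • starRingEnd ℂ ((u ∘ c.symm) x) *
        divOp (laplaceCoeff g c) (u ∘ c.symm) x).re ≤ S * B * Λ * E := by
      have h1 := norm_integral_le_of_norm_le ((integrable_indicator_iff hKm).2 hgi)
        (f := fun x => (η x ^ 2) • starRingEnd ℂ ((u ∘ c.symm) x) *
          divOp (laplaceCoeff g c) (u ∘ c.symm) x) (ae_of_all _ fun x => ?_)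
      · rw [integral_indicator hKm, integral_add ((hiu.const_mul Λ).const_mul (S / 2))
          ((hih.const_mul Λ⁻¹).const_mul (S / 2))] at h1
        simp only [integral_const_mul] at h1
        refine (neg_le_abs _).trans ((Complex.abs_re_le_norm _).trans (h1.trans ?_))
        calc S / 2 * (Λ * ∫ x in K, ‖u (c.symm x)‖ ^ 2) +
              S / 2 * (Λ⁻¹ * ∫ x in K, ‖h (c.symm x)‖ ^ 2)
            ≤ S / 2 * (Λ * (B * E)) + S / 2 * (Λ⁻¹ * (B * (Λ ^ 2 * E))) := by gcongr
          _ = S * B * Λ * E := by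
            field_simp
            ring
      · by_cases hx : x ∈ K
        · rw [Set.indicator_of_mem hx, divOp_laplaceCoeff_eq g hc (hηW hx)]
          have e1 := heq x (hηW hx)
          have e2 : ‖chartLaplacian g c u x‖ = ‖h (c.symm x)‖ := by rw [← e1, norm_neg]
          rw [norm_mul, norm_smul, norm_smul, e2, RCLike.norm_conj, Function.comp_apply,
            Real.norm_eq_abs, Real.norm_eq_abs, abs_of_pos (volDensity_pos g hc (hηW hx)),
            abs_pow]
          have e3 : |η x| ^ 2 ≤ 1 := pow_le_one₀ (abs_nonneg _) (hη1 x)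
          have e4 := hS x hx
          have e5 := (volDensity_pos g hc (hηW hx)).le
          calc |η x| ^ 2 * ‖u (c.symm x)‖ * (volDensity g c x * ‖h (c.symm x)‖)
              ≤ 1 * ‖u (c.symm x)‖ * (S * ‖h (c.symm x)‖) := by gcongr
            _ ≤ _ := by
              have e6 : 0 ≤ S / 2 * (Λ⁻¹ *
                  (Λ * ‖u (c.symm x)‖ - ‖h (c.symm x)‖) ^ 2) := by positivity
              have e7 : S / 2 * (Λ⁻¹ * (Λ * ‖u (c.symm x)‖ - ‖h (c.symm x)‖) ^ 2) =
                  S / 2 * (Λ * ‖u (c.symm x)‖ ^ 2) + S / 2 * (Λ⁻¹ * ‖h (c.symm x)‖ ^ 2) -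
                  1 * ‖u (c.symm x)‖ * (S * ‖h (c.symm x)‖) := by
                field_simp
                ring
              linarith
        · rw [Set.indicator_of_notMem hx, image_eq_zero_of_notMem_tsupport hx]
          simp
    have hXle : X ≤ B * (C + S) / θ * (Λ * E) := by
      have e1 : C * ∫ x in K, ‖(u ∘ c.symm) x‖ ^ 2 ≤ C * (B * E) := by
        gcongr
        exact hu2
      have e2 : C * (B * E) ≤ C * B * Λ * E := by
        have : 0 ≤ C * B * E := by positivity
        nlinarith
      rw [div_mul_eq_mul_div, le_div_iff₀ hθ]
      linarith
    have hgrad : ∫⁻ x in Q, ‖fderiv ℝ (u ∘ c.symm) x‖ₑ ^ 2 ≤ ENNReal.ofReal (d * X) := by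
      rw [← integral_const_mul, ofReal_integral_eq_lintegral_ofReal (hXi.const_mul _)
        (ae_of_all _ fun x => by positivity)]
      refine le_trans (setLIntegral_mono' hQm fun x hx => ?_) (setLIntegral_le_lintegral Q _)
      rw [enorm_sq_eq_ofReal]
      refine ENNReal.ofReal_le_ofReal ?_
      rw [hone x hx]
      simpa using norm_fderiv_sq_le (u ∘ c.symm) x
    have hpoin := poincare_grid c.open_target (hf.of_le (by simp)) hl hm (hQK.trans hηW)
      (((hf.continuousOn.mono hηW).integrableOn_compact hK).mono_set hQK) h0
    rw [setLIntegral_riemannianVolume g hc (hu.continuous.measurable.enorm.pow_const 2) hQm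
      (hQK.trans hηW)]
    have hmr : (0 : ℝ) < m := by exact_mod_cast hm
    calc ∫⁻ x in Q, ENNReal.ofReal (volDensity g c x) * ‖u (c.symm x)‖ₑ ^ 2
        ≤ ∫⁻ x in Q, ENNReal.ofReal S * ‖(u ∘ c.symm) x‖ₑ ^ 2 := by
          refine setLIntegral_mono' hQm fun x hx => ?_
          gcongr
          · exact hS x (hQK hx)
          · rfl
      _ = ENNReal.ofReal S * ∫⁻ x in Q, ‖(u ∘ c.symm) x‖ₑ ^ 2 :=
          lintegral_const_mul' _ _ (by finiteness)
      _ ≤ ENNReal.ofReal S * (ENNReal.ofReal (d * (l / m)) ^ 2 * 2 ^ d *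
            ENNReal.ofReal (d * X)) := by gcongr; exact hpoin.trans (by gcongr)
      _ = ENNReal.ofReal (S * ((d * (l / m)) ^ 2 * 2 ^ d * (d * X))) := by
          rw [ENNReal.ofReal_mul hS0.le,
            ENNReal.ofReal_mul (p := (d * (l / m)) ^ 2 * 2 ^ d) (by positivity),
            ENNReal.ofReal_mul (p := (d * (l / m)) ^ 2) (by positivity), ENNReal.ofReal_pow (by positivity),
            ENNReal.ofReal_pow (by positivity), ENNReal.ofReal_ofNat]
      _ ≤ _ := by
          refine ENNReal.ofReal_le_ofReal ?_
          calc S * ((d * (l / m)) ^ 2 * 2 ^ d * (d * X))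
              ≤ S * ((d * (l / m)) ^ 2 * 2 ^ d * (d * (B * (C + S) / θ * (Λ * E)))) := by gcongr
            _ = (S * ((d * l) ^ 2 * 2 ^ d * (d * (B * (C + S) / θ)))) * Λ / m ^ 2 * E := by
              field_simp
            _ ≤ _ := by
              have : 0 ≤ C * B := by positivity
              gcongr
              linarith
  · intro u E ev hu hE hev hEu
    have hf := contDiffOn_comp_symm hc hu.1
    obtain ⟨hiu, hu2⟩ := hBu u E hu.1.continuous hE hEu
    obtain ⟨hXi, hX⟩ := hcacc _ hf
    have hcu := hf.continuousOn
    -- For an eigenfunction the zeroth order term is -λ η² √(det g) |u|², which is nonnegative when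
    -- λ < 0. Caccioppoli's inequality then bounds |λ| times its local mass, the gradient term being
    -- dropped.
    have hval : ∀ x, (η x ^ 2) • starRingEnd ℂ ((u ∘ c.symm) x) *
        divOp (laplaceCoeff g c) (u ∘ c.symm) x =
        ((-ev * (η x ^ 2 * volDensity g c x * ‖u (c.symm x)‖ ^ 2) : ℝ) : ℂ) := by
      intro x
      by_cases hx : x ∈ K
      · have e1 := hu.2 c hc x (hηW hx)
        rw [divOp_laplaceCoeff_eq g hc (hηW hx), ← neg_neg (chartLaplacian g c u x), e1]
        have e2 : starRingEnd ℂ (u (c.symm x)) * u (c.symm x) =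
            ((‖u (c.symm x)‖ ^ 2 : ℝ) : ℂ) := by
          rw [mul_comm, Complex.mul_conj, Complex.normSq_eq_norm_sq]
        simp only [Complex.real_smul, Function.comp_apply, smul_neg]
        rw [Complex.ofReal_mul, Complex.ofReal_mul, ← e2]
        push_cast
        ring
      · rw [image_eq_zero_of_notMem_tsupport hx]
        simp
    have hYi : Integrable (fun x => η x ^ 2 * volDensity g c x * ‖u (c.symm x)‖ ^ 2) := by
      have hs : tsupport (fun x => η x ^ 2 * volDensity g c x * ‖u (c.symm x)‖ ^ 2) ⊆ K :=
        closure_mono fun x hx h => hx (by simp [h])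
      have hcont : Continuous (fun x => η x ^ 2 * volDensity g c x * ‖u (c.symm x)‖ ^ 2) :=
        continuous_of_tsupport fun x hx =>
          (((hη.continuous.pow 2).continuousOn.mul hscont).mul (hcu.norm.pow 2)).continuousAt
            (c.open_target.mem_nhds (hηW (hs hx)))
      exact hcont.integrable_of_hasCompactSupport (hK.of_isClosed_subset (isClosed_tsupport _) hs)
    set Z := ∫ x, η x ^ 2 * volDensity g c x * ‖u (c.symm x)‖ ^ 2 with hZ
    simp only [hval] at hX
    rw [integral_complex_ofReal, Complex.ofReal_re, integral_const_mul (-ev)] at hX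
    have hX0 : 0 ≤ θ * ∫ x, η x ^ 2 * ∑ j, ‖partialDeriv j (u ∘ c.symm) x‖ ^ 2 :=
      mul_nonneg hθ.le (integral_nonneg fun x => by positivity)
    have hZle : Z ≤ C * B / |ev| * E := by
      have e1 : C * ∫ x in K, ‖(u ∘ c.symm) x‖ ^ 2 ≤ C * (B * E) := by
        gcongr
        exact hu2
      rw [abs_of_neg hev, div_mul_eq_mul_div, le_div_iff₀ (by linarith)]
      linarith
    rw [setLIntegral_riemannianVolume g hc (hu.1.continuous.measurable.enorm.pow_const 2) hQm
      (hQK.trans hηW)]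
    have hev' : 0 < |ev| := abs_pos.2 hev.ne
    calc ∫⁻ x in Q, ENNReal.ofReal (volDensity g c x) * ‖u (c.symm x)‖ₑ ^ 2
        = ∫⁻ x in Q, ENNReal.ofReal (η x ^ 2 * volDensity g c x * ‖u (c.symm x)‖ ^ 2) := by
          refine setLIntegral_congr_fun hQm fun x hx => ?_
          simp only [hone x hx, one_pow, one_mul]
          rw [ENNReal.ofReal_mul (volDensity_pos g hc (hηW (hQK hx))).le, enorm_sq_eq_ofReal]
      _ ≤ ∫⁻ x in K, ENNReal.ofReal (η x ^ 2 * volDensity g c x * ‖u (c.symm x)‖ ^ 2) :=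
          lintegral_mono_set hQK
      _ = ENNReal.ofReal (∫ x in K, η x ^ 2 * volDensity g c x * ‖u (c.symm x)‖ ^ 2) := by
          rw [ofReal_integral_eq_lintegral_ofReal hYi.integrableOn]
          filter_upwards [self_mem_ae_restrict hKm] with x hx
          have := (volDensity_pos g hc (hηW hx)).le
          simp only [Pi.zero_apply]
          positivity
      _ = ENNReal.ofReal Z := by
          rw [setIntegral_eq_integral_of_forall_compl_eq_zero fun x hx => ?_]
          rw [image_eq_zero_of_notMem_tsupport hx]
          simp
      _ ≤ _ := by
          refine ENNReal.ofReal_le_ofReal (hZle.trans ?_)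
          gcongr
          have : 0 ≤ S * ((d * l) ^ 2 * 2 ^ d * (d * (B * (C + S) / θ))) := by positivity
          linarith

end Local

/-! ### The lower bound in Weyl's law -/

section Weyl

theorem lintegral_enorm_sq_eq_norm_sq {α : Type*} [MeasurableSpace α] {μ : Measure α}
    (u : Lp ℂ 2 μ) : ∫⁻ p, ‖u p‖ₑ ^ 2 ∂μ = ENNReal.ofReal (‖u‖ ^ 2) := by
  rw [ENNReal.ofReal_pow (norm_nonneg _), ofReal_norm, Lp.enorm_def,
    eLpNorm_eq_lintegral_rpow_enorm_toReal (by norm_num) (by norm_num), ← ENNReal.rpow_natCast,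
    ← ENNReal.rpow_mul]
  norm_num

theorem norm_sq_sum_smul_of_orthonormal {ι H : Type*} [NormedAddCommGroup H]
    [InnerProductSpace ℂ H] {v : ι → H} (hv : Orthonormal ℂ v) (s : Finset ι) (a : ι → ℂ) :
    ‖∑ j ∈ s, a j • v j‖ ^ 2 = ∑ j ∈ s, ‖a j‖ ^ 2 := by
  rw [← Complex.ofReal_inj, Complex.ofReal_pow, ← Complex.coe_algebraMap,
    ← inner_self_eq_norm_sq_to_K (𝕜 := ℂ), hv.inner_sum]
  simp [Complex.conj_mul']

variable {d : ℕ}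

theorem partialDeriv_sum {ι V : Type*} [NormedAddCommGroup V] [NormedSpace ℝ V] (s : Finset ι)
    {f : ι → Euc d → V} {x : Euc d} (hf : ∀ k ∈ s, DifferentiableAt ℝ (f k) x) (i : Fin d) :
    partialDeriv i (fun y => ∑ k ∈ s, f k y) x = ∑ k ∈ s, partialDeriv i (f k) x := by
  simp only [partialDeriv]
  rw [fderiv_fun_sum hf]
  simp

theorem partialDeriv_const_mul {f : Euc d → ℂ} {x : Euc d} (a : ℂ)
    (hf : DifferentiableAt ℝ f x) (i : Fin d) :
    partialDeriv i (fun y => a * f y) x = a * partialDeriv i f x := by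
  simp only [partialDeriv]
  rw [fderiv_const_mul hf]
  simp

theorem Filter.EventuallyEq.partialDeriv_eq {V : Type*} [NormedAddCommGroup V] [NormedSpace ℝ V]
    {f f' : Euc d → V} {x : Euc d} (h : f =ᶠ[𝓝 x] f') (i : Fin d) :
    partialDeriv i f x = partialDeriv i f' x := by
  simp only [partialDeriv, h.fderiv_eq]

theorem divOp_sum {ι : Type*} (s : Finset ι) {a : Fin d → Fin d → Euc d → ℝ} {W : Set (Euc d)}
    (hW : IsOpen W) (ha : ∀ i j, ContDiffOn ℝ ∞ (a i j) W) {f : ι → Euc d → ℂ}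
    (hf : ∀ k, ContDiffOn ℝ ∞ (f k) W) (z : ι → ℂ) {x : Euc d} (hx : x ∈ W) :
    divOp a (fun y => ∑ k ∈ s, z k * f k y) x = ∑ k ∈ s, z k * divOp a (f k) x := by
  have hd : ∀ k, ∀ y ∈ W, DifferentiableAt ℝ (f k) y := fun k y hy =>
    ((hf k).contDiffAt (hW.mem_nhds hy)).differentiableAt (by simp)
  have hd2 : ∀ i j k, DifferentiableAt ℝ (fun y => a i j y • partialDeriv j (f k) y) x :=
    fun i j k => ((((ha i j).smul (contDiffOn_partialDeriv (m := ∞) hW (hf k) (by simp)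
      j)).contDiffAt (hW.mem_nhds hx)).differentiableAt (by simp))
  simp only [divOp, Finset.mul_sum]
  rw [Finset.sum_comm (s := s)]
  refine Finset.sum_congr rfl fun i _ => ?_
  rw [Finset.sum_comm (s := s)]
  refine Finset.sum_congr rfl fun j _ => ?_
  have h1 : (fun y => a i j y • partialDeriv j (fun y => ∑ k ∈ s, z k * f k y) y) =ᶠ[𝓝 x]
      fun y => ∑ k ∈ s, z k * (a i j y • partialDeriv j (f k) y) := by
    filter_upwards [hW.mem_nhds hx] with y hy
    rw [partialDeriv_sum s fun k _ => (hd k y hy).const_mul _, Finset.smul_sum]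
    refine Finset.sum_congr rfl fun k _ => ?_
    rw [partialDeriv_const_mul _ (hd k y hy), mul_smul_comm]
  rw [h1.partialDeriv_eq, partialDeriv_sum s fun k _ => (hd2 i j k).const_mul _]
  exact Finset.sum_congr rfl fun k _ => partialDeriv_const_mul _ (hd2 i j k) i

variable {N : Type*} [TopologicalSpace N] [CompactSpace N] [MeasurableSpace N] [BorelSpace N]
  [ChartedSpace (Euc d) N] [IsManifold 𝓘(ℝ, Euc d) ω N]

theorem lintegral_enorm_sq_fn {g : AnalyticMetric d N} (B : LaplaceEigenbasis g) (s : Finset ℕ)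
    (a : ℕ → ℂ) : ∫⁻ p, ‖∑ j ∈ s, a j * B.fn j p‖ₑ ^ 2 ∂(riemannianVolume g) =
      ENNReal.ofReal (∑ j ∈ s, ‖a j‖ ^ 2) := by
  rw [← norm_sq_sum_smul_of_orthonormal B.basis.orthonormal, ← lintegral_enorm_sq_eq_norm_sq]
  refine lintegral_congr_ae ?_
  have h1 : ∀ s : Finset ℕ, ⇑(∑ j ∈ s, a j • B.basis j : RiemL2 g) =ᵐ[riemannianVolume g]
      fun p => ∑ j ∈ s, a j * B.fn j p := by
    intro s
    induction s using Finset.cons_induction with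
    | empty =>
      simp only [Finset.sum_empty]
      exact Lp.coeFn_zero _ _ _
    | cons j s hj ih =>
      simp only [Finset.sum_cons]
      filter_upwards [Lp.coeFn_add (a j • B.basis j) (∑ j ∈ s, a j • B.basis j), ih,
        Lp.coeFn_smul (a j) (B.basis j), B.basis_ae_eq j] with p e1 e2 e3 e4
      rw [e1, Pi.add_apply, e2, e3, Pi.smul_apply, e4, smul_eq_mul]
  filter_upwards [h1 s] with p hp
  rw [hp]

theorem lintegral_le_sum_of_cover {ι : Type*} (μ : Measure N) (t : Finset ι) (V : ι → Set N)
    (hV : Set.univ ⊆ ⋃ i ∈ t, V i) (f : N → ENNReal) :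
    ∫⁻ p, f p ∂μ ≤ ∑ i ∈ t, ∫⁻ p in V i, f p ∂μ := by
  rw [← setLIntegral_univ, ← Finset.sum_coe_sort t fun i => ∫⁻ p in V i, f p ∂μ,
    ← tsum_fintype (L := .unconditional t)]
  have hV' : Set.univ ⊆ ⋃ i : t, V i := fun p hp => by
    obtain ⟨i, hi, hpi⟩ := Set.mem_iUnion₂.1 (hV hp)
    exact Set.mem_iUnion.2 ⟨⟨i, hi⟩, hpi⟩
  refine (lintegral_mono_set hV').trans ?_
  exact lintegral_iUnion_le (fun i : t => V i) f

/-- The eigenvalue bounds which are needed for Weyl's lower bound: the eigenvalues are bounded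
below, and if the first `S m ^ d + 1` eigenvalues are bounded by `Λ`, then `m ^ 2 ≤ A Λ`. -/
theorem exists_eigenvalue_bounds (g : AnalyticMetric d N) :
    ∃ (A : ℝ) (S : ℕ), 0 < A ∧ 0 < S ∧ ∀ B : LaplaceEigenbasis g,
      (∀ j, -A ≤ B.eigenvalue j) ∧
      ∀ (m : ℕ) (Λ : ℝ), 0 < m → 1 ≤ Λ → (∀ j ≤ S * m ^ d, |B.eigenvalue j| ≤ Λ) →
        (m : ℝ) ^ 2 ≤ A * Λ := by
  have hchart : ∀ p : N, chartAt (Euc d) p ∈ analyticCharts d N := fun p =>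
    IsManifold.chart_mem_maximalAtlas p
  -- The estimates hold near every point. Compactness selects finitely many cubes, and the sum of
  -- their constants controls the global norm.
  choose b l hl hsub hnhds A hA hA1 hA2 using fun p : N =>
    exists_local_energy_estimate g (hchart p) (mem_chart_source (Euc d) p)
  obtain ⟨t, ht⟩ := CompactSpace.elim_nhds_subcover _ hnhds
  have hcover : Set.univ ⊆ ⋃ p ∈ t, (chartAt (Euc d) p).source ∩
      chartAt (Euc d) p ⁻¹' halfOpenCube (b p) (l p) := by rw [ht]; rfl
  set A' := ∑ p ∈ t, A p with hA'
  have hA'0 : 0 ≤ A' := Finset.sum_nonneg fun p _ => (hA p).le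
  refine ⟨A' + 1, t.card + 1, by positivity, by positivity, fun B => ⟨fun j => ?_, ?_⟩⟩
  -- An eigenvalue below -(A' + 1) would give a normalized eigenfunction total mass at most A'/|λ| <
  -- 1.
  · by_contra! hj
    have hev : B.eigenvalue j < 0 := by linarith
    have h1 : ∫⁻ p, ‖B.fn j p‖ₑ ^ 2 ∂(riemannianVolume g) = ENNReal.ofReal 1 := by
      simpa using lintegral_enorm_sq_fn B {j} fun _ => 1
    have h2 := lintegral_le_sum_of_cover (riemannianVolume g) t _ hcover
      fun p => ‖B.fn j p‖ₑ ^ 2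
    rw [h1] at h2
    have h3 : ENNReal.ofReal 1 ≤ ENNReal.ofReal (A' / |B.eigenvalue j|) := by
      refine h2.trans ((Finset.sum_le_sum fun p _ => hA2 p (B.fn j) 1 (B.eigenvalue j)
        (B.isEigenfunction j) zero_le_one hev h1.le).trans_eq ?_)
      simp only [mul_one]
      rw [← ENNReal.ofReal_sum_of_nonneg fun p _ => div_nonneg (hA p).le (abs_nonneg _),
        ← Finset.sum_div]
    rw [ENNReal.ofReal_le_ofReal_iff (by positivity), le_div_iff₀ (abs_pos.2 hev.ne),
      abs_of_neg hev] at h3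
    linarith
  · intro m Λ hm hΛ hle
    -- This exceeds the number t.card · m^d of cells, so the linear map `T` of cell integrals has a
    -- nonzero kernel vector.
    set M := (t.card + 1) * m ^ d + 1 with hM
    let T : (Fin M → ℂ) →ₗ[ℂ] (t × (Fin d → Fin m) → ℂ) :=
      { toFun := fun a q => ∑ j, a j * ∫ x in gridCell (b q.1) (l q.1) q.2,
          B.fn j ((chartAt (Euc d) (q.1 : N)).symm x)
        map_add' := fun a a' => by
          ext q
          simp [add_mul, Finset.sum_add_distrib]
        map_smul' := fun z a => by
          ext q
          simp [mul_assoc, Finset.mul_sum] }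
    obtain ⟨a, haT, ha0⟩ : ∃ a : Fin M → ℂ, T a = 0 ∧ a ≠ 0 := by
      have hlt : Module.finrank ℂ (t × (Fin d → Fin m) → ℂ) < Module.finrank ℂ (Fin M → ℂ) := by
        simp only [Module.finrank_fintype_fun_eq_card, Fintype.card_prod, Fintype.card_coe,
          Fintype.card_fun, Fintype.card_fin, hM]
        nlinarith [Nat.pow_pos (n := d) hm]
      obtain ⟨a, ha, ha0⟩ := (Submodule.ne_bot_iff _).1 (T.ker_ne_bot_of_finrank_lt hlt)
      exact ⟨a, ha, ha0⟩
    set z : ℕ → ℂ := fun j => if h : j < M then a ⟨j, h⟩ else 0 with hz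
    have hza : ∀ j : Fin M, z j = a j := fun j => by simp [hz]
    set E : ℝ := ∑ j ∈ Finset.range M, ‖z j‖ ^ 2 with hE
    have hE0 : 0 < E := by
      obtain ⟨j, hj⟩ := Function.ne_iff.1 ha0
      refine Finset.sum_pos' (fun j _ => by positivity) ⟨j, Finset.mem_range.2 j.2, ?_⟩
      rw [hza]
      have := norm_pos_iff.2 hj
      positivity
    have hsmooth : ∀ z : ℕ → ℂ, ContMDiff 𝓘(ℝ, Euc d) 𝓘(ℝ, ℂ) ∞
        (fun p => ∑ j ∈ Finset.range M, z j * B.fn j p) := fun z =>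
      contMDiff_finsetSum fun j _ =>
        (contDiff_const.mul contDiff_id : ContDiff ℝ ∞ fun w : ℂ => z j * w).contMDiff.comp
          (B.isEigenfunction j).1
    have hu := lintegral_enorm_sq_fn B (Finset.range M) z
    have hh := lintegral_enorm_sq_fn B (Finset.range M) fun j => (B.eigenvalue j : ℂ) * z j
    -- By Parseval this is the squared norm of -Δ_g u for u = ∑ z_j φ_j, identified with the
    -- right-hand side in `hlap`.
    have hhE : ∑ j ∈ Finset.range M, ‖(B.eigenvalue j : ℂ) * z j‖ ^ 2 ≤ Λ ^ 2 * E := by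
      rw [hE, Finset.mul_sum]
      refine Finset.sum_le_sum fun j hj => ?_
      rw [norm_mul, mul_pow, Complex.norm_real, Real.norm_eq_abs]
      have := hle j (by rw [Finset.mem_range, hM] at hj; omega)
      gcongr
    have hlap : ∀ p : N, ∀ x ∈ (chartAt (Euc d) p).target,
        -chartLaplacian g (chartAt (Euc d) p) (fun p => ∑ j ∈ Finset.range M, z j * B.fn j p) x =
        ∑ j ∈ Finset.range M, (B.eigenvalue j : ℂ) * z j *
          B.fn j ((chartAt (Euc d) p).symm x) := by
      intro p x hx
      have h1 := divOp_sum (Finset.range M) (chartAt (Euc d) p).open_target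
        (fun i j => (contDiffOn_laplaceCoeff g (hchart p) i j).of_le (by simp))
        (fun k => contDiffOn_comp_symm (hchart p) (B.isEigenfunction k).1) z hx
      have h2 : ((fun p => ∑ j ∈ Finset.range M, z j * B.fn j p) ∘ (chartAt (Euc d) p).symm) =
          fun y => ∑ j ∈ Finset.range M, z j * (B.fn j ∘ (chartAt (Euc d) p).symm) y := rfl
      rw [chartLaplacian_eq, h2, h1, Finset.smul_sum, ← Finset.sum_neg_distrib]
      refine Finset.sum_congr rfl fun j _ => ?_
      have h3 := (B.isEigenfunction j).2 _ (hchart p) x hx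
      rw [chartLaplacian_eq] at h3
      rw [← mul_smul_comm, ← mul_neg, h3, Complex.real_smul]
      ring
    have hmean : ∀ p ∈ t, ∀ k : Fin d → Fin m, ∫ x in gridCell (b p) (l p) k,
        ∑ j ∈ Finset.range M, z j * B.fn j ((chartAt (Euc d) p).symm x) = 0 := by
      intro p hp k
      obtain ⟨K, hK, hQK, hKc⟩ := hsub p
      have hi : ∀ j, IntegrableOn (fun x => z j * B.fn j ((chartAt (Euc d) p).symm x))
          (gridCell (b p) (l p) k) := fun j =>
        (((continuousOn_const.mul ((B.isEigenfunction j).1.continuous.comp_continuousOn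
          (chartAt (Euc d) p).continuousOn_symm)).mono hKc).integrableOn_compact hK).mono_set
            ((gridCell_subset _ (hl p) hm k).trans hQK)
      rw [integral_finsetSum _ fun j _ => hi j, Finset.sum_range]
      have := congrFun haT (⟨p, hp⟩, k)
      simp only [T, LinearMap.coe_mk, AddHom.coe_mk, Pi.zero_apply] at this
      rw [← this]
      refine Finset.sum_congr rfl fun j _ => ?_
      rw [integral_const_mul, hza]
    have h2 := lintegral_le_sum_of_cover (riemannianVolume g) t _ hcover
      fun p => ‖∑ j ∈ Finset.range M, z j * B.fn j p‖ₑ ^ 2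
    rw [hu] at h2
    have hmr : (0 : ℝ) < m := by exact_mod_cast hm
    -- Summing the local estimates over the cover bounds the total mass E by (A'Λ/m²) E; dividing by
    -- E > 0 yields m² ≤ A'Λ.
    have h3 : ENNReal.ofReal E ≤ ENNReal.ofReal (A' * Λ / m ^ 2 * E) := by
      refine h2.trans ((Finset.sum_le_sum fun p hp => hA1 p _ _ E Λ m (hsmooth z)
        (hsmooth _).continuous hE0.le hΛ hm (hlap p) (hmean p hp) hu.le
        (hh.le.trans (ENNReal.ofReal_le_ofReal hhE))).trans_eq ?_)
      rw [← ENNReal.ofReal_sum_of_nonneg fun p _ => by have := (hA p).le; positivity,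
        ← Finset.sum_mul, ← Finset.sum_div, ← Finset.sum_mul]
    rw [ENNReal.ofReal_le_ofReal_iff (by positivity), div_mul_eq_mul_div,
      le_div_iff₀ (by positivity), mul_comm E] at h3
    have h4 := le_of_mul_le_mul_right h3 hE0
    linarith

/-- The lower bound in Weyl's law. -/
theorem exists_weyl_lower_bound (hd : 0 < d) (g : AnalyticMetric d N) :
    ∃ κ D : ℝ, 0 < κ ∧ 0 ≤ D ∧ ∀ (B : LaplaceEigenbasis g) (j : ℕ),
      κ * (j : ℝ) ^ (2 / (d : ℝ)) ≤ |B.eigenvalue j| + D := by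
  obtain ⟨A, S, hA, hS, h⟩ := exists_eigenvalue_bounds g
  have hS' : (0 : ℝ) < S := by exact_mod_cast hS
  have hd' : (0 : ℝ) < d := by exact_mod_cast hd
  refine ⟨((S : ℝ) ^ (2 / (d : ℝ)))⁻¹ / (2 * A), 1 + A + 1 / A, by positivity, by positivity,
    fun B j => ?_⟩
  obtain ⟨h1, h2⟩ := h B
  -- Its integer part m is the finest subdivision for which S m^d ≤ j, so only eigenvalues up to the
  -- j-th are involved. The constants κ and D come from solving x² ≤ 2A(1 + A + |λ_j|) + 2 for
  -- |λ_j|.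
  set x : ℝ := ((j : ℝ) / S) ^ (1 / (d : ℝ)) with hx
  have hx0 : 0 ≤ x := by positivity
  have hx2 : x ^ 2 = (j : ℝ) ^ (2 / (d : ℝ)) * ((S : ℝ) ^ (2 / (d : ℝ)))⁻¹ := by
    rw [hx, ← Real.rpow_natCast, ← Real.rpow_mul (by positivity),
      Real.div_rpow (by positivity) (by positivity), div_eq_mul_inv]
    congr 2 <;> push_cast <;> ring_nf
  set m := ⌊x⌋₊ with hm
  have hmx : x < m + 1 := Nat.lt_floor_add_one x
  have key : x ^ 2 ≤ 2 * A * (1 + A + |B.eigenvalue j|) + 2 := by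
    have h3 : x ^ 2 ≤ 2 * (m : ℝ) ^ 2 + 2 := by
      have : x ^ 2 ≤ ((m : ℝ) + 1) ^ 2 := by gcongr
      nlinarith [sq_nonneg ((m : ℝ) - 1)]
    rcases Nat.eq_zero_or_pos m with h0 | h0
    · rw [h0] at h3
      have : 0 ≤ 2 * A * (1 + A + |B.eigenvalue j|) := by positivity
      simp at h3
      linarith
    · have hmle : S * m ^ d ≤ j := by
        have e1 : (m : ℝ) ^ d ≤ x ^ d := by
          gcongr
          exact Nat.floor_le hx0
        have e2 : x ^ d = j / S := by
          rw [hx, ← Real.rpow_natCast, ← Real.rpow_mul (by positivity), one_div,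
            inv_mul_cancel₀ hd'.ne', Real.rpow_one]
        rw [e2, le_div_iff₀ hS'] at e1
        have e3 : ((S * m ^ d : ℕ) : ℝ) ≤ j := by
          push_cast
          linarith
        exact_mod_cast e3
      -- For i ≤ j one has -A ≤ λ_i ≤ λ_j, whence |λ_i| ≤ A + |λ_j|; the summand 1 ensures Λ ≥ 1.
      have h4 := h2 m (1 + A + |B.eigenvalue j|) h0 (by linarith [abs_nonneg (B.eigenvalue j)])
        fun i hi => by
          have e1 := h1 i
          have e2 := B.monotone (hi.trans hmle)
          have e3 := le_abs_self (B.eigenvalue j)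
          have e4 := abs_nonneg (B.eigenvalue j)
          rw [abs_le]
          constructor <;> linarith
      linarith
  rw [hx2] at key
  rw [div_mul_eq_mul_div, div_le_iff₀ (by positivity)]
  have : (|B.eigenvalue j| + (1 + A + 1 / A)) * (2 * A) =
      2 * A * (1 + A + |B.eigenvalue j|) + 2 := by
    field_simp
    ring
  rw [this]
  linarith

end Weyl

/-! ### Gevrey norms at a point -/

section Gevrey

variable {d : ℕ} {V : Type*} [NormedAddCommGroup V] [NormedSpace ℝ V]

/-- The derivatives of `f` satisfy a Gevrey bound of order `σ`, uniformly on the set `K`. -/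
def IsGevreyBounded (σ : ℝ) (f : Euc d → V) (K : Set (Euc d)) : Prop :=
  ∃ H L : ℝ, 0 < H ∧ 0 < L ∧ ∀ k : ℕ, ∀ x ∈ K,
    ‖iteratedFDeriv ℝ k f x‖ ≤ H * L ^ k * (k.factorial : ℝ) ^ σ

/-- The Gevrey norm `∑_k ‖D^k f(x)‖ R^k / k!^σ` of `f` at the point `x` is at most `M`. -/
def GevreySumLE (σ R M : ℝ) (f : Euc d → V) (x : Euc d) : Prop :=
  ∀ n : ℕ, ∑ k ∈ Finset.range n, ‖iteratedFDeriv ℝ k f x‖ * R ^ k / (k.factorial : ℝ) ^ σ ≤ M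

/-- A binomial coefficient is at least 1, hence at most its σ-th power. This is what makes the
Gevrey norm submultiplicative. -/
theorem choose_div_factorial_rpow_le {σ : ℝ} (hσ : 1 ≤ σ) {k i : ℕ} (hi : i ≤ k) :
    (k.choose i : ℝ) / (k.factorial : ℝ) ^ σ ≤
      1 / ((i.factorial : ℝ) ^ σ * ((k - i).factorial : ℝ) ^ σ) := by
  have h1 : (k.factorial : ℝ) = k.choose i * i.factorial * (k - i).factorial := by
    exact_mod_cast (Nat.choose_mul_factorial_mul_factorial hi).symm
  have hc : (1 : ℝ) ≤ k.choose i := by exact_mod_cast Nat.choose_pos hi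
  have hc2 : (k.choose i : ℝ) ≤ (k.choose i : ℝ) ^ σ := by
    simpa using Real.rpow_le_rpow_of_exponent_le hc hσ
  have hi0 : (0 : ℝ) < i.factorial := by positivity
  have hk0 : (0 : ℝ) < (k - i).factorial := by positivity
  rw [h1, Real.mul_rpow (by positivity) (by positivity), Real.mul_rpow (by positivity)
    (by positivity), div_le_div_iff₀ (by positivity) (by positivity), one_mul, mul_assoc]
  gcongr

theorem GevreySumLE.norm_le {σ R M : ℝ} {f : Euc d → V} {x : Euc d}
    (h : GevreySumLE σ R M f x) : ‖f x‖ ≤ M := by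
  simpa using h 1

theorem GevreySumLE.nonneg {σ R M : ℝ} {f : Euc d → V} {x : Euc d}
    (h : GevreySumLE σ R M f x) : 0 ≤ M := by
  simpa using h 0

theorem GevreySumLE.mono {σ R R' M M' : ℝ} {f : Euc d → V} {x : Euc d}
    (h : GevreySumLE σ R M f x) (hR' : 0 ≤ R') (hR : R' ≤ R) (hM : M ≤ M') :
    GevreySumLE σ R' M' f x := fun n => by
  refine le_trans (Finset.sum_le_sum fun k _ => ?_) ((h n).trans hM)
  gcongr

/-- With radius 1/(2L) the supremum bounds give a geometric series of ratio 1/2. -/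
theorem IsGevreyBounded.exists_gevreySumLE {σ : ℝ} {f : Euc d → V} {K : Set (Euc d)}
    (h : IsGevreyBounded σ f K) :
    ∃ R M : ℝ, 0 < R ∧ 0 < M ∧ ∀ x ∈ K, GevreySumLE σ R M f x := by
  obtain ⟨H, L, hH, hL, h⟩ := h
  refine ⟨1 / (2 * L), 2 * H, by positivity, by positivity, fun x hx n => ?_⟩
  calc ∑ k ∈ Finset.range n, ‖iteratedFDeriv ℝ k f x‖ * (1 / (2 * L)) ^ k / (k.factorial : ℝ) ^ σ
      ≤ ∑ k ∈ Finset.range n, H * (1 / 2) ^ k := by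
        refine Finset.sum_le_sum fun k _ => ?_
        rw [div_le_iff₀ (by positivity)]
        calc ‖iteratedFDeriv ℝ k f x‖ * (1 / (2 * L)) ^ k
            ≤ H * L ^ k * (k.factorial : ℝ) ^ σ * (1 / (2 * L)) ^ k := by gcongr; exact h k x hx
          _ = H * (1 / 2) ^ k * (k.factorial : ℝ) ^ σ := by
            rw [div_pow, mul_pow, div_pow]
            field_simp
    _ ≤ 2 * H := by
        rw [← Finset.mul_sum]
        have := sum_geometric_two_le n
        nlinarith

theorem GevreySumLE.isGevreyBounded {σ R M : ℝ} {f : Euc d → V} {K : Set (Euc d)} (hR : 0 < R)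
    (hM : 0 < M) (h : ∀ x ∈ K, GevreySumLE σ R M f x) : IsGevreyBounded σ f K := by
  refine ⟨M, 1 / R, hM, by positivity, fun k x hx => ?_⟩
  have h1 := (Finset.single_le_sum (f := fun k => ‖iteratedFDeriv ℝ k f x‖ * R ^ k /
    (k.factorial : ℝ) ^ σ) (fun j _ => by positivity) (Finset.self_mem_range_succ k)).trans
    (h x hx (k + 1))
  rw [div_le_iff₀ (by positivity)] at h1
  rw [one_div, inv_pow, ← div_eq_mul_inv, div_mul_eq_mul_div, le_div_iff₀ (by positivity)]
  exact h1

/-- Leibniz' rule, divided by k!^σ, is dominated by the Cauchy product of the two series. -/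
theorem GevreySumLE.smul {𝕜' : Type*} [NormedField 𝕜'] [NormedAlgebra ℝ 𝕜'] [NormedSpace 𝕜' V]
    [IsScalarTower ℝ 𝕜' V] {σ R M M' : ℝ} (hσ : 1 ≤ σ) (hR : 0 ≤ R) {b : Euc d → 𝕜'}
    {f : Euc d → V} {W : Set (Euc d)} (hW : IsOpen W) (hb : ContDiffOn ℝ ∞ b W)
    (hf : ContDiffOn ℝ ∞ f W) {x : Euc d} (hx : x ∈ W)
    (h : GevreySumLE σ R M b x) (h' : GevreySumLE σ R M' f x) :
    GevreySumLE σ R (M * M') (fun y => b y • f y) x := fun n => by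
  set A : ℕ → ℝ := fun k => ‖iteratedFDeriv ℝ k b x‖ * R ^ k / (k.factorial : ℝ) ^ σ with hA
  set B : ℕ → ℝ := fun k => ‖iteratedFDeriv ℝ k f x‖ * R ^ k / (k.factorial : ℝ) ^ σ with hB
  have hA0 : ∀ k, 0 ≤ A k := fun k => by positivity
  have hB0 : ∀ k, 0 ≤ B k := fun k => by positivity
  calc _ ≤ ∑ k ∈ Finset.range n, ∑ i ∈ Finset.range (k + 1), A i * B (k - i) := by
        refine Finset.sum_le_sum fun k _ => ?_
        have h1 := norm_iteratedFDerivWithin_smul_le hb hf hW.uniqueDiffOn hx (n := k)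
          (by exact_mod_cast le_top)
        simp only [iteratedFDerivWithin_of_isOpen _ hW hx] at h1
        calc _ ≤ (∑ i ∈ Finset.range (k + 1), (k.choose i : ℝ) * ‖iteratedFDeriv ℝ i b x‖ *
                ‖iteratedFDeriv ℝ (k - i) f x‖) * R ^ k / (k.factorial : ℝ) ^ σ := by gcongr
          _ ≤ _ := by
            rw [Finset.sum_mul, Finset.sum_div]
            refine Finset.sum_le_sum fun i hi => ?_
            have hik : i ≤ k := Nat.lt_succ_iff.1 (Finset.mem_range.1 hi)
            have h2 := choose_div_factorial_rpow_le hσ hik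
            have h3 : R ^ k = R ^ i * R ^ (k - i) := by rw [← pow_add, Nat.add_sub_cancel' hik]
            calc _ = (k.choose i : ℝ) / (k.factorial : ℝ) ^ σ * (‖iteratedFDeriv ℝ i b x‖ *
                  ‖iteratedFDeriv ℝ (k - i) f x‖ * R ^ k) := by ring
              _ ≤ 1 / ((i.factorial : ℝ) ^ σ * ((k - i).factorial : ℝ) ^ σ) *
                  (‖iteratedFDeriv ℝ i b x‖ * ‖iteratedFDeriv ℝ (k - i) f x‖ * R ^ k) := by gcongr
              _ = _ := by
                rw [h3, hA, hB]
                field_simp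
    _ = ∑ i ∈ Finset.range n, ∑ j ∈ Finset.range (n - i), A i * B j :=
        Finset.sum_range_diag_flip n fun i j => A i * B j
    _ ≤ ∑ i ∈ Finset.range n, A i * M' := by
        refine Finset.sum_le_sum fun i _ => ?_
        rw [← Finset.mul_sum]
        exact mul_le_mul_of_nonneg_left (h' _) (hA0 i)
    _ ≤ M * M' := by
        rw [← Finset.sum_mul]
        exact mul_le_mul_of_nonneg_right (h n) h'.nonneg

theorem GevreySumLE.sum {ι : Type*} (s : Finset ι) {σ R : ℝ} {M : ι → ℝ} (hR : 0 ≤ R)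
    {f : ι → Euc d → V} {x : Euc d} (hf : ∀ i ∈ s, ContDiffAt ℝ ∞ (f i) x)
    (h : ∀ i ∈ s, GevreySumLE σ R (M i) (f i) x) :
    GevreySumLE σ R (∑ i ∈ s, M i) (fun y => ∑ i ∈ s, f i y) x := fun n => by
  calc _ ≤ ∑ k ∈ Finset.range n, ∑ i ∈ s,
        ‖iteratedFDeriv ℝ k (f i) x‖ * R ^ k / (k.factorial : ℝ) ^ σ := by
        refine Finset.sum_le_sum fun k _ => ?_
        have hs : (fun y => ∑ i ∈ s, f i y) = ∑ i ∈ s, f i := by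
          ext y
          simp
        rw [hs, iteratedFDeriv_sum_apply fun i hi => (hf i hi).of_le (by exact_mod_cast le_top),
          ← Finset.sum_div, ← Finset.sum_mul]
        gcongr
        exact norm_sum_le _ _
    _ ≤ _ := by
        rw [Finset.sum_comm]
        exact Finset.sum_le_sum fun i hi => h i hi n

theorem norm_iteratedFDeriv_partialDeriv_le {f : Euc d → V} {x : Euc d}
    (hf : ContDiffAt ℝ ∞ f x) (i : Fin d) (k : ℕ) :
    ‖iteratedFDeriv ℝ k (partialDeriv i f) x‖ ≤ ‖iteratedFDeriv ℝ (k + 1) f x‖ := by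
  have h := norm_iteratedFDeriv_clm_apply_const (c := stdVec i)
    (hf.fderiv_right (m := ∞) (by simp)) (n := k) (by exact_mod_cast le_top)
  rw [norm_iteratedFDeriv_fderiv] at h
  have hn : ‖(stdVec i : Euc d)‖ = 1 := by simp [stdVec]
  rw [hn, one_mul] at h
  exact h

/-- A derivative shifts the series by one index. The factor (k + 1)^σ so created is compensated by
(R'/R)^k, at the price c. -/
theorem GevreySumLE.partialDeriv {σ R R' M c : ℝ} {f : Euc d → V} {x : Euc d}
    (hf : ContDiffAt ℝ ∞ f x) (hR : 0 < R) (hR' : 0 ≤ R') (hc : 0 ≤ c)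
    (hRc : ∀ k : ℕ, ((k : ℝ) + 1) ^ σ * (R' / R) ^ k ≤ c * R)
    (h : GevreySumLE σ R M f x) (i : Fin d) :
    GevreySumLE σ R' (c * M) (partialDeriv i f) x := fun n => by
  calc _ ≤ ∑ k ∈ Finset.range n, c * (‖iteratedFDeriv ℝ (k + 1) f x‖ * R ^ (k + 1) /
        ((k + 1).factorial : ℝ) ^ σ) := by
        refine Finset.sum_le_sum fun k _ => ?_
        have h1 := norm_iteratedFDeriv_partialDeriv_le hf i k
        have h2 := hRc k
        rw [Nat.factorial_succ, Nat.cast_mul, Real.mul_rpow (by positivity) (by positivity)]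
        push_cast
        have h3 : R' ^ k ≤ c * (R ^ (k + 1) / ((k : ℝ) + 1) ^ σ) := by
          rw [mul_div_assoc', le_div_iff₀ (by positivity)]
          rw [div_pow, mul_div_assoc', div_le_iff₀ (by positivity)] at h2
          calc R' ^ k * ((k : ℝ) + 1) ^ σ = ((k : ℝ) + 1) ^ σ * R' ^ k := mul_comm _ _
            _ ≤ _ := h2
            _ = _ := by ring
        calc _ ≤ ‖iteratedFDeriv ℝ (k + 1) f x‖ * (c * (R ^ (k + 1) / ((k : ℝ) + 1) ^ σ)) /
              (k.factorial : ℝ) ^ σ := by gcongr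
          _ = _ := by
            field_simp
    _ = c * ∑ k ∈ Finset.range n, ‖iteratedFDeriv ℝ (k + 1) f x‖ * R ^ (k + 1) /
        ((k + 1).factorial : ℝ) ^ σ := by rw [Finset.mul_sum]
    _ ≤ c * M := by
        gcongr
        refine le_trans ?_ (h (n + 1))
        rw [Finset.sum_range_succ']
        have : 0 ≤ ‖iteratedFDeriv ℝ 0 f x‖ * R ^ 0 / ((0 : ℕ).factorial : ℝ) ^ σ := by positivity
        linarith

/-- Here q^k ≤ e^{-k/m}, whereas (k + 1)^σ ≤ (mσ)^σ e^{(k+1)/m}. So giving up a fraction 1/m of the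
radius costs a factor of order m^σ. -/
theorem add_one_rpow_mul_pow_le {σ : ℝ} (hσ : 1 ≤ σ) {m : ℕ} (hm : 0 < m) {q : ℝ} (hq0 : 0 ≤ q)
    (hq : q ≤ 1 - 1 / m) (k : ℕ) :
    ((k : ℝ) + 1) ^ σ * q ^ k ≤ (m * σ) ^ σ * Real.exp 1 := by
  have hm' : (1 : ℝ) ≤ m := by exact_mod_cast hm
  have hms : 0 < m * σ := by positivity
  have h1 : (k : ℝ) + 1 ≤ m * σ * Real.exp (((k : ℝ) + 1) / (m * σ)) := by
    have := Real.add_one_le_exp (((k : ℝ) + 1) / (m * σ))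
    calc (k : ℝ) + 1 = m * σ * (((k : ℝ) + 1) / (m * σ)) := by field_simp
      _ ≤ _ := by gcongr; linarith
  have h2 : ((k : ℝ) + 1) ^ σ ≤ (m * σ) ^ σ * Real.exp (((k : ℝ) + 1) / m) := by
    refine (Real.rpow_le_rpow (by positivity) h1 (by linarith)).trans_eq ?_
    rw [Real.mul_rpow hms.le (Real.exp_pos _).le, ← Real.exp_mul]
    congr 2
    field_simp
  have h3 : q ^ k ≤ Real.exp (-(k / m : ℝ)) := by
    have e1 : q ≤ Real.exp (-(1 / m)) := by
      have := Real.add_one_le_exp (-(1 / m : ℝ))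
      linarith
    refine (pow_le_pow_left₀ hq0 e1 k).trans_eq ?_
    rw [← Real.exp_nat_mul]
    congr 1
    ring
  calc _ ≤ (m * σ) ^ σ * Real.exp (((k : ℝ) + 1) / m) * Real.exp (-(k / m : ℝ)) := by gcongr
    _ = (m * σ) ^ σ * Real.exp (1 / m) := by
      rw [mul_assoc, ← Real.exp_add]
      congr 2
      ring
    _ ≤ _ := by
      gcongr
      rw [div_le_one (by positivity)]
      exact hm'

end Gevrey

/-! ### Cauchy estimates for analytic functions -/

section Analytic

variable {E F : Type*} [NormedAddCommGroup E] [NormedSpace ℝ E] [NormedAddCommGroup F]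
  [NormedSpace ℝ F] [CompleteSpace F]

theorem HasFPowerSeriesOnBall.norm_iteratedFDeriv_le {f : E → F}
    {p : FormalMultilinearSeries ℝ E F} {x : E} {r : ENNReal} (h : HasFPowerSeriesOnBall f p x r)
    (k : ℕ) : ‖iteratedFDeriv ℝ k f x‖ ≤ k.factorial * ‖p k‖ := by
  refine ContinuousMultilinearMap.opNorm_le_bound (by positivity) fun v => ?_
  rw [h.iteratedFDeriv_eq_sum_of_completeSpace]
  refine (norm_sum_le _ _).trans ?_
  calc ∑ τ : Equiv.Perm (Fin k), ‖p k fun i => v (τ i)‖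
      ≤ ∑ _τ : Equiv.Perm (Fin k), ‖p k‖ * ∏ i, ‖v i‖ := by
        refine Finset.sum_le_sum fun τ _ => ((p k).le_opNorm _).trans_eq ?_
        rw [Equiv.prod_comp τ fun i => ‖v i‖]
    _ = _ := by
        simp [Finset.card_univ, Fintype.card_perm]
        ring

/-- Cauchy estimates for a real analytic function, uniformly near a point. -/
theorem AnalyticAt.exists_norm_iteratedFDeriv_le {f : E → F} {x : E} (hf : AnalyticAt ℝ f x) :
    ∃ H L : ℝ, 0 < H ∧ 0 < L ∧ ∀ᶠ y in 𝓝 x, ∀ k : ℕ,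
      ‖iteratedFDeriv ℝ k f y‖ ≤ H * L ^ k * k.factorial := by
  obtain ⟨p, r, hp⟩ := hf
  -- One s bounds the distance from x to y, the other is the radius of the estimate at y. The double
  -- series that re-expands p at y converges at this pair, and its sum T dominates ‖p.changeOrigin
  -- (y - x) k‖ s^k for all such y and all k.
  obtain ⟨s, hs0, hs⟩ : ∃ s : NNReal, 0 < s ∧ (s + s : ENNReal) < r := by
    obtain ⟨s, hs0, hs⟩ := ENNReal.lt_iff_exists_nnreal_btwn.1 hp.r_pos
    refine ⟨s / 2, by simpa using hs0, ?_⟩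
    rw [← ENNReal.coe_add, add_halves]
    exact hs
  have hsum := p.changeOriginSeries_summable_aux₁ (hs.trans_le hp.r_le)
  set T := ∑' s_1 : Σ k l : ℕ, { t : Finset (Fin (k + l)) // t.card = l },
    ‖p (s_1.1 + s_1.2.1)‖₊ * s ^ s_1.2.1 * s ^ s_1.1 with hT
  refine ⟨T + 1, (s : ℝ)⁻¹, by positivity, by positivity, ?_⟩
  filter_upwards [Metric.closedBall_mem_nhds x (NNReal.coe_pos.2 hs0)] with y hy k
  have hys : ‖y - x‖₊ ≤ s := by
    rw [← NNReal.coe_le_coe, coe_nnnorm, ← dist_eq_norm]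
    exact hy
  have hsr : (s : ENNReal) < r := lt_of_le_of_lt le_self_add hs
  have hyr : (‖y - x‖₊ : ENNReal) < r := lt_of_le_of_lt (by exact_mod_cast hys) hsr
  have h1 := (hp.changeOrigin hyr).norm_iteratedFDeriv_le k
  rw [add_sub_cancel] at h1
  have h2 := p.nnnorm_changeOrigin_le k (hyr.trans_le hp.r_le)
  have h3 : ‖p.changeOrigin (y - x) k‖₊ * s ^ k ≤ T := by
    have e1 := p.changeOriginSeries_summable_aux₂ (hsr.trans_le hp.r_le) k
    have e0 := p.changeOriginSeries_summable_aux₂ (hyr.trans_le hp.r_le) k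
    calc ‖p.changeOrigin (y - x) k‖₊ * s ^ k
        ≤ (∑' t : Σ l : ℕ, { t : Finset (Fin (k + l)) // t.card = l },
            ‖p (k + t.1)‖₊ * s ^ t.1) * s ^ k := by
          gcongr
          refine h2.trans (e0.tsum_le_tsum (fun t => ?_) e1)
          gcongr
      _ = ∑' t : Σ l : ℕ, { t : Finset (Fin (k + l)) // t.card = l },
            ‖p (k + t.1)‖₊ * s ^ t.1 * s ^ k := NNReal.tsum_mul_right _ _ |>.symm
      _ ≤ ∑' k, ∑' t : Σ l : ℕ, { t : Finset (Fin (k + l)) // t.card = l },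
            ‖p (k + t.1)‖₊ * s ^ t.1 * s ^ k :=
          (NNReal.summable_sigma.1 hsum).2.le_tsum k fun _ _ => zero_le
      _ = T := (hsum.tsum_sigma' fun k => (NNReal.summable_sigma.1 hsum).1 k).symm
  have h4 : ‖p.changeOrigin (y - x) k‖ ≤ (T + 1) * (s : ℝ)⁻¹ ^ k := by
    have h5 : ‖p.changeOrigin (y - x) k‖ * (s : ℝ) ^ k ≤ T := by exact_mod_cast h3
    have : (0 : ℝ) < s := hs0
    rw [inv_pow, ← div_eq_mul_inv, le_div_iff₀ (by positivity)]
    linarith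
  calc _ ≤ k.factorial * ‖p.changeOrigin (y - x) k‖ := h1
    _ ≤ k.factorial * ((T + 1) * (s : ℝ)⁻¹ ^ k) := by gcongr
    _ = _ := by ring

/-- Real analytic functions satisfy Gevrey bounds on compact sets. -/
theorem ContDiffOn.isGevreyBounded {d : ℕ} {f : Euc d → F} {W K : Set (Euc d)} (hW : IsOpen W)
    (hf : ContDiffOn ℝ ω f W) (hK : IsCompact K) (hKW : K ⊆ W) {σ : ℝ} (hσ : 1 ≤ σ) :
    IsGevreyBounded σ f K := by
  have hfac : ∀ k : ℕ, (k.factorial : ℝ) ≤ (k.factorial : ℝ) ^ σ := fun k => by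
    simpa using Real.rpow_le_rpow_of_exponent_le
      (by exact_mod_cast Nat.factorial_pos k : (1 : ℝ) ≤ k.factorial) hσ
  refine hK.induction_on (p := IsGevreyBounded σ f) ⟨1, 1, one_pos, one_pos, by simp⟩ ?_ ?_ ?_
  · rintro s t hst ⟨H, L, hH, hL, h⟩
    exact ⟨H, L, hH, hL, fun k x hx => h k x (hst hx)⟩
  · rintro s t ⟨H, L, hH, hL, h⟩ ⟨H', L', hH', hL', h'⟩
    refine ⟨max H H', max L L', by positivity, by positivity, fun k x hx => ?_⟩
    rcases hx with hx | hx
    · refine (h k x hx).trans ?_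
      gcongr
      · exact le_max_left _ _
      · exact le_max_left _ _
    · refine (h' k x hx).trans ?_
      gcongr
      · exact le_max_right _ _
      · exact le_max_right _ _
  · intro x hx
    obtain ⟨H, L, hH, hL, h⟩ :=
      ((hf.contDiffAt (hW.mem_nhds (hKW hx))).analyticAt).exists_norm_iteratedFDeriv_le
    refine ⟨_, mem_nhdsWithin_of_mem_nhds h, H, L, hH, hL, fun k y hy => (hy k).trans ?_⟩
    gcongr
    exact hfac k

end Analytic

/-! ### Iterates of an operator on Gevrey functions -/

section Iterates

variable {d : ℕ}

theorem exists_uniform_of_isGevreyBounded {V : Type*} [NormedAddCommGroup V] [NormedSpace ℝ V]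
    {ι : Type*} [Fintype ι] {σ : ℝ} {f : ι → Euc d → V} {K : Set (Euc d)}
    (h : ∀ i, IsGevreyBounded σ (f i) K) :
    ∃ H L : ℝ, 0 < H ∧ 0 < L ∧ ∀ i (k : ℕ), ∀ x ∈ K,
      ‖iteratedFDeriv ℝ k (f i) x‖ ≤ H * L ^ k * (k.factorial : ℝ) ^ σ := by
  choose H L hH hL h using h
  have hH' : ∀ i, H i ≤ 1 + ∑ i, H i := fun i => by
    linarith [Finset.single_le_sum (fun i _ => (hH i).le) (Finset.mem_univ i)]
  have hL' : ∀ i, L i ≤ 1 + ∑ i, L i := fun i => by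
    linarith [Finset.single_le_sum (fun i _ => (hL i).le) (Finset.mem_univ i)]
  have hH0 : 0 ≤ ∑ i, H i := Finset.sum_nonneg fun i _ => (hH i).le
  have hL0 : 0 ≤ ∑ i, L i := Finset.sum_nonneg fun i _ => (hL i).le
  refine ⟨1 + ∑ i, H i, 1 + ∑ i, L i, by positivity, by positivity, fun i k x hx =>
    (h i k x hx).trans ?_⟩
  have := (hL i).le
  gcongr
  · exact hH' i
  · exact hL' i

/-- The iterates of `u ↦ q ∑_{i,j} ∂_i (a_{ij} ∂_j u)`. -/
noncomputable def divOpIter (q : Euc d → ℝ) (a : Fin d → Fin d → Euc d → ℝ) (w : Euc d → ℂ) :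
    ℕ → Euc d → ℂ
  | 0 => w
  | k + 1 => fun x => q x • divOp a (divOpIter q a w k) x

theorem tsupport_divOpIter_subset (q : Euc d → ℝ) (a : Fin d → Fin d → Euc d → ℝ)
    (w : Euc d → ℂ) (k : ℕ) : tsupport (divOpIter q a w k) ⊆ tsupport w := by
  induction k with
  | zero => exact le_rfl
  | succ k ih =>
    exact ((tsupport_smul_subset_right q _).trans (tsupport_divOp_subset a _)).trans ih

theorem contDiffOn_divOpIter {q : Euc d → ℝ} {a : Fin d → Fin d → Euc d → ℝ} {w : Euc d → ℂ}
    {W : Set (Euc d)} (hW : IsOpen W) (hq : ContDiffOn ℝ ∞ q W)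
    (ha : ∀ i j, ContDiffOn ℝ ∞ (a i j) W) (hw : ContDiffOn ℝ ∞ w W) (k : ℕ) :
    ContDiffOn ℝ ∞ (divOpIter q a w k) W := by
  induction k with
  | zero => exact hw
  | succ k ih => exact hq.smul (contDiffOn_divOp hW ha ih)

/-- Each of the two derivatives shrinks the radius once, from R to R' to R''. The coefficients
a_{ij} are multiplied in at the intermediate radius and q at the final one; d² counts the terms. -/
theorem GevreySumLE.smul_divOp {σ R R' R'' M c Mq Ma : ℝ} (hσ : 1 ≤ σ) {q : Euc d → ℝ}
    {a : Fin d → Fin d → Euc d → ℝ} {u : Euc d → ℂ} {W : Set (Euc d)} (hW : IsOpen W)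
    (hq : ContDiffOn ℝ ∞ q W) (ha : ∀ i j, ContDiffOn ℝ ∞ (a i j) W) (hu : ContDiffOn ℝ ∞ u W)
    {x : Euc d} (hx : x ∈ W) (hR : 0 < R) (hR' : 0 < R') (hR'' : 0 ≤ R'') (hc : 0 ≤ c)
    (hRc : ∀ k : ℕ, ((k : ℝ) + 1) ^ σ * (R' / R) ^ k ≤ c * R)
    (hRc' : ∀ k : ℕ, ((k : ℝ) + 1) ^ σ * (R'' / R') ^ k ≤ c * R')
    (h : GevreySumLE σ R M u x) (hqM : GevreySumLE σ R'' Mq q x)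
    (haM : ∀ i j, GevreySumLE σ R' Ma (a i j) x) :
    GevreySumLE σ R'' (Mq * (d ^ 2 * c ^ 2 * Ma) * M) (fun x => q x • divOp a u x) x := by
  have hpu : ∀ j, ContDiffOn ℝ ∞ (_root_.partialDeriv j u) W := fun j =>
    contDiffOn_partialDeriv hW hu (by simp) j
  have hapu : ∀ i j, ContDiffOn ℝ ∞ (fun y => a i j y • _root_.partialDeriv j u y) W :=
    fun i j => (ha i j).smul (hpu j)
  have hppu : ∀ i j, ContDiffOn ℝ ∞
      (_root_.partialDeriv i fun y => a i j y • _root_.partialDeriv j u y) W :=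
    fun i j => contDiffOn_partialDeriv hW (hapu i j) (by simp) i
  have h1 : ∀ i j, GevreySumLE σ R'' (c * (Ma * (c * M)))
      (_root_.partialDeriv i fun y => a i j y • _root_.partialDeriv j u y) x := fun i j =>
    GevreySumLE.partialDeriv ((hapu i j).contDiffAt (hW.mem_nhds hx)) hR' hR'' hc hRc'
      (GevreySumLE.smul hσ hR'.le hW (ha i j) (hpu j) hx (haM i j)
        (GevreySumLE.partialDeriv (hu.contDiffAt (hW.mem_nhds hx)) hR hR'.le hc hRc h j)) i
  have h2 : GevreySumLE σ R'' (∑ _i : Fin d, ∑ _j : Fin d, c * (Ma * (c * M))) (divOp a u) x :=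
    GevreySumLE.sum _ hR'' (fun i _ => ContDiffAt.sum fun j _ =>
      (hppu i j).contDiffAt (hW.mem_nhds hx)) fun i _ =>
      GevreySumLE.sum _ hR'' (fun j _ => (hppu i j).contDiffAt (hW.mem_nhds hx)) fun j _ => h1 i j
  refine (GevreySumLE.smul hσ hR'' hW hq (contDiffOn_divOp hW ha hu) hx hqM h2).mono hR'' le_rfl
    (le_of_eq ?_)
  simp
  ring

/-- The iterates of an operator with Gevrey coefficients on a Gevrey function. -/
theorem exists_norm_divOpIter_le {σ : ℝ} (hσ : 1 ≤ σ) {q : Euc d → ℝ}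
    {a : Fin d → Fin d → Euc d → ℝ} {w : Euc d → ℂ} {W K : Set (Euc d)} (hW : IsOpen W)
    (hKW : K ⊆ W) (hq : ContDiffOn ℝ ∞ q W) (ha : ∀ i j, ContDiffOn ℝ ∞ (a i j) W)
    (hw : ContDiffOn ℝ ∞ w W) (hqK : IsGevreyBounded σ q K)
    (haK : ∀ i j, IsGevreyBounded σ (a i j) K) (hwK : IsGevreyBounded σ w K) :
    ∃ H A : ℝ, 0 < H ∧ 0 < A ∧ ∀ k : ℕ, ∀ x ∈ K,
      ‖divOpIter q a w k x‖ ≤ H * (A * (k : ℝ) ^ (2 * σ)) ^ k := by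
  obtain ⟨R₁, M₁, hR₁, hM₁, h₁⟩ := hqK.exists_gevreySumLE
  obtain ⟨R₂, M₂, hR₂, hM₂, h₂⟩ : ∃ R M : ℝ, 0 < R ∧ 0 < M ∧ ∀ i j, ∀ x ∈ K,
      GevreySumLE σ R M (a i j) x := by
    choose R M hR hM h using fun i j => (haK i j).exists_gevreySumLE
    rcases isEmpty_or_nonempty (Fin d) with he | he
    · exact ⟨1, 1, one_pos, one_pos, fun i => he.elim i⟩
    refine ⟨Finset.univ.inf' Finset.univ_nonempty fun p : Fin d × Fin d => R p.1 p.2,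
      ∑ p : Fin d × Fin d, M p.1 p.2, ?_, ?_, fun i j x hx => ?_⟩
    · exact (Finset.lt_inf'_iff _).2 fun p _ => hR p.1 p.2
    · exact Finset.sum_pos (fun p _ => hM p.1 p.2) Finset.univ_nonempty
    · exact (h i j x hx).mono
        ((Finset.lt_inf'_iff (f := fun p : Fin d × Fin d => R p.1 p.2) _).2
          fun p _ => hR p.1 p.2).le
        (Finset.inf'_le (fun p : Fin d × Fin d => R p.1 p.2) (Finset.mem_univ (i, j)))
        (Finset.single_le_sum (f := fun p : Fin d × Fin d => M p.1 p.2)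
          (fun p _ => (hM p.1 p.2).le) (Finset.mem_univ (i, j)))
  obtain ⟨R₃, M₃, hR₃, hM₃, h₃⟩ := hwK.exists_gevreySumLE
  set R := min R₁ (min R₂ R₃) with hR
  have hR0 : 0 < R := lt_min hR₁ (lt_min hR₂ hR₃)
  -- Chosen so that c = D k^σ satisfies (4kσ)^σ e = c R/2, the price of one shrinking when m = 4k
  -- and all radii are at least R/2.
  set D := 2 * ((4 * σ) ^ σ * Real.exp 1) / R with hD
  have hD0 : 0 < D := by positivity
  refine ⟨M₃, M₁ * (d ^ 2 * D ^ 2 * M₂) + 1, hM₃, by positivity, fun k x hx => ?_⟩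
  rcases Nat.eq_zero_or_pos k with rfl | hk
  · simpa [divOpIter] using (h₃ x hx).norm_le
  have hk' : (0 : ℝ) < k := by exact_mod_cast hk
  -- The k iterates contain 2k derivatives, and each lowers the radius by R/(4k), so that half of R
  -- survives. The radii depend on the total number k of iterates.
  set ρ : ℕ → ℝ := fun j => R * (1 - j / (4 * k : ℕ)) with hρ
  have hρ1 : ∀ j ≤ 2 * k, R / 2 ≤ ρ j := fun j hj => by
    have : (j : ℝ) / (4 * k : ℕ) ≤ 1 / 2 := by
      have : (j : ℝ) ≤ 2 * k := by exact_mod_cast hj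
      rw [div_le_div_iff₀ (by positivity) (by positivity)]
      push_cast
      linarith
    simp only [hρ]
    nlinarith
  have hρ2 : ∀ j, ρ j ≤ R := fun j => by
    have : (0 : ℝ) ≤ j / (4 * k : ℕ) := by positivity
    simp only [hρ]
    nlinarith
  set c := D * (k : ℝ) ^ σ with hc
  have hc0 : 0 ≤ c := by positivity
  have hstep : ∀ j, j + 1 ≤ 2 * k → ∀ l : ℕ,
      ((l : ℝ) + 1) ^ σ * (ρ (j + 1) / ρ j) ^ l ≤ c * ρ j := by
    intro j hj l
    have e1 := hρ1 j (by omega)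
    have e2 := hρ1 (j + 1) hj
    have e3 : 0 < ρ j := by linarith
    have e4 : 0 < ρ (j + 1) := by linarith
    refine (add_one_rpow_mul_pow_le hσ (m := 4 * k) (by omega) (by positivity) ?_ l).trans ?_
    · rw [div_le_iff₀ e3]
      have e5 : ρ (j + 1) = ρ j - R * (1 / (4 * k : ℕ)) := by
        simp only [hρ]
        push_cast
        ring
      have e6 : 0 ≤ 1 / ((4 * k : ℕ) : ℝ) := by positivity
      have e7 := hρ2 j
      rw [e5]
      nlinarith
    · calc (((4 * k : ℕ) : ℝ) * σ) ^ σ * Real.exp 1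
          = (4 * σ) ^ σ * (k : ℝ) ^ σ * Real.exp 1 := by
            rw [← Real.mul_rpow (by positivity) (by positivity)]
            congr 2
            push_cast
            ring
        _ = c * (R / 2) := by
            rw [hc, hD]
            field_simp
        _ ≤ _ := by gcongr
  have main : ∀ i ≤ k, GevreySumLE σ (ρ (2 * i)) (M₃ * (M₁ * (d ^ 2 * c ^ 2 * M₂)) ^ i)
      (divOpIter q a w i) x := by
    intro i hi
    induction i with
    | zero =>
      simpa [divOpIter] using (h₃ x hx).mono (R' := ρ 0) (by simp [hρ, hR0.le])
        ((hρ2 0).trans ((min_le_right _ _).trans (min_le_right _ _))) le_rfl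
    | succ i ih =>
      have e1 := hρ1 (2 * i) (by omega)
      have e2 := hρ1 (2 * i + 1) (by omega)
      have e3 := hρ1 (2 * i + 1 + 1) (by omega)
      have := GevreySumLE.smul_divOp hσ hW hq ha (contDiffOn_divOpIter hW hq ha hw i) (hKW hx)
        (R' := ρ (2 * i + 1)) (R'' := ρ (2 * i + 1 + 1)) (by linarith) (by linarith)
        (by linarith) hc0 (hstep _ (by omega)) (hstep _ (by omega)) (ih (by omega))
        ((h₁ x hx).mono (by linarith) ((hρ2 _).trans (min_le_left _ _)) le_rfl)
        (fun i' j => (h₂ i' j x hx).mono (by linarith)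
          ((hρ2 _).trans ((min_le_right _ _).trans (min_le_left _ _))) le_rfl)
      rw [show 2 * (i + 1) = 2 * i + 1 + 1 by ring]
      refine GevreySumLE.mono this (by linarith) le_rfl (le_of_eq ?_)
      rw [pow_succ]
      ring
  refine (main k le_rfl).norm_le.trans ?_
  have hck : c ^ 2 = D ^ 2 * (k : ℝ) ^ (2 * σ) := by
    rw [hc, mul_pow, mul_comm 2 σ, Real.rpow_mul hk'.le]
    norm_num
  rw [hck]
  have : M₁ * (d ^ 2 * (D ^ 2 * (k : ℝ) ^ (2 * σ)) * M₂) =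
      M₁ * (d ^ 2 * D ^ 2 * M₂) * (k : ℝ) ^ (2 * σ) := by ring
  rw [this]
  gcongr
  linarith

end Iterates

/-! ### Auxiliary bounds for derivatives and factorials -/

section CovariantDerivatives

variable {d : ℕ}

/-- The differential is ∑ dx_i ⊗ ∂_i f, and tensoring with dx_i is a linear map of norm at most one.
-/
theorem norm_iteratedFDeriv_succ_le_sum {V : Type*} [NormedAddCommGroup V] [NormedSpace ℝ V]
    {f : Euc d → V} {x : Euc d} (hf : ContDiffAt ℝ ∞ f x) (m : ℕ) :
    ‖iteratedFDeriv ℝ (m + 1) f x‖ ≤ ∑ i, ‖iteratedFDeriv ℝ m (partialDeriv i f) x‖ := by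
  have hp : ∀ i, ContDiffAt ℝ ∞ (partialDeriv i f) x := fun i =>
    (hf.fderiv_right (m := ∞) (by simp)).clm_apply contDiffAt_const
  let L : Fin d → V →L[ℝ] (Euc d →L[ℝ] V) := fun i =>
    ContinuousLinearMap.smulRightL ℝ (Euc d) V (EuclideanSpace.proj i)
  have hL : ∀ i, ‖L i‖ ≤ 1 := fun i => by
    refine ContinuousLinearMap.opNorm_le_bound _ zero_le_one fun v => ?_
    refine ContinuousLinearMap.opNorm_le_bound _ (by positivity) fun z => ?_
    change ‖z i • v‖ ≤ _
    rw [norm_smul, one_mul, mul_comm]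
    exact mul_le_mul_of_nonneg_left (PiLp.norm_apply_le z i) (norm_nonneg _)
  have heq : fderiv ℝ f = ∑ i, (L i ∘ partialDeriv i f) := by
    ext y z
    conv_lhs => rw [← sum_smul_stdVec z, map_sum]
    simp [L, partialDeriv]
  rw [← norm_iteratedFDeriv_fderiv, heq, iteratedFDeriv_sum_apply fun i _ =>
    (((L i).contDiff.contDiffAt.comp x (hp i))).of_le (by exact_mod_cast le_top)]
  refine (norm_sum_le _ _).trans (Finset.sum_le_sum fun i _ => ?_)
  refine ((L i).norm_iteratedFDeriv_comp_left (hp i) (by exact_mod_cast le_top)).trans ?_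
  exact mul_le_of_le_one_left (norm_nonneg _) (hL i)

/-- The falling factorial of length j from m is at most the one from m + k. Shifted factorials occur
because m derivatives of a tensor of order k are measured against (m + k)!^σ. -/
theorem choose_mul_factorial_mul_rpow_le {σ : ℝ} (hσ : 1 ≤ σ) {m j : ℕ} (hj : j ≤ m) (k : ℕ) :
    (m.choose j : ℝ) * j.factorial * ((m - j + k).factorial : ℝ) ^ σ ≤
      ((m + k).factorial : ℝ) ^ σ := by
  have h1 : m.choose j * j.factorial * (m - j + k).factorial ≤ (m + k).factorial := by
    have e1 : m.choose j * j.factorial = m.descFactorial j := by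
      rw [Nat.descFactorial_eq_factorial_mul_choose, mul_comm]
    have e2 : (m + k).descFactorial j * (m + k - j).factorial = (m + k).factorial := by
      rw [mul_comm]
      exact Nat.factorial_mul_descFactorial (by omega)
    rw [e1, ← e2, show m - j + k = m + k - j by omega]
    exact Nat.mul_le_mul_right _ (Nat.descFactorial_le j (by omega))
  have h2 : (1 : ℝ) ≤ m.choose j * j.factorial := by
    exact_mod_cast Nat.mul_pos (Nat.choose_pos hj) (Nat.factorial_pos j)
  have h3 : (m.choose j : ℝ) * j.factorial ≤ ((m.choose j : ℝ) * j.factorial) ^ σ := by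
    simpa using Real.rpow_le_rpow_of_exponent_le h2 hσ
  calc _ ≤ ((m.choose j : ℝ) * j.factorial) ^ σ * ((m - j + k).factorial : ℝ) ^ σ := by gcongr
    _ = ((m.choose j : ℝ) * j.factorial * (m - j + k).factorial) ^ σ := by
      rw [← Real.mul_rpow (by positivity) (by positivity)]
    _ ≤ _ := by
      refine Real.rpow_le_rpow (by positivity) ?_ (by linarith)
      exact_mod_cast h1

end CovariantDerivatives

/-! ### From covariant derivatives to coordinate derivatives -/

section CovariantDerivatives

variable {d : ℕ}

theorem norm_iteratedFDeriv_sum_le {V ι : Type*} [NormedAddCommGroup V] [NormedSpace ℝ V]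
    (s : Finset ι) {f : ι → Euc d → V} {x : Euc d} (hf : ∀ i ∈ s, ContDiffAt ℝ ∞ (f i) x) (m : ℕ) :
    ‖iteratedFDeriv ℝ m (fun y => ∑ i ∈ s, f i y) x‖ ≤
      ∑ i ∈ s, ‖iteratedFDeriv ℝ m (f i) x‖ := by
  have hs : (fun y => ∑ i ∈ s, f i y) = ∑ i ∈ s, f i := by
    ext y
    simp
  rw [hs, iteratedFDeriv_sum_apply fun i hi => (hf i hi).of_le (by exact_mod_cast le_top)]
  exact norm_sum_le _ _

/-- Derivatives of a product of an analytic and a Gevrey function, with shifted factorials. -/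
theorem norm_iteratedFDeriv_smul_le_of_shifted {σ G A H L : ℝ} (hσ : 1 ≤ σ) (hG : 0 ≤ G)
    (hA : 0 < A) (hH : 0 ≤ H) (hAL : 2 * A ≤ L) {b : Euc d → ℝ} {f : Euc d → ℂ}
    {W : Set (Euc d)} (hW : IsOpen W) (hb : ContDiffOn ℝ ∞ b W) (hf : ContDiffOn ℝ ∞ f W)
    {x : Euc d} (hx : x ∈ W) {m k : ℕ}
    (hbx : ∀ j, ‖iteratedFDeriv ℝ j b x‖ ≤ G * A ^ j * j.factorial)
    (hfx : ∀ j ≤ m, ‖iteratedFDeriv ℝ j f x‖ ≤ H * L ^ j * ((j + k).factorial : ℝ) ^ σ) :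
    ‖iteratedFDeriv ℝ m (fun y => b y • f y) x‖ ≤
      2 * G * H * L ^ m * ((m + k).factorial : ℝ) ^ σ := by
  have hL : 0 < L := by linarith
  have h1 := norm_iteratedFDerivWithin_smul_le hb hf hW.uniqueDiffOn hx (n := m)
    (by exact_mod_cast le_top)
  simp only [iteratedFDerivWithin_of_isOpen _ hW hx] at h1
  refine h1.trans ?_
  calc _ ≤ ∑ j ∈ Finset.range (m + 1),
        G * H * L ^ m * ((m + k).factorial : ℝ) ^ σ * (1 / 2) ^ j := by
        refine Finset.sum_le_sum fun j hj => ?_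
        have hjm : j ≤ m := Nat.lt_succ_iff.1 (Finset.mem_range.1 hj)
        have e1 := choose_mul_factorial_mul_rpow_le hσ hjm k
        -- The room 2A ≤ L makes the Leibniz sum geometric, whence the factor 2 in the conclusion.
        have e2 : A ^ j ≤ L ^ j * (1 / 2) ^ j := by
          rw [← mul_pow]
          gcongr
          linarith
        calc _ ≤ (m.choose j : ℝ) * (G * A ^ j * j.factorial) *
              (H * L ^ (m - j) * ((m - j + k).factorial : ℝ) ^ σ) := by
              gcongr
              · exact hbx j
              · exact hfx _ (Nat.sub_le _ _)
          _ = G * H * L ^ (m - j) * A ^ j * ((m.choose j : ℝ) * j.factorial *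
              ((m - j + k).factorial : ℝ) ^ σ) := by ring
          _ ≤ G * H * L ^ (m - j) * (L ^ j * (1 / 2) ^ j) * ((m + k).factorial : ℝ) ^ σ := by
              gcongr
          _ = _ := by
              have : L ^ m = L ^ (m - j) * L ^ j := by rw [← pow_add, Nat.sub_add_cancel hjm]
              rw [this]
              ring
    _ ≤ _ := by
        rw [← Finset.mul_sum]
        have := sum_geometric_two_le (m + 1)
        have e0 : 0 ≤ G * H * L ^ m * ((m + k).factorial : ℝ) ^ σ := by positivity
        nlinarith

/-- Gevrey bounds for all partial derivatives from bounds for iterated covariant derivatives. -/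
theorem norm_iteratedFDeriv_le_of_covariant {σ G A H M L : ℝ} (hσ : 1 ≤ σ) (hG : 0 ≤ G)
    (hA : 0 < A) (hH : 0 ≤ H) (hM : 0 ≤ M) (hL : 2 * A ≤ L) (hL' : d * (M + 2 * d * G) ≤ L)
    {Γ : Fin d → Fin d → Fin d → Euc d → ℝ} {T : (k : ℕ) → (Fin k → Fin d) → Euc d → ℂ}
    {W : Set (Euc d)} (hW : IsOpen W) (hΓ : ∀ l i j, ContDiffOn ℝ ∞ (Γ l i j) W)
    (hT : ∀ k I, ContDiffOn ℝ ∞ (T k I) W)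
    (hrec : ∀ k (I : Fin k → Fin d) i, ∀ y ∈ W, partialDeriv i (T k I) y =
      T (k + 1) (Fin.cons i I) y +
        ∑ m : Fin k, ∑ l, Γ l i (I m) y • T k (Function.update I m l) y)
    {x : Euc d} (hx : x ∈ W)
    (hΓx : ∀ l i j (n : ℕ), ‖iteratedFDeriv ℝ n (Γ l i j) x‖ ≤ G * A ^ n * n.factorial)
    (hTx : ∀ k I, ‖T k I x‖ ≤ H * M ^ k * (k.factorial : ℝ) ^ σ) (m : ℕ) :
    ∀ k I, ‖iteratedFDeriv ℝ m (T k I) x‖ ≤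
      H * L ^ m * M ^ k * ((m + k).factorial : ℝ) ^ σ := by
  have hL0 : 0 < L := by linarith
  -- The induction treats all tensor orders at once, since trading a partial for a covariant
  -- derivative raises k by one. It is strong because Leibniz' rule for Γ T involves all lower
  -- derivatives.
  induction m using Nat.strong_induction_on with
  | _ m ih =>
    intro k I
    cases m with
    | zero => simpa using hTx k I
    | succ m =>
      have hTa : ∀ k I, ContDiffAt ℝ ∞ (T k I) x := fun k I =>
        (hT k I).contDiffAt (hW.mem_nhds hx)
      have hΓT : ∀ i (q : Fin k) l, ContDiffAt ℝ ∞
          (fun y => Γ l i (I q) y • T k (Function.update I q l) y) x := fun i q l =>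
        ((hΓ l i (I q)).smul (hT k _)).contDiffAt (hW.mem_nhds hx)
      -- A tensor of order k produces k groups of Christoffel terms; the step from (m + k)! to (m +
      -- 1 + k)! absorbs this factor, so no constant grows with k.
      have hfac : (k : ℝ) * ((m + k).factorial : ℝ) ^ σ ≤ ((m + 1 + k).factorial : ℝ) ^ σ := by
        have e1 : m + 1 + k = (m + k) + 1 := by ring
        rw [e1, Nat.factorial_succ, Nat.cast_mul, Real.mul_rpow (by positivity) (by positivity)]
        gcongr
        have e2 : (1 : ℝ) ≤ ((m + k + 1 : ℕ) : ℝ) := by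
          exact_mod_cast Nat.le_add_left 1 (m + k)
        calc (k : ℝ) ≤ ((m + k + 1 : ℕ) : ℝ) := by exact_mod_cast (by omega)
          _ ≤ _ := by simpa using Real.rpow_le_rpow_of_exponent_le e2 hσ
      have hi : ∀ i, ‖iteratedFDeriv ℝ m (partialDeriv i (T k I)) x‖ ≤
          H * L ^ m * M ^ k * ((m + 1 + k).factorial : ℝ) ^ σ * (M + 2 * d * G) := by
        intro i
        have heq : partialDeriv i (T k I) =ᶠ[𝓝 x] T (k + 1) (Fin.cons i I) +
            fun y => ∑ q : Fin k, ∑ l, Γ l i (I q) y • T k (Function.update I q l) y := by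
          filter_upwards [hW.mem_nhds hx] with y hy
          exact hrec k I i y hy
        rw [(Filter.EventuallyEq.iteratedFDeriv ℝ heq m).eq_of_nhds, iteratedFDeriv_add_apply
          ((hTa _ _).of_le (by exact_mod_cast le_top))
          ((ContDiffAt.sum fun q _ => ContDiffAt.sum fun l _ => hΓT i q l).of_le
            (by exact_mod_cast le_top))]
        refine (norm_add_le _ _).trans ?_
        have h1 := ih m (Nat.lt_succ_self m) (k + 1) (Fin.cons i I)
        have h2 : ‖iteratedFDeriv ℝ m (fun y => ∑ q : Fin k, ∑ l,
            Γ l i (I q) y • T k (Function.update I q l) y) x‖ ≤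
            ∑ _q : Fin k, ∑ _l : Fin d,
              2 * G * (H * M ^ k) * L ^ m * ((m + k).factorial : ℝ) ^ σ := by
          refine (norm_iteratedFDeriv_sum_le _ (fun q _ => ContDiffAt.sum fun l _ => hΓT i q l)
            m).trans (Finset.sum_le_sum fun q _ => ?_)
          refine (norm_iteratedFDeriv_sum_le _ (fun l _ => hΓT i q l) m).trans
            (Finset.sum_le_sum fun l _ => ?_)
          refine norm_iteratedFDeriv_smul_le_of_shifted hσ hG hA (by positivity) hL hW
            (hΓ _ _ _) (hT _ _) hx (hΓx _ _ _) fun j hj => ?_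
          refine (ih j (Nat.lt_succ_of_le hj) k _).trans_eq ?_
          ring
        simp only [Finset.sum_const, Finset.card_univ, Fintype.card_fin, nsmul_eq_mul] at h2
        have e1 : m + (k + 1) = m + 1 + k := by ring
        rw [e1] at h1
        calc _ ≤ H * L ^ m * M ^ (k + 1) * ((m + 1 + k).factorial : ℝ) ^ σ +
              k * (d * (2 * G * (H * M ^ k) * L ^ m * ((m + k).factorial : ℝ) ^ σ)) :=
              add_le_add h1 h2
          _ = H * L ^ m * M ^ (k + 1) * ((m + 1 + k).factorial : ℝ) ^ σ +
              d * (2 * G * (H * M ^ k) * L ^ m) * (k * ((m + k).factorial : ℝ) ^ σ) := by ring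
          _ ≤ H * L ^ m * M ^ (k + 1) * ((m + 1 + k).factorial : ℝ) ^ σ +
              d * (2 * G * (H * M ^ k) * L ^ m) * ((m + 1 + k).factorial : ℝ) ^ σ := by gcongr
          _ = _ := by ring
      refine (norm_iteratedFDeriv_succ_le_sum (hTa k I) m).trans
        ((Finset.sum_le_sum fun i _ => hi i).trans ?_)
      simp only [Finset.sum_const, Finset.card_univ, Fintype.card_fin, nsmul_eq_mul]
      calc _ = H * L ^ m * M ^ k * ((m + 1 + k).factorial : ℝ) ^ σ * (d * (M + 2 * d * G)) := by
            ring
        _ ≤ H * L ^ m * M ^ k * ((m + 1 + k).factorial : ℝ) ^ σ * L := by gcongr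
        _ = _ := by ring

open scoped MatrixOrder Matrix.Norms.L2Operator in
theorem exists_eq_transpose_mul_self {h : Matrix (Fin d) (Fin d) ℝ} (hh : h.PosDef) :
    ∃ B : Matrix (Fin d) (Fin d) ℝ, h = B.transpose * B := by
  obtain ⟨B, hB⟩ := CStarAlgebra.nonneg_iff_eq_star_mul_self.mp hh.posSemidef.nonneg
  exact ⟨B, by simpa [Matrix.star_eq_conjTranspose] using hB⟩

/-- A component of a tensor is bounded by the norm of the tensor and the norms of the basis
vectors. -/
theorem norm_sq_le_prod_mul_tensorNorm {h : Matrix (Fin d) (Fin d) ℝ} (hh : h.PosDef) (k : ℕ)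
    (T : (Fin k → Fin d) → ℂ) (I : Fin k → Fin d) :
    ‖T I‖ ^ 2 ≤ (∏ m, h⁻¹ (I m) (I m)) *
      (∑ I, ∑ J, (∏ m, h (I m) (J m)) • (T I * starRingEnd ℂ (T J))).re := by
  obtain ⟨B, hB⟩ := exists_eq_transpose_mul_self hh
  have hBdet : IsUnit B.det := by
    have h1 := hh.det_pos
    rw [hB, Matrix.det_mul, Matrix.det_transpose] at h1
    exact isUnit_iff_ne_zero.2 fun h0 => by simp [h0] at h1
  -- With h = BᵀB these are the components in an orthonormal frame, so the tensor norm becomes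
  -- Euclidean. T is recovered by B⁻¹ in each index, Cauchy-Schwarz applies, and the squared rows of
  -- B⁻¹ sum to the diagonal entries of h⁻¹.
  set S : (Fin k → Fin d) → ℂ := fun R => ∑ J, (∏ m, B (R m) (J m)) • T J with hS
  have hsum : (∑ I, ∑ J, (∏ m, h (I m) (J m)) • (T I * starRingEnd ℂ (T J))).re =
      ∑ R, ‖S R‖ ^ 2 := by
    have e1 : ∀ R, ((‖S R‖ ^ 2 : ℝ) : ℂ) = ∑ I, ∑ J,
        ((∏ m, B (R m) (I m)) * ∏ m, B (R m) (J m)) • (T I * starRingEnd ℂ (T J)) := by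
      intro R
      rw [← Complex.normSq_eq_norm_sq, ← Complex.mul_conj, hS]
      simp only [map_sum, Finset.sum_mul_sum]
      refine Finset.sum_congr rfl fun I _ => Finset.sum_congr rfl fun J _ => ?_
      simp only [Complex.real_smul, map_mul, Complex.conj_ofReal, Complex.ofReal_mul]
      ring
    have e2 : ∑ I, ∑ J, (∏ m, h (I m) (J m)) • (T I * starRingEnd ℂ (T J)) =
        ∑ R, ((‖S R‖ ^ 2 : ℝ) : ℂ) := by
      simp only [e1]
      conv_rhs => rw [Finset.sum_comm]
      refine Finset.sum_congr rfl fun I _ => ?_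
      conv_rhs => rw [Finset.sum_comm]
      refine Finset.sum_congr rfl fun J _ => ?_
      rw [← Finset.sum_smul]
      congr 1
      simp only [hB, Matrix.mul_apply, Matrix.transpose_apply]
      rw [Finset.prod_univ_sum, Fintype.piFinset_univ]
      exact Finset.sum_congr rfl fun R _ => Finset.prod_mul_distrib
    rw [e2, ← Complex.ofReal_sum, Complex.ofReal_re]
  have hinv : T I = ∑ R, (∏ m, B⁻¹ (I m) (R m)) • S R := by
    simp only [hS, Finset.smul_sum, smul_smul]
    rw [Finset.sum_comm]
    have e1 : ∀ J, ∑ R : Fin k → Fin d, ((∏ m, B⁻¹ (I m) (R m)) * ∏ m, B (R m) (J m)) • T J =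
        if I = J then T J else 0 := by
      intro J
      rw [← Finset.sum_smul]
      have e2 : ∑ R : Fin k → Fin d, (∏ m, B⁻¹ (I m) (R m)) * ∏ m, B (R m) (J m) =
          ∏ m, (B⁻¹ * B) (I m) (J m) := by
        simp only [Matrix.mul_apply]
        rw [Finset.prod_univ_sum, Fintype.piFinset_univ]
        exact Finset.sum_congr rfl fun R _ => Finset.prod_mul_distrib.symm
      have e3 : ∀ i j, (B⁻¹ * B) i j = if i = j then 1 else 0 := fun i j => by
        rw [Matrix.nonsing_inv_mul B hBdet, Matrix.one_apply]
      simp only [e2, e3]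
      split_ifs with hIJ
      · simp [hIJ]
      · obtain ⟨m, hm⟩ := Function.ne_iff.1 hIJ
        rw [Finset.prod_eq_zero (Finset.mem_univ m) (if_neg hm), zero_smul]
    rw [Finset.sum_congr rfl fun J _ => e1 J]
    simp
  have hdiag : ∏ m, h⁻¹ (I m) (I m) = ∑ R : Fin k → Fin d, (∏ m, B⁻¹ (I m) (R m)) ^ 2 := by
    have e1 : h⁻¹ = B⁻¹ * B⁻¹.transpose := by
      rw [hB, Matrix.mul_inv_rev, Matrix.transpose_nonsing_inv]
    simp only [e1, Matrix.mul_apply, Matrix.transpose_apply]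
    rw [Finset.prod_univ_sum, Fintype.piFinset_univ]
    refine Finset.sum_congr rfl fun R _ => ?_
    rw [Finset.prod_mul_distrib, sq]
  rw [hsum, hdiag]
  have e3 : ‖T I‖ ≤ ∑ R, |∏ m, B⁻¹ (I m) (R m)| * ‖S R‖ := by
    rw [hinv]
    refine (norm_sum_le _ _).trans_eq ?_
    simp only [norm_smul, Real.norm_eq_abs]
  calc ‖T I‖ ^ 2 ≤ (∑ R, |∏ m, B⁻¹ (I m) (R m)| * ‖S R‖) ^ 2 := by gcongr
    _ ≤ (∑ R : Fin k → Fin d, |∏ m, B⁻¹ (I m) (R m)| ^ 2) * ∑ R, ‖S R‖ ^ 2 :=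
        Finset.sum_mul_sq_le_sq_mul_sq _ _ _
    _ = _ := by simp only [sq_abs]

variable {N : Type*} [TopologicalSpace N] [ChartedSpace (Euc d) N]
  [IsManifold 𝓘(ℝ, Euc d) ω N] {c : OpenPartialHomeomorph N (Euc d)}

theorem contDiffOn_christoffel (g : AnalyticMetric d N) (hc : c ∈ analyticCharts d N)
    (l i j : Fin d) : ContDiffOn ℝ ω (christoffel g c l i j) c.target := by
  have h : ∀ i j m, ContDiffOn ℝ ω (partialDeriv i fun y => gram g c y j m) c.target :=
    fun i j m => contDiffOn_partialDeriv c.open_target (contDiffOn_gram g hc j m) le_rfl i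
  exact contDiffOn_const.mul (ContDiffOn.sum fun m _ =>
    (contDiffOn_gramInv g hc l m).mul (((h i j m).add (h j i m)).sub (h m i j)))

theorem contDiffOn_covDeriv (g : AnalyticMetric d N) (hc : c ∈ analyticCharts d N) {u : N → ℂ}
    (hu : ContMDiff 𝓘(ℝ, Euc d) 𝓘(ℝ, ℂ) ∞ u) (k : ℕ) (I : Fin k → Fin d) :
    ContDiffOn ℝ ∞ (covDeriv g c u k I) c.target := by
  induction k with
  | zero => exact contDiffOn_comp_symm hc hu
  | succ k ih =>
    exact (contDiffOn_partialDeriv c.open_target (ih _) (by simp) _).sub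
      (ContDiffOn.sum fun m _ => ContDiffOn.sum fun l _ =>
        ((contDiffOn_christoffel g hc _ _ _).of_le (by simp)).smul (ih _))

theorem partialDeriv_covDeriv (g : AnalyticMetric d N) (c : OpenPartialHomeomorph N (Euc d))
    (u : N → ℂ) (k : ℕ) (I : Fin k → Fin d) (i : Fin d) (y : Euc d) :
    partialDeriv i (covDeriv g c u k I) y = covDeriv g c u (k + 1) (Fin.cons i I) y +
      ∑ m : Fin k, ∑ l, christoffel g c l i (I m) y •
        covDeriv g c u k (Function.update I m l) y := by
  simp [covDeriv]

theorem rpow_mul_le_factorial_rpow {σ : ℝ} (hσ : 0 ≤ σ) (k : ℕ) :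
    (k : ℝ) ^ (σ * k) ≤ Real.exp σ ^ k * (k.factorial : ℝ) ^ σ := by
  have h1 := Real.pow_div_factorial_le_exp (k : ℝ) (Nat.cast_nonneg k) k
  rw [div_le_iff₀ (by positivity)] at h1
  calc (k : ℝ) ^ (σ * k) = ((k : ℝ) ^ k) ^ σ := by
        rw [← Real.rpow_natCast, ← Real.rpow_mul (by positivity), mul_comm]
    _ ≤ (Real.exp k * k.factorial) ^ σ := Real.rpow_le_rpow (by positivity) h1 hσ
    _ = _ := by
        rw [Real.mul_rpow (by positivity) (by positivity), ← Real.exp_mul, ← Real.exp_nat_mul]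

/-- Gevrey functions on the manifold satisfy Gevrey bounds in coordinates. -/
theorem IsGevrey.isGevreyBounded {g : AnalyticMetric d N} {σ : ℝ} (hσ : 1 ≤ σ) {u : N → ℂ}
    (hu : IsGevrey g σ u) (hc : c ∈ analyticCharts d N) {K : Set (Euc d)} (hK : IsCompact K)
    (hKc : K ⊆ c.target) : IsGevreyBounded σ (u ∘ c.symm) K := by
  obtain ⟨hu, C, hC, hCu⟩ := hu
  obtain ⟨G, A, hG, hA, hΓ⟩ := exists_uniform_of_isGevreyBounded (σ := 1)
    (f := fun p : Fin d × Fin d × Fin d => christoffel g c p.1 p.2.1 p.2.2) (K := K)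
    fun p => (contDiffOn_christoffel g hc _ _ _).isGevreyBounded c.open_target hK hKc le_rfl
  obtain ⟨E, hE0, hE⟩ : ∃ E : ℝ, 0 ≤ E ∧ ∀ i, ∀ x ∈ K, gram g c x i i ≤ E := by
    choose E hE using fun i => hK.exists_bound_of_continuousOn
      ((contDiffOn_gram g hc i i).continuousOn.mono hKc)
    refine ⟨∑ i, |E i|, Finset.sum_nonneg fun i _ => abs_nonneg _, fun i x hx =>
      (le_abs_self _).trans ((hE i x hx).trans ((le_abs_self _).trans ?_))⟩
    exact Finset.single_le_sum (f := fun i => |E i|) (fun i _ => abs_nonneg _)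
      (Finset.mem_univ i)
  set M := (E + 1) * C * Real.exp σ with hM
  have hM0 : 0 ≤ M := by positivity
  have hT : ∀ x ∈ K, ∀ k I, ‖covDeriv g c u k I x‖ ≤ C * M ^ k * (k.factorial : ℝ) ^ σ := by
    intro x hx k I
    have h1 := norm_sq_le_prod_mul_tensorNorm (gramInv_posDef g hc (hKc hx)) k
      (fun I => covDeriv g c u k I x) I
    have h2 := hCu k c hc x (hKc hx)
    -- The norm of a covariant tensor is formed with g^{ij}, so the diagonal entries of the inverse
    -- are the g_{ii}, bounded by E on K.
    have h3 : (gramInv g c x)⁻¹ = gram g c x := Matrix.nonsing_inv_nonsing_inv _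
      (isUnit_iff_ne_zero.2 (gram_det_pos g hc (hKc hx)).ne')
    rw [h3] at h1
    rw [covDerivNorm, Real.sqrt_le_left (by positivity)] at h2
    have hg0 : ∀ i, 0 ≤ gram g c x i i := fun i => (gram_posDef g hc (hKc hx)).diag_pos.le
    have h4 : ∏ m, gram g c x (I m) (I m) ≤ (E + 1) ^ (2 * k) := by
      calc ∏ m, gram g c x (I m) (I m) ≤ ∏ _m : Fin k, (E + 1) ^ 2 := by
            refine Finset.prod_le_prod (fun m _ => hg0 _) fun m _ => ?_
            have := hE (I m) x hx
            nlinarith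
        _ = _ := by simp [pow_mul]
    have h5 : ‖covDeriv g c u k I x‖ ^ 2 ≤
        ((E + 1) ^ k * (C ^ (k + 1) * (k : ℝ) ^ (σ * k))) ^ 2 := by
      refine h1.trans ?_
      rw [mul_pow, ← pow_mul, mul_comm k 2]
      refine (mul_le_mul_of_nonneg_left h2 (Finset.prod_nonneg fun m _ => hg0 _)).trans ?_
      gcongr
    have h6 := abs_le_of_sq_le_sq h5 (by positivity)
    refine (le_abs_self _).trans (h6.trans ?_)
    calc (E + 1) ^ k * (C ^ (k + 1) * (k : ℝ) ^ (σ * k))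
        ≤ (E + 1) ^ k * (C ^ (k + 1) * (Real.exp σ ^ k * (k.factorial : ℝ) ^ σ)) := by
          gcongr
          exact rpow_mul_le_factorial_rpow (by linarith) k
      _ = _ := by
          rw [hM, mul_pow, mul_pow]
          ring
  refine ⟨C, 2 * A + d * (M + 2 * d * G), hC, by positivity, fun k x hx => ?_⟩
  -- The tensor of order zero is u itself, and L is a sum of two nonnegative terms so that it
  -- dominates both required lower bounds.
  have := norm_iteratedFDeriv_le_of_covariant hσ hG.le hA hC.le hM0
    (le_add_of_nonneg_right (by positivity)) (le_add_of_nonneg_left (by positivity))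
    c.open_target (fun l i j => (contDiffOn_christoffel g hc l i j).of_le (by simp))
    (fun k I => contDiffOn_covDeriv g hc hu k I)
    (fun k I i y _ => partialDeriv_covDeriv g c u k I i y) (hKc hx)
    (fun l i j n => by simpa using hΓ (l, i, j) n x hx) (hT x hx) k 0 Fin.elim0
  simp only [pow_zero, mul_one, add_zero] at this
  exact this

end CovariantDerivatives

/-! ### Decay of the eigenfunction coefficients -/

section Decay

/-- Optimization over the number of iterates. -/
theorem le_exp_of_forall_pow_mul_le {I H A lam σ : ℝ} (hH : 0 < H) (hA : 0 < A)
    (hlam : 0 ≤ lam) (hσ : 0 < σ)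
    (h : ∀ k : ℕ, lam ^ k * I ≤ H * (A * (k : ℝ) ^ (2 * σ)) ^ k) :
    I ≤ H * Real.exp (1 - (lam / (A * Real.exp 1)) ^ (1 / (2 * σ))) := by
  -- At k = y the quotient A k^{2σ} / λ equals 1/e, so each iterate gains a factor e⁻¹. Rounding y
  -- down costs at most the factor e, the 1 in the exponent.
  set y := (lam / (A * Real.exp 1)) ^ (1 / (2 * σ)) with hy
  have hy0 : 0 ≤ y := by positivity
  set k := ⌊y⌋₊ with hk
  have hk1 : (k : ℝ) ≤ y := Nat.floor_le hy0
  have hk2 : y < k + 1 := Nat.lt_floor_add_one y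
  have h1 : (k : ℝ) ^ (2 * σ) ≤ lam / (A * Real.exp 1) := by
    calc (k : ℝ) ^ (2 * σ) ≤ y ^ (2 * σ) := by gcongr
      _ = _ := by
        rw [hy, ← Real.rpow_mul (by positivity), one_div_mul_cancel (by positivity), Real.rpow_one]
  have h2 : A * (k : ℝ) ^ (2 * σ) ≤ lam * Real.exp (-1) := by
    calc _ ≤ A * (lam / (A * Real.exp 1)) := by gcongr
      _ = _ := by
        rw [Real.exp_neg]
        field_simp
  have h3 : lam ^ k * I ≤ lam ^ k * (H * Real.exp (-k)) := by
    calc _ ≤ H * (lam * Real.exp (-1)) ^ k := (h k).trans (by gcongr)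
      _ = _ := by
        rw [mul_pow, ← Real.exp_nat_mul]
        ring_nf
  have h4 : I ≤ H * Real.exp (-k) := by
    -- For λ = 0 there is no decay to prove: k = 0 and the bound is the case of no iterate.
    rcases hlam.eq_or_lt with h0 | h0
    · have hy1 : y = 0 := by
        rw [hy, ← h0, zero_div, Real.zero_rpow (by positivity)]
      have hk0 : k = 0 := by rw [hk, hy1, Nat.floor_zero]
      simpa [hk0] using h3
    · exact le_of_mul_le_mul_left h3 (by positivity)
  refine h4.trans ?_
  gcongr
  linarith

variable {d : ℕ}

theorem partialDeriv_conj (f : Euc d → ℂ) (i : Fin d) (x : Euc d) :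
    partialDeriv i (fun y => starRingEnd ℂ (f y)) x = starRingEnd ℂ (partialDeriv i f x) := by
  have h := Complex.conjCLE.comp_fderiv (f := f) (x := x)
  exact congrArg (fun l : Euc d →L[ℝ] ℂ => l (stdVec i)) h

theorem divOp_conj (a : Fin d → Fin d → Euc d → ℝ) (f : Euc d → ℂ) (x : Euc d) :
    divOp a (fun y => starRingEnd ℂ (f y)) x = starRingEnd ℂ (divOp a f x) := by
  simp only [divOp, map_sum, ← partialDeriv_conj, Complex.real_smul, map_mul, Complex.conj_ofReal]

variable {N : Type*} [TopologicalSpace N] [ChartedSpace (Euc d) N]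
  [IsManifold 𝓘(ℝ, Euc d) ω N] {c : OpenPartialHomeomorph N (Euc d)}

theorem IsLaplaceEigenfunction.divOp_conj_eq {g : AnalyticMetric d N} {φ : N → ℂ} {ev : ℝ}
    (hφ : IsLaplaceEigenfunction g φ ev) (hc : c ∈ analyticCharts d N) {x : Euc d}
    (hx : x ∈ c.target) :
    divOp (laplaceCoeff g c) (fun y => starRingEnd ℂ (φ (c.symm y))) x =
      -(ev : ℂ) * (volDensity g c x • starRingEnd ℂ (φ (c.symm x))) := by
  rw [divOp_conj, show (fun y => φ (c.symm y)) = φ ∘ c.symm from rfl,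
    divOp_laplaceCoeff_eq g hc hx, neg_eq_iff_eq_neg.1 (hφ.2 c hc x hx)]
  simp only [Complex.real_smul, map_mul, map_neg, Complex.conj_ofReal]
  ring

/-- The operator is symmetric for √(det g) dx, and the factor (det g)^{-1/2} cancels this density.
Each iterate is thus moved onto the eigenfunction, where it becomes multiplication by -λ; the
supports never leave that of w. -/
theorem integral_divOpIter_eq {g : AnalyticMetric d N} {φ : N → ℂ} {ev : ℝ}
    (hφ : IsLaplaceEigenfunction g φ ev) (hc : c ∈ analyticCharts d N) {w : Euc d → ℂ}
    (hw : ContDiffOn ℝ ∞ w c.target) (hwc : HasCompactSupport w) (hwt : tsupport w ⊆ c.target)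
    (k : ℕ) :
    ∫ x, divOpIter (fun x => (volDensity g c x)⁻¹) (laplaceCoeff g c) w k x *
        (volDensity g c x • starRingEnd ℂ (φ (c.symm x))) =
      (-(ev : ℂ)) ^ k * ∫ x, w x * (volDensity g c x • starRingEnd ℂ (φ (c.symm x))) := by
  have ha : ∀ i j, ContDiffOn ℝ ∞ (laplaceCoeff g c i j) c.target := fun i j =>
    (contDiffOn_laplaceCoeff g hc i j).of_le (by simp)
  have hq : ContDiffOn ℝ ∞ (fun x => (volDensity g c x)⁻¹) c.target :=
    ((contDiffOn_volDensity g hc).inv fun x hx => (volDensity_pos g hc hx).ne').of_le (by simp)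
  induction k with
  | zero => simp [divOpIter]
  | succ k ih =>
    set u := divOpIter (fun x => (volDensity g c x)⁻¹) (laplaceCoeff g c) w k with hu
    have hus : tsupport u ⊆ tsupport w := tsupport_divOpIter_subset _ _ _ _
    have hu1 : ContDiffOn ℝ ∞ u c.target := contDiffOn_divOpIter c.open_target hq ha hw k
    have hφ1 : ContDiffOn ℝ ∞ (fun x => starRingEnd ℂ (φ (c.symm x))) c.target :=
      Complex.conjCLE.contDiff.comp_contDiffOn (contDiffOn_comp_symm hc hφ.1)
    have h1 := integral_mul_divOp_comm c.open_target ha (fun i j x hx => by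
      simp only [laplaceCoeff, gramInv_isSymm g hc hx i j]) hu1 hφ1
      (hwc.of_isClosed_subset (isClosed_tsupport _) hus) (hus.trans hwt)
    have h2 : ∀ x, divOpIter (fun x => (volDensity g c x)⁻¹) (laplaceCoeff g c) w (k + 1) x *
        (volDensity g c x • starRingEnd ℂ (φ (c.symm x))) =
        starRingEnd ℂ (φ (c.symm x)) * divOp (laplaceCoeff g c) u x := by
      intro x
      by_cases hx : x ∈ c.target
      · have := (volDensity_pos g hc hx).ne'
        simp only [divOpIter, Complex.real_smul, ← hu]
        have h3 : (volDensity g c x : ℂ) ≠ 0 := by exact_mod_cast this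
        push_cast
        field_simp
      · have h3 : divOp (laplaceCoeff g c) u x = 0 := image_eq_zero_of_notMem_tsupport
          fun h => hx (hwt (hus (tsupport_divOp_subset _ _ h)))
        simp [divOpIter, ← hu, h3]
    have h4 : ∀ x, u x * divOp (laplaceCoeff g c) (fun x => starRingEnd ℂ (φ (c.symm x))) x =
        -(ev : ℂ) * (u x * (volDensity g c x • starRingEnd ℂ (φ (c.symm x)))) := by
      intro x
      by_cases hx : x ∈ c.target
      · rw [hφ.divOp_conj_eq hc hx]
        ring
      · have h3 : u x = 0 := image_eq_zero_of_notMem_tsupport fun h => hx (hwt (hus h))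
        simp [h3]
    simp only [h2]
    rw [h1]
    simp only [h4]
    rw [integral_const_mul, ih, pow_succ]
    ring

variable [CompactSpace N] [MeasurableSpace N] [BorelSpace N]

/-- The coefficients of a compactly supported Gevrey function decay exponentially. -/
theorem exists_norm_integral_le_exp (hd : 0 < d) (g : AnalyticMetric d N)
    (hc : c ∈ analyticCharts d N) {σ : ℝ} (hσ : 1 ≤ σ) {w : Euc d → ℂ}
    (hw : ContDiffOn ℝ ∞ w c.target) {K : Set (Euc d)} (hK : IsCompact K) (hKc : K ⊆ c.target)
    (hws : tsupport w ⊆ K) (hwK : IsGevreyBounded σ w K) :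
    ∃ C b : ℝ, 0 < C ∧ 0 < b ∧ ∀ (B : LaplaceEigenbasis g) (j : ℕ),
      ‖∫ x, w x * (volDensity g c x • starRingEnd ℂ (B.fn j (c.symm x)))‖ ≤
        C * Real.exp (-(b * (j : ℝ) ^ (1 / (d * σ)))) := by
  have ha : ∀ i j, ContDiffOn ℝ ω (laplaceCoeff g c i j) c.target := contDiffOn_laplaceCoeff g hc
  have hq : ContDiffOn ℝ ω (fun x => (volDensity g c x)⁻¹) c.target :=
    (contDiffOn_volDensity g hc).inv fun x hx => (volDensity_pos g hc hx).ne'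
  obtain ⟨H, A, hH, hA, hHA⟩ := exists_norm_divOpIter_le hσ c.open_target hKc
    (hq.of_le (by simp)) (fun i j => (ha i j).of_le (by simp)) hw
    (hq.isGevreyBounded c.open_target hK hKc hσ)
    (fun i j => (ha i j).isGevreyBounded c.open_target hK hKc hσ) hwK
  obtain ⟨E, hE, hEK⟩ := exists_setIntegral_norm_sq_le g hc hK hKc
  obtain ⟨S, hS⟩ := hK.exists_bound_of_continuousOn
    ((contDiffOn_volDensity g hc).continuousOn.mono hKc)
  -- All constants are fixed before the eigenbasis is introduced, which is why C and b do not depend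
  -- on it.
  obtain ⟨κ, D, hκ, hD, hW⟩ := exists_weyl_lower_bound hd g
  have hσ0 : 0 < σ := by linarith
  have hwc : HasCompactSupport w := hK.of_isClosed_subset (isClosed_tsupport _) hws
  set P := H * ((|S| + 1) * (volume.real K + E)) with hP
  have hP0 : 0 < P := by positivity
  set p := 1 / (2 * σ) with hp
  have hp0 : 0 < p := by positivity
  have hp1 : p ≤ 1 := by
    rw [hp, div_le_one (by positivity)]
    linarith
  set s := (A * Real.exp 1)⁻¹ ^ p with hs
  have hs0 : 0 < s := by positivity
  refine ⟨P * Real.exp (1 + s * D ^ p), s * κ ^ p, by positivity, by positivity,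
    fun B j => ?_⟩
  have hfn := B.isEigenfunction j
  set φ := B.fn j with hφ
  set lam := |B.eigenvalue j| with hlam
  obtain ⟨hi1, hi2⟩ := hEK φ 1 hfn.1.continuous zero_le_one (by
    have := lintegral_enorm_sq_fn B {j} 1
    simp only [Finset.sum_singleton, Pi.one_apply, one_mul, norm_one, one_pow] at this
    exact this.le)
  have h1 : ∀ k : ℕ, lam ^ k *
      ‖∫ x, w x * (volDensity g c x • starRingEnd ℂ (φ (c.symm x)))‖ ≤
      P * (A * (k : ℝ) ^ (2 * σ)) ^ k := by
    intro k
    set Mk := H * (A * (k : ℝ) ^ (2 * σ)) ^ k with hMk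
    have hMk0 : 0 ≤ Mk := by positivity
    have e1 := congrArg norm (integral_divOpIter_eq hfn hc hw hwc (hws.trans hKc) k)
    rw [norm_mul, norm_pow, norm_neg, Complex.norm_real, Real.norm_eq_abs] at e1
    rw [← e1, ← setIntegral_eq_integral_of_forall_compl_eq_zero (s := K) fun x hx => by
      rw [image_eq_zero_of_notMem_tsupport fun h =>
        hx (hws (tsupport_divOpIter_subset _ _ _ _ h)), zero_mul]]
    have e0 : IntegrableOn (fun _ : Euc d => (1 : ℝ)) K := integrableOn_const hK.measure_lt_top.ne
    have e2 : IntegrableOn (fun x => Mk * ((|S| + 1) * (1 + ‖φ (c.symm x)‖ ^ 2))) K :=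
      ((e0.add hi1).const_mul _).const_mul _
    refine (norm_integral_le_of_norm_le e2 ?_).trans ?_
    · refine (ae_restrict_iff' hK.measurableSet).2 (ae_of_all _ fun x hx => ?_)
      rw [norm_mul, norm_smul, RCLike.norm_conj]
      have e3 := hS x hx
      have e4 := le_abs_self S
      -- This elementary bound replaces Cauchy-Schwarz: its right-hand side has integral at most vol
      -- K + E, as φ is normalized.
      have e5 : ‖φ (c.symm x)‖ ≤ 1 + ‖φ (c.symm x)‖ ^ 2 := by
        nlinarith [sq_nonneg (‖φ (c.symm x)‖ - 1)]
      refine mul_le_mul (hHA k x hx) (mul_le_mul (by linarith) e5 (norm_nonneg _)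
        (by positivity)) (by positivity) hMk0
    · rw [integral_const_mul, integral_const_mul,
        integral_add e0 hi1, setIntegral_const,
        smul_eq_mul, mul_one]
      calc _ ≤ Mk * ((|S| + 1) * (volume.real K + E)) := by
            gcongr
            linarith
        _ = _ := by
            rw [hMk, hP]
            ring
  have h2 := le_exp_of_forall_pow_mul_le hP0 hA (abs_nonneg _) hσ0 h1
  -- As p = 1/(2σ) ≤ 1, the power t ↦ t^p is subadditive. The additive error D of the Weyl bound
  -- therefore only contributes the constant factor exp(s D^p).
  have h3 : κ ^ p * (j : ℝ) ^ (1 / (d * σ)) ≤ lam ^ p + D ^ p := by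
    calc κ ^ p * (j : ℝ) ^ (1 / (d * σ)) = (κ * (j : ℝ) ^ (2 / (d : ℝ))) ^ p := by
          rw [Real.mul_rpow hκ.le (by positivity), ← Real.rpow_mul (by positivity)]
          congr 2
          rw [hp]
          field_simp
      _ ≤ (lam + D) ^ p := by
          gcongr
          exact hW B j
      _ ≤ _ := Real.rpow_add_le_add_rpow (abs_nonneg _) hD hp0.le hp1
  have h4 : (lam / (A * Real.exp 1)) ^ p = s * lam ^ p := by
    rw [div_eq_mul_inv, Real.mul_rpow (abs_nonneg _) (by positivity), mul_comm]
  refine h2.trans ?_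
  rw [← hp, h4, mul_assoc P, ← Real.exp_add]
  gcongr
  have := mul_le_mul_of_nonneg_left h3 hs0.le
  nlinarith

end Decay

/-! ### Multiplication by the cutoff and transport to the manifold -/

section Cutoff

variable {d : ℕ}

/-- Expansion in the standard basis has d^k terms; in Gevrey bounds this factor goes into the
constant L^k. -/
theorem norm_multilinear_le_of_components {V : Type*} [NormedAddCommGroup V] [NormedSpace ℝ V]
    {k : ℕ} (Φ : ContinuousMultilinearMap ℝ (fun _ : Fin k => Euc d) V) {M : ℝ} (hM : 0 ≤ M)
    (h : ∀ I : Fin k → Fin d, ‖Φ fun m => stdVec (I m)‖ ≤ M) : ‖Φ‖ ≤ d ^ k * M := by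
  refine ContinuousMultilinearMap.opNorm_le_bound (by positivity) fun v => ?_
  have e1 : Φ v = ∑ I : Fin k → Fin d, (∏ m, v m (I m)) • Φ fun m => stdVec (I m) := by
    calc Φ v = Φ fun m => ∑ i, v m i • stdVec i := by simp only [sum_smul_stdVec]
      _ = ∑ I : Fin k → Fin d, Φ fun m => v m (I m) • stdVec (I m) := Φ.map_sum _
      _ = _ := Finset.sum_congr rfl fun I _ => Φ.map_smul_univ _ _
  rw [e1]
  refine (norm_sum_le _ _).trans ?_
  calc _ ≤ ∑ _I : Fin k → Fin d, (∏ m, ‖v m‖) * M := by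
        refine Finset.sum_le_sum fun I _ => ?_
        rw [norm_smul, norm_prod]
        gcongr with m
        · exact PiLp.norm_apply_le (v m) (I m)
        · exact h I
    _ = _ := by
        simp only [Finset.sum_const, Finset.card_univ, Fintype.card_fun, Fintype.card_fin,
          nsmul_eq_mul]
        push_cast
        ring

theorem IsGevreyOn.isGevreyBounded {σ : ℝ} (hσ : 0 ≤ σ) {f : Euc d → ℂ} {W K : Set (Euc d)}
    (hf : IsGevreyOn σ f W) (hK : IsCompact K) (hKW : K ⊆ W) : IsGevreyBounded σ f K := by
  obtain ⟨C, hC, h⟩ := hf.2 K hK hKW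
  refine ⟨C, (d + 1) * C * Real.exp σ, hC, by positivity, fun k x hx => ?_⟩
  refine (norm_multilinear_le_of_components _ (by positivity) fun I => h k I x hx).trans ?_
  calc (d : ℝ) ^ k * (C ^ (1 + k) * (k : ℝ) ^ (σ * k))
      ≤ (d + 1) ^ k * (C ^ (1 + k) * (Real.exp σ ^ k * (k.factorial : ℝ) ^ σ)) := by
        gcongr
        · linarith
        · exact rpow_mul_le_factorial_rpow hσ k
    _ = _ := by
        rw [mul_pow, mul_pow]
        ring

theorem IsGevreyBounded.congr {V : Type*} [NormedAddCommGroup V] [NormedSpace ℝ V] {σ : ℝ}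
    {f f' : Euc d → V} {W K : Set (Euc d)} (hW : IsOpen W) (hKW : K ⊆ W)
    (h : IsGevreyBounded σ f K) (hff : Set.EqOn f' f W) : IsGevreyBounded σ f' K := by
  obtain ⟨H, L, hH, hL, hb⟩ := h
  refine ⟨H, L, hH, hL, fun k x hx => ?_⟩
  have heq : f' =ᶠ[𝓝 x] f := hff.eventuallyEq_of_mem (hW.mem_nhds (hKW hx))
  rw [(Filter.EventuallyEq.iteratedFDeriv ℝ heq k).eq_of_nhds]
  exact hb k x hx

theorem IsGevreyBounded.mul {σ : ℝ} (hσ : 1 ≤ σ) {b f : Euc d → ℂ} {W K : Set (Euc d)}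
    (hW : IsOpen W) (hKW : K ⊆ W) (hb : ContDiffOn ℝ ∞ b W) (hf : ContDiffOn ℝ ∞ f W)
    (hbK : IsGevreyBounded σ b K) (hfK : IsGevreyBounded σ f K) :
    IsGevreyBounded σ (fun x => b x * f x) K := by
  obtain ⟨R, M, hR, hM, h⟩ := hbK.exists_gevreySumLE
  obtain ⟨R', M', hR', hM', h'⟩ := hfK.exists_gevreySumLE
  have hR0 : 0 < min R R' := lt_min hR hR'
  exact GevreySumLE.isGevreyBounded hR0 (mul_pos hM hM') fun x hx =>
    ((h x hx).mono hR0.le (min_le_left _ _) le_rfl).smul hσ hR0.le hW hb hf (hKW hx)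
      ((h' x hx).mono hR0.le (min_le_right _ _) le_rfl)

variable {N : Type*} [TopologicalSpace N] {c : OpenPartialHomeomorph N (Euc d)}

theorem isCompact_image_tsupport [CompactSpace N] {χ : N → ℂ} (hχ : tsupport χ ⊆ c.source) :
    IsCompact (c '' tsupport χ) :=
  (isClosed_tsupport χ).isCompact.image_of_continuousOn (c.continuousOn.mono hχ)

theorem image_tsupport_subset {χ : N → ℂ} (hχ : tsupport χ ⊆ c.source) :
    c '' tsupport χ ⊆ c.target := by
  rintro _ ⟨p, hp, rfl⟩
  exact c.map_source (hχ hp)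

theorem symm_eq_zero_of_notMem {χ : N → ℂ} {x : Euc d} (hx : x ∈ c.target)
    (hx' : x ∉ c '' tsupport χ) : χ (c.symm x) = 0 :=
  image_eq_zero_of_notMem_tsupport fun h => hx' ⟨_, h, c.right_inv hx⟩

section Chart

variable (c)

open scoped Classical in
/-- The chart `c`, extended by zero. -/
noncomputable def chartExt : N → Euc d := c.source.piecewise c fun _ => 0

theorem chartExt_of_mem {p : N} (hp : p ∈ c.source) : chartExt c p = c p := by
  simp [chartExt, hp]

theorem mul_comp_chartExt {χ : N → ℂ} (hχ : tsupport χ ⊆ c.source) (v : Euc d → ℂ) (p : N) :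
    χ p * v (chartExt c p) = χ p * v (c p) := by
  by_cases hp : p ∈ c.source
  · rw [chartExt_of_mem c hp]
  · rw [image_eq_zero_of_notMem_tsupport fun h => hp (hχ h), zero_mul, zero_mul]

variable [MeasurableSpace N] [BorelSpace N]

open scoped Classical in
theorem measurable_chartExt : Measurable (chartExt c) := by
  exact c.continuousOn.measurable_piecewise continuousOn_const c.open_source.measurableSet

end Chart

variable [ChartedSpace (Euc d) N] [IsManifold 𝓘(ℝ, Euc d) ω N]

section Chart

variable [MeasurableSpace N] [BorelSpace N]

/-- Null sets in the chart pull back to null sets on N, so composing with the chart is well defined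
on classes of functions modulo null sets. -/
theorem quasiMeasurePreserving_chartExt (g : AnalyticMetric d N) (hc : c ∈ analyticCharts d N) :
    Measure.QuasiMeasurePreserving (chartExt c) ((riemannianVolume g).restrict c.source)
      (volume.restrict c.target) := by
  refine ⟨measurable_chartExt c, Measure.AbsolutelyContinuous.mk fun A hA h0 => ?_⟩
  rw [Measure.map_apply (measurable_chartExt c) hA, riemannianVolume_restrict_source g hc,
    chartVolume_apply g c (measurable_chartExt c hA)]
  rw [Measure.restrict_apply hA] at h0
  refine setLIntegral_measure_zero _ _ (measure_mono_null ?_ h0)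
  rintro x ⟨hx, hx'⟩
  have hx'' : chartExt c (c.symm x) ∈ A := hx'
  rw [chartExt_of_mem c (c.map_target hx), c.right_inv hx] at hx''
  exact ⟨hx'', hx⟩

theorem ae_eq_mul_comp_chart (g : AnalyticMetric d N) (hc : c ∈ analyticCharts d N) {χ : N → ℂ}
    (hχ : tsupport χ ⊆ c.source) {v v' : Euc d → ℂ} (h : v =ᵐ[volume.restrict c.target] v') :
    (fun p => χ p * v (c p)) =ᵐ[riemannianVolume g] fun p => χ p * v' (c p) := by
  have h1 := (quasiMeasurePreserving_chartExt g hc).ae h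
  rw [ae_restrict_iff' c.open_source.measurableSet] at h1
  filter_upwards [h1] with p hp
  by_cases hs : p ∈ c.source
  · rw [← chartExt_of_mem c hs, hp hs]
  · rw [image_eq_zero_of_notMem_tsupport fun h => hs (hχ h), zero_mul, zero_mul]

theorem integral_source_riemannianVolume (g : AnalyticMetric d N) (hc : c ∈ analyticCharts d N)
    {f : N → ℂ} (hf : AEStronglyMeasurable f (riemannianVolume g)) :
    ∫ p in c.source, f p ∂(riemannianVolume g) =
      ∫ x in c.target, volDensity g c x • f (c.symm x) := by
  have h1 : AEStronglyMeasurable f (chartVolume g c) := by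
    rw [← riemannianVolume_restrict_source g hc]
    exact hf.restrict
  rw [riemannianVolume_restrict_source g hc, chartVolume,
    integral_map (aemeasurable_symm_withDensity g c) h1,
    integral_withDensity_eq_integral_toReal_smul₀ (measurable_ofReal_volDensity g hc)
      (ae_of_all _ fun x => ENNReal.ofReal_lt_top)]
  simp only [volDensity, ENNReal.toReal_ofReal (Real.sqrt_nonneg _)]

end Chart

variable [MeasurableSpace N] [BorelSpace N]

/-- The cutoff lives in one chart, so each coefficient is a single coordinate integral, in the form
to which the decay estimate applies. -/
theorem LaplaceEigenbasis.inner_eq_integral {g : AnalyticMetric d N} (B : LaplaceEigenbasis g)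
    (hc : c ∈ analyticCharts d N) {χ : N → ℂ} (hχ : tsupport χ ⊆ c.source) {u : RiemL2 g}
    {f : Euc d → ℂ} (hu : u =ᵐ[riemannianVolume g] fun p => χ p * f (c p)) (j : ℕ) :
    inner ℂ (B.basis j) u = ∫ x, c.target.indicator (fun x => χ (c.symm x) * f x) x *
      (volDensity g c x • starRingEnd ℂ (B.fn j (c.symm x))) := by
  have h1 : (fun p => inner ℂ (B.basis j p) (u p)) =ᵐ[riemannianVolume g]
      fun p => χ p * f (c p) * starRingEnd ℂ (B.fn j p) := by
    filter_upwards [hu, B.basis_ae_eq j] with p e1 e2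
    rw [RCLike.inner_apply, e1, e2]
  rw [L2.inner_def, integral_congr_ae h1, ← setIntegral_eq_integral_of_forall_compl_eq_zero
    (s := c.source) fun p hp => by
      rw [image_eq_zero_of_notMem_tsupport fun h => hp (hχ h), zero_mul, zero_mul],
    integral_source_riemannianVolume g hc
      ((L2.integrable_inner (𝕜 := ℂ) (B.basis j) u).aestronglyMeasurable.congr h1)]
  symm
  rw [← setIntegral_eq_integral_of_forall_compl_eq_zero (s := c.target) fun x hx => by
      rw [Set.indicator_of_notMem hx, zero_mul]]
  refine setIntegral_congr_fun c.open_target.measurableSet fun x hx => ?_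
  simp only [Set.indicator_of_mem hx, c.right_inv hx, Complex.real_smul]
  ring

variable [CompactSpace N]

/-- χ is bounded, and the density is bounded on the compact image of its support. Measurability goes
through `chartExt`, since `c` is arbitrary off its source. -/
theorem exists_lintegral_mul_comp_chart_le (g : AnalyticMetric d N) (hc : c ∈ analyticCharts d N)
    {χ : N → ℂ} (hχc : Continuous χ) (hχ : tsupport χ ⊆ c.source) :
    ∃ Q : ℝ, 0 ≤ Q ∧ ∀ v : Euc d → ℂ, Measurable v →
      ∫⁻ p, ‖χ p * v (c p)‖ₑ ^ 2 ∂(riemannianVolume g) ≤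
        ENNReal.ofReal (Q ^ 2) * ∫⁻ x in c.target, ‖v x‖ₑ ^ 2 := by
  obtain ⟨M, hM⟩ := isCompact_univ.exists_bound_of_continuousOn hχc.continuousOn
  obtain ⟨S, hS⟩ := (isCompact_image_tsupport hχ).exists_bound_of_continuousOn
    ((contDiffOn_volDensity g hc).continuousOn.mono (image_tsupport_subset hχ))
  refine ⟨Real.sqrt (|S| * M ^ 2), Real.sqrt_nonneg _, fun v hv => ?_⟩
  rw [Real.sq_sqrt (by positivity)]
  have hmeas : Measurable fun p => ‖χ p * v (chartExt c p)‖ₑ ^ 2 :=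
    ((hχc.measurable.mul (hv.comp (measurable_chartExt c))).enorm).pow_const 2
  have hs : c.source ∩ c ⁻¹' c.target = c.source :=
    Set.inter_eq_left.2 fun p hp => c.map_source hp
  have h1 := setLIntegral_riemannianVolume g hc hmeas c.open_target.measurableSet subset_rfl
  rw [hs] at h1
  simp only [← mul_comp_chartExt c hχ v]
  rw [← setLIntegral_eq_of_support_subset (s := c.source), h1, ← lintegral_const_mul _ (by fun_prop)]
  · refine setLIntegral_mono' c.open_target.measurableSet fun x hx => ?_
    rw [mul_comp_chartExt c hχ, c.right_inv hx, enorm_sq_eq_ofReal, enorm_sq_eq_ofReal, norm_mul,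
      ← ENNReal.ofReal_mul (volDensity_pos g hc hx).le, ← ENNReal.ofReal_mul (by positivity)]
    refine ENNReal.ofReal_le_ofReal ?_
    by_cases hxK : x ∈ c '' tsupport χ
    · have e1 := (le_abs_self _).trans ((hS x hxK).trans (le_abs_self S))
      have e2 := hM (c.symm x) trivial
      calc volDensity g c x * (‖χ (c.symm x)‖ * ‖v x‖) ^ 2
          ≤ |S| * (M * ‖v x‖) ^ 2 := by gcongr
        _ = _ := by ring
    · rw [symm_eq_zero_of_notMem hx hxK]
      simp only [norm_zero, zero_mul, ne_eq, OfNat.ofNat_ne_zero, not_false_eq_true, zero_pow,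
        mul_zero]
      positivity
  · intro p hp
    by_contra hps
    exact hp (by simp [image_eq_zero_of_notMem_tsupport fun h => hps (hχ h)])

/-- Multiplication by `χ`, from `L²` of the range of the chart to `L²(N)`. -/
theorem exists_cutoff_operator (g : AnalyticMetric d N) (hc : c ∈ analyticCharts d N)
    {χ : N → ℂ} (hχc : Continuous χ) (hχ : tsupport χ ⊆ c.source) :
    ∃ Φ : L2 c.target →L[ℂ] RiemL2 g,
      ∀ v : L2 c.target, Φ v =ᵐ[riemannianVolume g] fun p => χ p * v (c p) := by
  obtain ⟨Q, hQ, hb⟩ := exists_lintegral_mul_comp_chart_le g hc hχc hχ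
  have hb' : ∀ v : L2 c.target, ∫⁻ p, ‖χ p * v (c p)‖ₑ ^ 2 ∂(riemannianVolume g) ≤
      ENNReal.ofReal ((Q * ‖v‖) ^ 2) := by
    intro v
    refine (hb v (Lp.stronglyMeasurable v).measurable).trans_eq ?_
    rw [lintegral_enorm_sq_eq_norm_sq, ← ENNReal.ofReal_mul (by positivity), mul_pow]
  have hL : ∀ v : L2 c.target, MemLp (fun p => χ p * v (c p)) 2 (riemannianVolume g) := by
    intro v
    constructor
    · simp only [← mul_comp_chartExt c hχ]
      exact (hχc.measurable.mul ((Lp.stronglyMeasurable v).measurable.comp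
        (measurable_chartExt c))).aestronglyMeasurable
    · rw [eLpNorm_lt_top_iff_lintegral_rpow_enorm_lt_top (by norm_num) (by norm_num)]
      simp only [ENNReal.toReal_ofNat, ENNReal.rpow_ofNat]
      exact (hb' v).trans_lt ENNReal.ofReal_lt_top
  let Φ : L2 c.target →ₗ[ℂ] RiemL2 g :=
    { toFun := fun v => (hL v).toLp _
      map_add' := fun v v' => by
        refine Lp.ext ?_
        filter_upwards [(hL (v + v')).coeFn_toLp, Lp.coeFn_add ((hL v).toLp _) ((hL v').toLp _),
          (hL v).coeFn_toLp, (hL v').coeFn_toLp,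
          ae_eq_mul_comp_chart g hc hχ (Lp.coeFn_add v v')] with p h1 h2 h3 h4 h5
        rw [h1, h2, Pi.add_apply, h3, h4, h5, Pi.add_apply]
        ring
      map_smul' := fun a v => by
        refine Lp.ext ?_
        filter_upwards [(hL (a • v)).coeFn_toLp, Lp.coeFn_smul a ((hL v).toLp _),
          (hL v).coeFn_toLp, ae_eq_mul_comp_chart g hc hχ (Lp.coeFn_smul a v)] with p h1 h2 h3 h4
        rw [RingHom.id_apply, h1, h2, Pi.smul_apply, h3, h4, Pi.smul_apply, smul_eq_mul,
          smul_eq_mul]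
        ring }
  refine ⟨Φ.mkContinuous Q fun v => ?_, fun v => (hL v).coeFn_toLp⟩
  have h1 := lintegral_enorm_sq_eq_norm_sq (Φ v)
  rw [lintegral_congr_ae (g := fun p => ‖χ p * v (c p)‖ₑ ^ 2) (by
    filter_upwards [(hL v).coeFn_toLp] with p hp
    exact congrArg (fun z => ‖z‖ₑ ^ 2) hp)] at h1
  have h2 := (h1.symm.le.trans (hb' v))
  rw [ENNReal.ofReal_le_ofReal_iff (by positivity)] at h2
  exact (sq_le_sq₀ (norm_nonneg _) (by positivity)).1 h2

/-- The coefficients of `χ f` decay exponentially if `χ` and `f` are Gevrey functions. -/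
theorem exists_norm_inner_le_exp (hd : 0 < d) (g : AnalyticMetric d N)
    (hc : c ∈ analyticCharts d N) {σ : ℝ} (hσ : 1 ≤ σ) {χ : N → ℂ} (hχG : IsGevrey g σ χ)
    (hχ : tsupport χ ⊆ c.source) {f : Euc d → ℂ} (hf : IsGevreyOn σ f c.target) {u : RiemL2 g}
    (hu : u =ᵐ[riemannianVolume g] fun p => χ p * f (c p)) :
    ∃ C b : ℝ, 0 < C ∧ 0 < b ∧ ∀ (B : LaplaceEigenbasis g) (j : ℕ),
      ‖inner ℂ (B.basis j) u‖ ≤ C * Real.exp (-(b * (j : ℝ) ^ (1 / (d * σ)))) := by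
  have hK := isCompact_image_tsupport hχ
  have hKc := image_tsupport_subset hχ
  have hχ1 := contDiffOn_comp_symm hc hχG.1
  have heq : Set.EqOn (c.target.indicator fun x => χ (c.symm x) * f x)
      (fun x => (χ ∘ c.symm) x * f x) c.target := fun x hx => Set.indicator_of_mem hx _
  have hs : tsupport (c.target.indicator fun x => χ (c.symm x) * f x) ⊆ c '' tsupport χ := by
    refine closure_minimal (fun x hx => ?_) hK.isClosed
    by_contra hxK
    refine hx ?_
    by_cases hxt : x ∈ c.target
    · rw [Set.indicator_of_mem hxt, symm_eq_zero_of_notMem hxt hxK, zero_mul]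
    · exact Set.indicator_of_notMem hxt _
  obtain ⟨C, b, hC, hb, h⟩ := exists_norm_integral_le_exp hd g hc hσ
    ((hχ1.mul hf.1).congr heq) hK hKc hs
    (((hχG.isGevreyBounded hσ hc hK hKc).mul hσ c.open_target hKc hχ1 hf.1
      (hf.isGevreyBounded (by linarith) hK hKc)).congr c.open_target hKc heq)
  refine ⟨C, b, hC, hb, fun B j => ?_⟩
  rw [B.inner_eq_integral hc hχ hu]
  exact h B j

end Cutoff

/-! ### Uniform decay by Baire category -/

section UniformDecay

theorem summable_exp_neg_mul_rpow {b s : ℝ} (hb : 0 < b) (hs : 0 < s) :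
    Summable fun j : ℕ => Real.exp (-(b * (j : ℝ) ^ s)) := by
  have h1 : Filter.Tendsto (fun j : ℕ => (j : ℝ) ^ s) Filter.atTop Filter.atTop :=
    (tendsto_rpow_atTop hs).comp tendsto_natCast_atTop_atTop
  have h2 := (isLittleO_exp_neg_mul_rpow_atTop hb (-2 / s)).isBigO.comp_tendsto h1
  refine summable_of_isBigO_nat (Real.summable_nat_rpow.2 (by norm_num : (-2 : ℝ) < -1))
    (h2.congr (fun j => ?_) fun j => ?_)
  · simp only [Function.comp_apply, neg_mul]
  · rw [Function.comp_apply, ← Real.rpow_mul (Nat.cast_nonneg j), mul_div_cancel₀ _ hs.ne']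

/-- If each vector has exponentially small coefficients, then so they are uniformly. -/
theorem exists_uniform_exp_bound {X H ι : Type*} [NormedAddCommGroup X] [NormedSpace ℂ X]
    [CompleteSpace X] [NormedAddCommGroup H] [InnerProductSpace ℂ H] (Φ : X →L[ℂ] H)
    (v : ι → H) {τ : ι → ℝ} (hτ : ∀ i, 0 ≤ τ i)
    (h : ∀ u, ∃ C b : ℝ, 0 < C ∧ 0 < b ∧ ∀ i,
      ‖inner ℂ (v i) (Φ u)‖ ≤ C * Real.exp (-(b * τ i))) :
    ∃ C b : ℝ, 0 < C ∧ 0 < b ∧ ∀ u i,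
      ‖inner ℂ (v i) (Φ u)‖ ≤ C * ‖u‖ * Real.exp (-(b * τ i)) := by
  -- A single integer controls both constants: C ≤ m + 1 and b ≥ 1/(m + 1). These sets are closed
  -- and cover X, so by completeness one of them contains a ball.
  let E : ℕ → Set X := fun m =>
    {u | ∀ i, ‖inner ℂ (v i) (Φ u)‖ ≤ (m + 1) * Real.exp (-((1 / ((m : ℝ) + 1)) * τ i))}
  have hE : ∀ m, IsClosed (E m) := by
    intro m
    simp only [E, Set.ofPred_forall]
    exact isClosed_iInter fun i => isClosed_le (by fun_prop) continuous_const
  have hU : ⋃ m, E m = Set.univ := by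
    refine Set.eq_univ_of_forall fun u => Set.mem_iUnion.2 ?_
    obtain ⟨C, b, hC, hb, hu⟩ := h u
    obtain ⟨m, hm⟩ := exists_nat_ge (max C (1 / b))
    refine ⟨m, fun i => (hu i).trans ?_⟩
    have e1 : C ≤ m + 1 := (le_max_left _ _).trans (hm.trans (by linarith))
    have e2 : 1 / ((m : ℝ) + 1) ≤ b := by
      rw [one_div_le (by positivity) hb]
      exact (le_max_right _ _).trans (hm.trans (by linarith))
    gcongr
    exact hτ i
  obtain ⟨m, u₀, hu₀⟩ := nonempty_interior_of_iUnion_of_closed hE hU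
  obtain ⟨ε, hε, hball⟩ := Metric.nhds_basis_closedBall.mem_iff.1 (mem_interior_iff_mem_nhds.1 hu₀)
  refine ⟨2 * (m + 1) / ε, 1 / ((m : ℝ) + 1), by positivity, by positivity, fun u i => ?_⟩
  set t := (m + 1) * Real.exp (-((1 / ((m : ℝ) + 1)) * τ i)) with ht
  let l : X →ₗ[ℂ] ℂ := (innerSL ℂ (v i)).toLinearMap ∘ₗ Φ.toLinearMap
  -- Both u₀ + z and u₀ lie in E m, so their difference z satisfies twice the bound; homogeneity
  -- extends this from the ball to X.
  have hl : ∀ z ∈ Metric.closedBall (0 : X) ε, ‖l z‖ ≤ 2 * t := by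
    intro z hz
    have e1 : ‖l (u₀ + z)‖ ≤ t := hball (by simpa using hz) i
    have e2 : ‖l u₀‖ ≤ t := hball (Metric.mem_closedBall_self hε.le) i
    have e3 : l z = l (u₀ + z) - l u₀ := by rw [map_add, add_sub_cancel_left]
    rw [e3]
    exact (norm_sub_le _ _).trans (by linarith)
  refine (LinearMap.bound_of_ball_bound' hε _ l hl u).trans_eq ?_
  rw [ht]
  ring

end UniformDecay

/-! ### Assembly of the operator into A^{σ,ρ} -/

section Assembly

variable {d : ℕ} {N : Type*} [TopologicalSpace N] [ChartedSpace (Euc d) N]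
  [IsManifold 𝓘(ℝ, Euc d) ω N] [MeasurableSpace N] {g : AnalyticMetric d N}

/-- An operator with uniformly exponentially small coefficients maps into `A^{σ,ρ}`. -/
theorem exists_operator_spaceA (hd : 0 < d) {X : Type*} [NormedAddCommGroup X] [NormedSpace ℂ X]
    (Φ : X →L[ℂ] RiemL2 g) {σ C b : ℝ} (hσ : 0 < σ) (hC : 0 ≤ C) (hb : 0 < b)
    (B : LaplaceEigenbasis g)
    (h : ∀ u j, ‖inner ℂ (B.basis j) (Φ u)‖ ≤
      C * ‖u‖ * Real.exp (-(b * (j : ℝ) ^ (1 / (d * σ))))) :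
    ∃ Ψ : X →L[ℂ] SpaceA B σ (b / 2), ∀ u, (Ψ u).val = Φ u := by
  have hs : 0 < 1 / (d * σ) := by positivity
  have hsum := summable_exp_neg_mul_rpow hb hs
  -- With ρ = b/2 the weight is e^y and the squared coefficient at most a constant times e^{-2y},
  -- where y = b j^{1/(dσ)}; the remaining e^{-y} is summable.
  have hle : ∀ u (j : ℕ), Real.exp (2 * (b / 2) * (j : ℝ) ^ (1 / (d * σ))) *
      ‖inner ℂ (B.basis j) (Φ u)‖ ^ 2 ≤
      (C * ‖u‖) ^ 2 * Real.exp (-(b * (j : ℝ) ^ (1 / (d * σ)))) := by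
    intro u j
    set y := b * (j : ℝ) ^ (1 / (d * σ)) with hy
    have e1 : 2 * (b / 2) * (j : ℝ) ^ (1 / (d * σ)) = y := by rw [hy]; ring
    rw [e1]
    calc _ ≤ Real.exp y * (C * ‖u‖ * Real.exp (-y)) ^ 2 := by
          gcongr
          exact h u j
      _ = (C * ‖u‖) ^ 2 * Real.exp (-y) * (Real.exp y * Real.exp (-y)) := by ring
      _ = _ := by rw [← Real.exp_add, add_neg_cancel, Real.exp_zero, mul_one]
  have hmem : ∀ u, MemA B σ (b / 2) (Φ u) := fun u =>
    Summable.of_nonneg_of_le (fun j => by positivity) (hle u) (hsum.mul_left _)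
  let Ψ : X →ₗ[ℂ] SpaceA B σ (b / 2) :=
    { toFun := fun u => (⟨Φ u, hmem u⟩ : submoduleA B σ (b / 2))
      map_add' := fun u v => Subtype.ext (map_add Φ u v)
      map_smul' := fun a u => Subtype.ext (map_smul Φ a u) }
  refine ⟨Ψ.mkContinuous (C * Real.sqrt (∑' j : ℕ, Real.exp (-(b * (j : ℝ) ^ (1 / (d * σ))))))
    fun u => ?_, fun u => rfl⟩
  calc ‖Ψ u‖ ≤ Real.sqrt ((C * ‖u‖) ^ 2 *
        ∑' j : ℕ, Real.exp (-(b * (j : ℝ) ^ (1 / (d * σ))))) := by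
        refine Real.sqrt_le_sqrt ?_
        rw [← tsum_mul_left]
        exact (hmem u).tsum_le_tsum (hle u) (hsum.mul_left _)
    _ = _ := by
        rw [Real.sqrt_mul (by positivity), Real.sqrt_sq (by positivity)]
        ring

/-- Multiplication by a Gevrey cutoff, after an operator with Gevrey values, maps into
`A^{σ,ρ}`. -/
theorem exists_cutoff_comp_spaceA [CompactSpace N] [BorelSpace N] (hd : 0 < d)
    {c : OpenPartialHomeomorph N (Euc d)} (hc : c ∈ analyticCharts d N) {Y : Set (Euc d)}
    (hY : c.target = Y) {X : Type*} [NormedAddCommGroup X] [NormedSpace ℂ X] [CompleteSpace X]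
    {σ : ℝ} (hσ : 1 ≤ σ) (F : X →L[ℂ] L2 Y)
    (hF : ∀ u, ∃ f : Euc d → ℂ, IsGevreyOn σ f Y ∧ F u =ᵐ[volume.restrict Y] f)
    {χ : N → ℂ} (hχ : IsGevrey g σ χ) (hχY : tsupport χ ⊆ c.source) :
    ∃ ρ : ℝ, 0 < ρ ∧ ∀ B : LaplaceEigenbasis g, ∃ χF : X →L[ℂ] SpaceA B σ ρ,
      ∀ u, (χF u).val =ᵐ[riemannianVolume g] fun p => χ p * F u (c p) := by
  subst hY
  obtain ⟨Φ, hΦ⟩ := exists_cutoff_operator g hc hχ.1.continuous hχY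
  have hdecay : ∀ u, ∃ C b : ℝ, 0 < C ∧ 0 < b ∧ ∀ i : LaplaceEigenbasis g × ℕ,
      ‖inner ℂ (i.1.basis i.2) ((Φ ∘L F) u)‖ ≤
        C * Real.exp (-(b * (i.2 : ℝ) ^ (1 / (d * σ)))) := by
    intro u
    obtain ⟨f, hf, hfu⟩ := hF u
    obtain ⟨C, b, hC, hb, h⟩ := exists_norm_inner_le_exp hd g hc hσ hχ hχY hf
      ((hΦ (F u)).trans (ae_eq_mul_comp_chart g hc hχY hfu))
    exact ⟨C, b, hC, hb, fun i => h i.1 i.2⟩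
  -- The index runs through all eigenbases together with all j, so one b, hence one ρ, serves every
  -- eigenbasis.
  obtain ⟨C, b, hC, hb, h⟩ := exists_uniform_exp_bound (Φ ∘L F)
    (fun i : LaplaceEigenbasis g × ℕ => i.1.basis i.2)
    (fun i => Real.rpow_nonneg (Nat.cast_nonneg i.2) _) hdecay
  refine ⟨b / 2, by positivity, fun B => ?_⟩
  obtain ⟨Ψ, hΨ⟩ := exists_operator_spaceA hd (Φ ∘L F) (by linarith) hC.le hb B
    fun u j => h u (B, j)
  refine ⟨Ψ, fun u => ?_⟩
  rw [hΨ u]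
  exact hΦ (F u)

end Assembly

theorem mainTheorem3 (n : ℕ) [NeZero n] (T r σ : ℝ) (hT : 0 < T) (hr : r ∈ Set.Ioo (0 : ℝ) 1)
    (hσ : 1 < σ)
    {N : Type*} [TopologicalSpace N] [T2Space N] [CompactSpace N]
    [MeasurableSpace N] [BorelSpace N]
    [ChartedSpace (Euc (n + 1)) N] [IsManifold 𝓘(ℝ, Euc (n + 1)) ω N]
    (g : AnalyticMetric (n + 1) N)
    -- `Y` is an open submanifold of `N`, through the inverse of the analytic chart `e`
    (e : OpenPartialHomeomorph N (Euc (n + 1))) (he : e ∈ analyticCharts (n + 1) N)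
    (heY : e.target = domainY n T r)
    (F : L2 (domainXPlus n T) →L[ℂ] L2 (domainY n T r))
    (hF : ∀ u, ∃ f : Euc (n + 1) → ℂ, IsGevreyOn σ f (domainY n T r) ∧
      F u =ᵐ[volume.restrict (domainY n T r)] f)
    (χ : N → ℂ) (hχ : IsGevrey g σ χ) (hχY : tsupport χ ⊆ e.source) :
    ∃ ρ : ℝ, 0 < ρ ∧ ∀ B : LaplaceEigenbasis g,
      ∃ χF : L2 (domainXPlus n T) →L[ℂ] SpaceA B σ ρ,
        ∀ u, (χF u).val =ᵐ[riemannianVolume g] fun p => χ p * F u (e p) :=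
  exists_cutoff_comp_spaceA n.succ_pos he heY hσ.le F hF hχ hχY
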